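/- Let $d\ge 1$ and let $\Omega\subset\mathbb R^d$ be bounded with $\Omega=\operatorname{int}\overline\Omega$ (for instance a bounded Lipschitz domain). Write $\langle\cdot,\cdot\rangle$ and $\|\cdot\|$ for the inner product and norm of $L^2(\Omega)$ or $L^2(\Omega)^d$. A mesh $\mathcal T_h$ of $\Omega$ is a finite conforming decomposition of $\overline\Omega$ into closed $d$-simplices; it is $\sigma$-shape-regular if $h_T\le\sigma\rho_T$ for every $T\in\mathcal T_h$, where $h_T$ is the diameter of $T$ and $\rho_T$ the diameter of the largest ball contained in $T$. Let $W_h\subset L^2(\Omega)$ be the space of functions that are constant on every $T\in\mathcal T_h$, and $V_h=\{\mathbf v\in H(\mathrm{div};\Omega): \mathbf v|_T(\mathbf x)=\mathbf a_T+b_T\mathbf x,\ \mathbf a_T\in\mathbb R^d,\ b_T\in\mathbb R,\ \text{for all } T\in\mathcal T_h\}$. Let $s,a,f_w,f_2:\mathbb R\to\mathbb R$ and $\mathbf f_1,\mathbf f_3:\mathbb R\to\mathbb R^d$ be Lipschitz continuous with Lipschitz constants $L_s,L_a,L_{f_w},L_{f_2},L_{\mathbf f_1},L_{\mathbf f_3}$;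 let $s$ be nondecreasing with values in $[0,1]$, $0<a_\star\le a\le a^\star<\infty$ and $|f_w|\le M_{f_w}$. Let $L\ge L_s$, $L>0$, $\tau>0$, and let $\Theta^{n-1}_h\in L^2(\Omega)$ be given. Problem $P_h^n$: find $(\Theta,\mathbf q,p,\mathbf u)\in W_h\times V_h\times W_h\times V_h$ such that, for all $w\in W_h$ and $\mathbf v\in V_h$, $$\langle s(\Theta)-s(\Theta^{n-1}_h),w\rangle+\tau\langle\nabla\cdot\mathbf q,w\rangle=0,$$ $$\langle\mathbf q,\mathbf v\rangle-\langle\Theta,\nabla\cdot\mathbf v\rangle-\langle f_w(s(\Theta))\mathbf u,\mathbf v\rangle=\langle\mathbf f_1(s(\Theta)),\mathbf v\rangle,$$ $$\langle\nabla\cdot\mathbf u,w\rangle=\langle f_2(s(\Theta)),w\rangle,$$ $$\langle a(s(\Theta))\mathbf u,\mathbf v\rangle-\langle p,\nabla\cdot\mathbf v\rangle+\langle\mathbf f_3(s(\Theta)),\mathbf v\rangle=0.$$ Problem $P_h^{n,i}$ ($i\ge1$, the $L$-scheme): given $\Theta^{i-1}\in W_h$ and $s^{i-1}=s(\Theta^{i-1})$,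 find $(\Theta^i,\mathbf q^i,p^i,\mathbf u^i)\in W_h\times V_h\times W_h\times V_h$ such that, for all $w\in W_h$ and $\mathbf v\in V_h$, $$\langle L(\Theta^i-\Theta^{i-1})+s^{i-1},w\rangle+\tau\langle\nabla\cdot\mathbf q^i,w\rangle=\langle s(\Theta^{n-1}_h),w\rangle,$$ $$\langle\mathbf q^i,\mathbf v\rangle-\langle\Theta^i,\nabla\cdot\mathbf v\rangle-\langle f_w(s^{i-1})\mathbf u^i,\mathbf v\rangle=\langle\mathbf f_1(s^{i-1}),\mathbf v\rangle,$$ $$\langle\nabla\cdot\mathbf u^i,w\rangle=\langle f_2(s^{i-1}),w\rangle,$$ $$\langle a(s^{i-1})\mathbf u^i,\mathbf v\rangle-\langle p^i,\nabla\cdot\mathbf v\rangle+\langle\mathbf f_3(s^{i-1}),\mathbf v\rangle=0.$$ For constants $C>0$ and $M_{\mathbf u}\ge0$ put $$C_1=\frac{4\left(M_{\mathbf u}^2L_a^2+L_{\mathbf f_3}^2+2(a^\star)^2C^2L_{f_2}^2\right)}{a_\star^2}+\frac{(M_{\mathbf u}L_a+L_{\mathbf f_3})^2}{(a^\star)^2},\qquad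 C_2=2C^2(a^\star)^2C_1+2C^2(M_{\mathbf u}L_a+L_{\mathbf f_3})^2,$$ $$C_3=M_{f_w}^2C_1+(M_{\mathbf u}L_{f_w}+L_{\mathbf f_1})^2,\qquad K=C_3+4L_{\mathbf f_1}^2+8L_{f_w}^2M_{\mathbf u}^2+8C_1M_{f_w}^2 .$$ **Theorem.** For every $\sigma$ there is a constant $C>0$, depending only on $d,\Omega,\sigma$, such that for every $\sigma$-shape-regular mesh of $\Omega$ every $w\in W_h$ equals $\nabla\cdot\mathbf v$ for some $\mathbf v\in V_h$ with $\|\mathbf v\|\le C\|w\|$, and such that, for all data as above with $\tau LK\le1$, the following holds. 1. Problem $P_h^{n,i}$ has exactly one solution for every $\Theta^{i-1}\in W_h$. 2. Let $\Theta^0\in W_h$ be arbitrary, let $(\Theta^i,\mathbf q^i,p^i,\mathbf u^i)_{i\ge1}$ be the iterates, and assume $\|\mathbf u^i\|_{L^\infty(\Omega)}\le M_{\mathbf u}$ for all $i\ge1$. With $e_\Theta^i=\Theta^i-\Theta^{i-1}$, $e_s^i=s(\Theta^i)-s(\Theta^{i-1})$, and $e_{\mathbf q}^i,e_p^i,e_{\mathbf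 u}^i$ defined likewise, one has for all $i\ge2$ $$\|e_{\mathbf u}^i\|^2\le C_1\|e_s^{i-1}\|^2,\quad \|\nabla\cdot e_{\mathbf u}^i\|^2\le L_{f_2}^2\|e_s^{i-1}\|^2,\quad \|e_p^i\|^2\le C_2\|e_s^{i-1}\|^2,\quad \|e_{\mathbf q}^i\|^2\ge\frac{1}{3C^2}\|e_\Theta^i\|^2-C_3\|e_s^{i-1}\|^2,$$ $$\|e_\Theta^i\|^2+\frac{3C^2\tau}{2(3C^2L+\tau)}\|e_{\mathbf q}^i\|^2+\frac{3C^2(1-\tau LK)}{L(3C^2L+\tau)}\|e_s^{i-1}\|^2\le\frac{3C^2L}{3C^2L+\tau}\|e_\Theta^{i-1}\|^2 ,$$ and in particular the same inequality without the (nonnegative) third term. 3. In the situation of 2, the iterates converge in $L^2$, in all four components, to a solution $(\Theta,\mathbf q,p,\mathbf u)$ of Problem $P_h^n$. The convergence is linear: for all $i\ge1$ the estimates of 2 also hold with $e_\Theta^i,e_{\mathbf q}^i,e_p^i,e_{\mathbf u}^i,e_s^{i-1},e_\Theta^{i-1}$ replaced by the errors $\Theta^i-\Theta$, $\mathbf q^i-\mathbf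 q$, $p^i-p$, $\mathbf u^i-\mathbf u$, $s(\Theta^{i-1})-s(\Theta)$, $\Theta^{i-1}-\Theta$; in particular $$\|\Theta^i-\Theta\|^2+\frac{3C^2\tau}{2(3C^2L+\tau)}\|\mathbf q^i-\mathbf q\|^2\le\frac{3C^2L}{3C^2L+\tau}\|\Theta^{i-1}-\Theta\|^2 .$$ -/

import Mathlib

open MeasureTheory Filter Topology
open scoped NNReal ENNReal ContDiff

noncomputable section

namespace TwoPhase

/-- Euclidean space `ℝ^d`. -/
abbrev Pt (d : ℕ) := EuclideanSpace ℝ (Fin d)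

/-- `L²(Ω)`. -/
abbrev L2 {d : ℕ} (Ω : Set (Pt d)) := Lp ℝ 2 (volume.restrict Ω)

/-- `(L²(Ω))^d`. -/
abbrev L2v {d : ℕ} (Ω : Set (Pt d)) := Lp (Pt d) 2 (volume.restrict Ω)

/-! ### Weak divergence and `H(div; Ω)` -/

/-- `g` is the weak divergence of `v` on `Ω`: `∫_Ω v · ∇φ = - ∫_Ω g φ` for every test function
`φ ∈ C_c^∞(Ω)`. -/
def HasWeakDiv {d : ℕ} {Ω : Set (Pt d)} (v : L2v Ω) (g : L2 Ω) : Prop :=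
  ∀ φ : Pt d → ℝ, ContDiff ℝ ∞ φ → HasCompactSupport φ → tsupport φ ⊆ Ω →
    ∫ x in Ω, fderiv ℝ φ x (v x) = - ∫ x in Ω, g x * φ x

/-- `H(div; Ω)`: the square integrable vector fields with a square integrable weak divergence. -/
def Hdiv {d : ℕ} (Ω : Set (Pt d)) : Set (L2v Ω) := {v | ∃ g : L2 Ω, HasWeakDiv v g}

open Classical in
/-- The weak divergence of a field in `H(div; Ω)` (and `0` for a field outside this space). -/
def weakDiv {d : ℕ} {Ω : Set (Pt d)} (v : L2v Ω) : L2 Ω :=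
  if h : ∃ g : L2 Ω, HasWeakDiv v g then h.choose else 0

/-- On an open set the weak divergence is unique. -/
theorem HasWeakDiv.unique {d : ℕ} {Ω : Set (Pt d)} (hΩ : IsOpen Ω) {v : L2v Ω} {g g' : L2 Ω}
    (h : HasWeakDiv v g) (h' : HasWeakDiv v g') : g = g' := by
  have hmem : MemLp (fun x => g x - g' x) 2 (volume.restrict Ω) := (Lp.memLp g).sub (Lp.memLp g')
  have hloc : LocallyIntegrable (fun x => g x - g' x) (volume.restrict Ω) :=
    hmem.locallyIntegrable (by norm_num)
  have key : ∀ᵐ x ∂(volume.restrict Ω), x ∈ Ω → g x - g' x = 0 := by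
    refine hΩ.ae_eq_zero_of_integral_contDiff_smul_eq_zero (hloc.locallyIntegrableOn Ω) ?_
    intro φ h1 h2 h3
    have e := (h φ h1 h2 h3).symm.trans (h' φ h1 h2 h3)
    have hφ : MemLp φ 2 (volume.restrict Ω) := h1.continuous.memLp_of_hasCompactSupport h2
    have i1 : Integrable (fun x => g x * φ x) (volume.restrict Ω) := (Lp.memLp g).integrable_mul hφ
    have i2 : Integrable (fun x => g' x * φ x) (volume.restrict Ω) :=
      (Lp.memLp g').integrable_mul hφ
    have : ∀ x, φ x • (g x - g' x) = g x * φ x - g' x * φ x := fun x => by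
      simp only [smul_eq_mul]; ring
    simp only [this]
    rw [integral_sub i1 i2]
    linarith
  refine Lp.ext ?_
  filter_upwards [key, ae_restrict_mem hΩ.measurableSet] with x hx hm
  linarith [hx hm]

/-- `weakDiv v` is the weak divergence of `v`, whenever there is one. -/
theorem HasWeakDiv.weakDiv_eq {d : ℕ} {Ω : Set (Pt d)} (hΩ : IsOpen Ω) {v : L2v Ω} {g : L2 Ω}
    (h : HasWeakDiv v g) : weakDiv v = g := by
  have hex : ∃ g : L2 Ω, HasWeakDiv v g := ⟨g, h⟩
  rw [weakDiv, dif_pos hex]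
  exact HasWeakDiv.unique hΩ hex.choose_spec h

/-! ### Meshes and the lowest order Raviart–Thomas spaces -/

/-- A decomposition of `Ω` into closed `d`-simplices: a finite simplicial complex (so any two
simplices meet in a common face or not at all) whose `d`-simplices cover `closure Ω` exactly. -/
structure Mesh {d : ℕ} (Ω : Set (Pt d)) where
  cplx : Geometry.SimplicialComplex ℝ (Pt d)
  finite_faces : cplx.faces.Finite
  cover : ⋃ T ∈ {T ∈ cplx.faces | T.card = d + 1}, convexHull ℝ (T : Set (Pt d)) = closure Ω

namespace Mesh

variable {d : ℕ} {Ω : Set (Pt d)}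

/-- The elements of the mesh, given by their sets of `d + 1` vertices. -/
def cells (𝒯 : Mesh Ω) : Set (Finset (Pt d)) := {T ∈ 𝒯.cplx.faces | T.card = d + 1}

/-- Shape regularity with parameter `σ`: `h_T ≤ σ ρ_T` for every element `T`, where `h_T` is the
diameter of `T` and `ρ_T` the diameter of the largest ball inside `T`. -/
def ShapeRegular (𝒯 : Mesh Ω) (σ : ℝ) : Prop :=
  ∀ T ∈ 𝒯.cells, ∃ z : Pt d, ∃ r : ℝ, 0 < r ∧
    Metric.closedBall z r ⊆ convexHull ℝ (T : Set (Pt d)) ∧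
    Metric.diam (convexHull ℝ (T : Set (Pt d))) ≤ σ * (2 * r)

/-- `W_h`: the piecewise constant functions. -/
def W (𝒯 : Mesh Ω) : Set (L2 Ω) :=
  {w | ∀ T ∈ 𝒯.cells, ∃ c : ℝ,
    ∀ᵐ x ∂(volume.restrict Ω), x ∈ convexHull ℝ (T : Set (Pt d)) → w x = c}

/-- `V_h`: the fields in `H(div; Ω)` of the form `a_T + b_T x` on every element `T`. -/
def V (𝒯 : Mesh Ω) : Set (L2v Ω) :=
  {v | v ∈ Hdiv Ω ∧ ∀ T ∈ 𝒯.cells, ∃ (a : Pt d) (b : ℝ),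
    ∀ᵐ x ∂(volume.restrict Ω), x ∈ convexHull ℝ (T : Set (Pt d)) → v x = a + b • x}

end Mesh

/-! ### Coefficient functions and assumptions -/

/-- The coefficient functions of the model. -/
structure Coeffs (d : ℕ) where
  s : ℝ → ℝ
  a : ℝ → ℝ
  fw : ℝ → ℝ
  f1 : ℝ → Pt d
  f2 : ℝ → ℝ
  f3 : ℝ → Pt d

/-- Lipschitz constants and bounds. -/
structure Consts where
  Ls : ℝ≥0
  La : ℝ≥0
  Lfw : ℝ≥0
  Lf1 : ℝ≥0
  Lf2 : ℝ≥0
  Lf3 : ℝ≥0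
  /-- lower bound of `a` -/
  aLow : ℝ
  /-- upper bound of `a` -/
  aUp : ℝ
  /-- bound of `|f_w|` -/
  Mfw : ℝ≥0
  /-- bound of the total fluxes in `L^∞` -/
  Mu : ℝ≥0

/-- The assumptions on the coefficient functions. -/
structure Coeffs.Admissible {d : ℕ} (c : Coeffs d) (B : Consts) : Prop where
  s_mem : ∀ y, c.s y ∈ Set.Icc (0 : ℝ) 1
  s_mono : Monotone c.s
  s_lip : LipschitzWith B.Ls c.s
  a_lip : LipschitzWith B.La c.a
  aLow_pos : 0 < B.aLow
  a_ge : ∀ y, B.aLow ≤ c.a y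
  a_le : ∀ y, c.a y ≤ B.aUp
  f1_lip : LipschitzWith B.Lf1 c.f1
  f2_lip : LipschitzWith B.Lf2 c.f2
  f3_lip : LipschitzWith B.Lf3 c.f3
  fw_lip : LipschitzWith B.Lfw c.fw
  fw_bdd : ∀ y, |c.fw y| ≤ B.Mfw

namespace Consts

/-- The constant `C₁`; here and below `C` is the stability constant of the divergence. -/
def C1 (B : Consts) (C : ℝ) : ℝ :=
  4 * ((B.Mu : ℝ) ^ 2 * (B.La : ℝ) ^ 2 + (B.Lf3 : ℝ) ^ 2
      + 2 * B.aUp ^ 2 * C ^ 2 * (B.Lf2 : ℝ) ^ 2) / B.aLow ^ 2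
    + ((B.Mu : ℝ) * B.La + B.Lf3) ^ 2 / B.aUp ^ 2

/-- The constant `C₂`. -/
def C2 (B : Consts) (C : ℝ) : ℝ :=
  2 * C ^ 2 * B.aUp ^ 2 * B.C1 C + 2 * C ^ 2 * ((B.Mu : ℝ) * B.La + B.Lf3) ^ 2

/-- The constant `C₃`. -/
def C3 (B : Consts) (C : ℝ) : ℝ :=
  (B.Mfw : ℝ) ^ 2 * B.C1 C + ((B.Mu : ℝ) * B.Lfw + B.Lf1) ^ 2

/-- The constant `K` in the time step restriction `τ ≤ 1 / (L K)`. -/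
def K (B : Consts) (C : ℝ) : ℝ :=
  B.C3 C + 4 * (B.Lf1 : ℝ) ^ 2 + 8 * (B.Lfw : ℝ) ^ 2 * (B.Mu : ℝ) ^ 2
    + 8 * B.C1 C * (B.Mfw : ℝ) ^ 2

end Consts

/-! ### The discrete problems -/

/-- A quadruple `(Θ, q, p, u)`. -/
@[ext]
structure State {d : ℕ} (Ω : Set (Pt d)) where
  Θ : L2 Ω
  q : L2v Ω
  p : L2 Ω
  u : L2v Ω

/-- The quadruple lies in `W_h × V_h × W_h × V_h`. -/
def State.Mem {d : ℕ} {Ω : Set (Pt d)} (X : State Ω) (𝒯 : Mesh Ω) : Prop :=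
  X.Θ ∈ 𝒯.W ∧ X.q ∈ 𝒯.V ∧ X.p ∈ 𝒯.W ∧ X.u ∈ 𝒯.V

/-- Problem `P_h^n`: `X` solves the nonlinear fully discrete problem with time step `τ` and
complementary pressure `Θprev` at the previous time. -/
def SolvesNonlinear {d : ℕ} {Ω : Set (Pt d)} (𝒯 : Mesh Ω) (c : Coeffs d) (τ : ℝ)
    (Θprev : L2 Ω) (X : State Ω) : Prop :=
  X.Mem 𝒯 ∧
  (∀ w ∈ 𝒯.W, (∫ x in Ω, (c.s (X.Θ x) - c.s (Θprev x)) * w x)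
      + τ * (∫ x in Ω, weakDiv X.q x * w x) = 0) ∧
  (∀ v ∈ 𝒯.V, (∫ x in Ω, inner ℝ (X.q x) (v x)) - (∫ x in Ω, X.Θ x * weakDiv v x)
      - (∫ x in Ω, inner ℝ (c.fw (c.s (X.Θ x)) • X.u x) (v x))
      = (∫ x in Ω, inner ℝ (c.f1 (c.s (X.Θ x))) (v x))) ∧
  (∀ w ∈ 𝒯.W, (∫ x in Ω, weakDiv X.u x * w x) = (∫ x in Ω, c.f2 (c.s (X.Θ x)) * w x)) ∧
  (∀ v ∈ 𝒯.V, (∫ x in Ω, inner ℝ (c.a (c.s (X.Θ x)) • X.u x) (v x))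
      - (∫ x in Ω, X.p x * weakDiv v x)
      + (∫ x in Ω, inner ℝ (c.f3 (c.s (X.Θ x))) (v x)) = 0)

/-- Problem `P_h^{n,i}`: `X` solves the linear problem of one step of the `L`-scheme, `Θold` being
the complementary pressure of the previous iterate. -/
def SolvesLStep {d : ℕ} {Ω : Set (Pt d)} (𝒯 : Mesh Ω) (c : Coeffs d) (L τ : ℝ)
    (Θprev Θold : L2 Ω) (X : State Ω) : Prop :=
  X.Mem 𝒯 ∧
  (∀ w ∈ 𝒯.W, (∫ x in Ω, (L * (X.Θ x - Θold x) + c.s (Θold x)) * w x)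
      + τ * (∫ x in Ω, weakDiv X.q x * w x) = (∫ x in Ω, c.s (Θprev x) * w x)) ∧
  (∀ v ∈ 𝒯.V, (∫ x in Ω, inner ℝ (X.q x) (v x)) - (∫ x in Ω, X.Θ x * weakDiv v x)
      - (∫ x in Ω, inner ℝ (c.fw (c.s (Θold x)) • X.u x) (v x))
      = (∫ x in Ω, inner ℝ (c.f1 (c.s (Θold x))) (v x))) ∧
  (∀ w ∈ 𝒯.W, (∫ x in Ω, weakDiv X.u x * w x) = (∫ x in Ω, c.f2 (c.s (Θold x)) * w x)) ∧
  (∀ v ∈ 𝒯.V, (∫ x in Ω, inner ℝ (c.a (c.s (Θold x)) • X.u x) (v x))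
      - (∫ x in Ω, X.p x * weakDiv v x)
      + (∫ x in Ω, inner ℝ (c.f3 (c.s (Θold x))) (v x)) = 0)

/-- `‖s(Θ) - s(Θ')‖²` in `L²(Ω)`. -/
def satDistSq {d : ℕ} {Ω : Set (Pt d)} (c : Coeffs d) (Θ Θ' : L2 Ω) : ℝ :=
  ∫ x in Ω, (c.s (Θ x) - c.s (Θ' x)) ^ 2

/-- The error bounds: `X, Y` are two quadruples whose difference is estimated by the difference of
the complementary pressures `Θ, Θ'` from which they were obtained. -/
structure ErrorBounds {d : ℕ} {Ω : Set (Pt d)} (c : Coeffs d) (B : Consts) (C L τ : ℝ)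
    (Θ Θ' : L2 Ω) (X Y : State Ω) : Prop where
  u_bound : ‖X.u - Y.u‖ ^ 2 ≤ B.C1 C * satDistSq c Θ Θ'
  div_u_bound : ‖weakDiv (X.u - Y.u)‖ ^ 2 ≤ (B.Lf2 : ℝ) ^ 2 * satDistSq c Θ Θ'
  p_bound : ‖X.p - Y.p‖ ^ 2 ≤ B.C2 C * satDistSq c Θ Θ'
  q_lower : 1 / (3 * C ^ 2) * ‖X.Θ - Y.Θ‖ ^ 2 - B.C3 C * satDistSq c Θ Θ' ≤ ‖X.q - Y.q‖ ^ 2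
  contraction :
    ‖X.Θ - Y.Θ‖ ^ 2 + 3 * C ^ 2 * τ / (2 * (3 * C ^ 2 * L + τ)) * ‖X.q - Y.q‖ ^ 2
      + 3 * C ^ 2 * (1 - τ * L * B.K C) / (L * (3 * C ^ 2 * L + τ)) * satDistSq c Θ Θ'
    ≤ 3 * C ^ 2 * L / (3 * C ^ 2 * L + τ) * ‖Θ - Θ'‖ ^ 2

end TwoPhase

end

/-! Two independent facts carry the theorem: the divergence from `V_h` onto `W_h` has a right
inverse bounded uniformly over the meshes, and a step of the `L`-scheme is a contraction.

Stability. On a simplex the fields `a + b x` are spanned by the fields `x - z`, `z` a vertex, and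
each of these is tangent to all faces through `z`. A field is thus given by one flux per facet, and
it lies in `H(div)` as soon as the two fluxes through a common face are opposite. Surface integrals
are avoided: by `integral_cone_eq_zero` the integral of `div (φ (x - z))` depends only on `φ` on the
face opposite to `z`, and by `coneMean_opposite` its mean is the same from both sides of the face.
The right inverse becomes a flow problem on the graph of cells, with the exterior as a node of
potential zero. `exists_flow` solves it with the graph Laplacian; the energy bound is the discrete
Poincaré inequality `sum_sq_le_sum_jump_sq`, proved like the classical one by expanding `∫ p² div
x`, with the fluxes of the position field `x` as reference flow. Neighbouring cells have comparable
volumes if they share an edge (`vol_opposite_le`), so this needs `d ≥ 2`; for `d = 1` a primitive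
gives the field directly (`exists_stable_field_one`).

Contraction. Compare two steps started from `Θ` and `Θ'`, and let `S` be the distance of `s(Θ)` and
`s(Θ')`. Coercivity of `a` and the stability of the divergence bound the errors of `u` and `p` by
`S`; the same stability bounds `e_Θ` by `e_q` and `S`. Testing with `e_Θ` and `e_q`, monotonicity
and Lipschitz continuity of `s` yield a term `S² / L`: one half absorbs the linearization error, the
other half, as `τ L K ≤ 1`, pays for the coupling terms (`mixed_error_bounds`,
`errorBounds_of_solvesLStep`).

Convergence. The iterates `Θ^i` are Cauchy. The step started from their limit is compared with the
iterates by the same estimate, hence reproduces the limit and solves the nonlinear problem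
(`exists_limit`). Only one of the two compared fluxes has to be bounded, so nothing is needed of the
limit flux. -/

noncomputable section

namespace TwoPhase

/-! ### Barycentric coordinates of a simplex -/

/-- `T` is the vertex set of a nondegenerate `d`-simplex. -/
structure IsSimplex {d : ℕ} (T : Finset (Pt d)) : Prop where
  indep : AffineIndependent ℝ ((↑) : T → Pt d)
  card_eq : T.card = d + 1

/-- The affine basis formed by the vertices of a nondegenerate simplex. -/
def IsSimplex.basis {d : ℕ} {T : Finset (Pt d)} (hT : IsSimplex T) : AffineBasis T ℝ (Pt d) where
  toFun := (↑)
  ind' := hT.indep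
  tot' := by
    rw [hT.indep.affineSpan_eq_top_iff_card_eq_finrank_add_one]
    simp [hT.card_eq]

open Classical in
/-- The barycentric coordinate of the vertex `z` of the simplex `T`. -/
def lam {d : ℕ} (T : Finset (Pt d)) (z : Pt d) : Pt d →ᵃ[ℝ] ℝ :=
  if h : IsSimplex T ∧ z ∈ T then h.1.basis.coord ⟨z, h.2⟩ else 0

namespace IsSimplex

variable {d : ℕ} {T : Finset (Pt d)}

theorem lam_eq (hT : IsSimplex T) {z : Pt d} (hz : z ∈ T) : lam T z = hT.basis.coord ⟨z, hz⟩ := by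
  rw [lam, dif_pos ⟨hT, hz⟩]

theorem lam_self (hT : IsSimplex T) {z : Pt d} (hz : z ∈ T) : lam T z z = 1 := by
  rw [hT.lam_eq hz]
  exact hT.basis.coord_apply_eq ⟨z, hz⟩

theorem lam_ne (hT : IsSimplex T) {z y : Pt d} (hz : z ∈ T) (hy : y ∈ T) (h : y ≠ z) :
    lam T z y = 0 := by
  rw [hT.lam_eq hz]
  exact hT.basis.coord_apply_ne (i := ⟨z, hz⟩) (j := ⟨y, hy⟩) (by simpa using h.symm)

theorem sum_lam (hT : IsSimplex T) (x : Pt d) : ∑ z ∈ T, lam T z x = 1 := by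
  rw [← Finset.sum_coe_sort, ← hT.basis.sum_coord_apply_eq_one x]
  exact Finset.sum_congr rfl fun z _ => by rw [hT.lam_eq z.2]

theorem sum_lam_smul (hT : IsSimplex T) (x : Pt d) : ∑ z ∈ T, lam T z x • z = x := by
  rw [← Finset.sum_coe_sort]
  conv_rhs => rw [← hT.basis.linear_combination_coord_eq_self x]
  exact Finset.sum_congr rfl fun z _ => by rw [hT.lam_eq z.2]; rfl

theorem affine_eq_sum (hT : IsSimplex T) (f : Pt d →ᵃ[ℝ] ℝ) (x : Pt d) :
    f x = ∑ z ∈ T, lam T z x * f z := by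
  have h : ∀ y, f y = f.linear y + f 0 := fun y => by
    have := f.map_vadd 0 y
    simpa using this
  rw [h x, Finset.sum_congr rfl fun z _ => by rw [h z, mul_add], Finset.sum_add_distrib,
    ← Finset.sum_mul, hT.sum_lam, one_mul]
  congr 1
  conv_lhs => rw [← hT.sum_lam_smul x]
  simp [map_sum]

theorem mem_convexHull_iff (hT : IsSimplex T) {x : Pt d} :
    x ∈ convexHull ℝ (T : Set (Pt d)) ↔ ∀ z ∈ T, 0 ≤ lam T z x := by
  have hr : Set.range hT.basis = (T : Set (Pt d)) := by
    ext y
    constructor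
    · rintro ⟨w, rfl⟩
      exact w.2
    · intro hy
      exact ⟨⟨y, hy⟩, rfl⟩
  rw [← hr, hT.basis.convexHull_eq_nonneg_coord]
  constructor
  · intro h z hz
    rw [hT.lam_eq hz]
    exact h _
  · intro h i
    rw [← hT.lam_eq i.2]
    exact h _ i.2

theorem lam_le_one (hT : IsSimplex T) {x z : Pt d} (hx : x ∈ convexHull ℝ (T : Set (Pt d)))
    (hz : z ∈ T) :
    lam T z x ≤ 1 := by
  rw [← hT.sum_lam x]
  exact Finset.single_le_sum (f := fun z => lam T z x) (hT.mem_convexHull_iff.1 hx) hz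

theorem lam_eq_zero_of_mem_face (hT : IsSimplex T) {S : Finset (Pt d)} (hS : S ⊆ T) {x z : Pt d}
    (hx : x ∈ convexHull ℝ (S : Set (Pt d))) (hz : z ∈ T) (hzS : z ∉ S) : lam T z x = 0 := by
  have hconv : Convex ℝ {y | lam T z y = 0} := by
    have : Convex ℝ ((lam T z) ⁻¹' {0}) := (convex_singleton (0 : ℝ)).affine_preimage _
    exact this
  refine convexHull_min ?_ hconv hx
  intro y hy
  exact hT.lam_ne hz (hS hy) (by rintro rfl; exact hzS hy)

theorem interior_nonempty (hT : IsSimplex T) :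
    (interior (convexHull ℝ (T : Set (Pt d)))).Nonempty := by
  rw [interior_convexHull_nonempty_iff_affineSpan_eq_top]
  have hr : (T : Set (Pt d)) = Set.range hT.basis := by
    ext y
    constructor
    · intro hy
      exact ⟨⟨y, hy⟩, rfl⟩
    · rintro ⟨w, rfl⟩
      exact w.2
  rw [hr]
  exact hT.basis.tot

theorem volume_pos (hT : IsSimplex T) : 0 < volume.real (convexHull ℝ (T : Set (Pt d))) := by
  have hfin : volume (convexHull ℝ (T : Set (Pt d))) ≠ ⊤ :=
    (T.finite_toSet.isCompact_convexHull (𝕜 := ℝ)).measure_ne_top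
  refine ENNReal.toReal_pos ?_ hfin
  refine (lt_of_lt_of_le ?_ (measure_mono interior_subset)).ne'
  exact isOpen_interior.measure_pos _ hT.interior_nonempty

/-- The coordinate stays in `[0, 1]` on the ball, so it varies by at most one along a diameter of
length `2 * r` in the direction of `v`. -/
theorem lam_linear_le (hT : IsSimplex T) {z w : Pt d} {r : ℝ} (hr : 0 < r) (hz : z ∈ T)
    (hball : Metric.closedBall w r ⊆ convexHull ℝ (T : Set (Pt d))) (v : Pt d) :
    |(lam T z).linear v| * (2 * r) ≤ ‖v‖ := by
  rcases eq_or_ne v 0 with rfl | hv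
  · simp
  have hv' : 0 < ‖v‖ := norm_pos_iff.2 hv
  have hmem : ∀ t : ℝ, |t| ≤ r → w + (t / ‖v‖) • v ∈ convexHull ℝ (T : Set (Pt d)) := by
    intro t ht
    refine hball ?_
    rw [mem_closedBall_iff_norm, add_sub_cancel_left, norm_smul, Real.norm_eq_abs, abs_div,
      abs_of_pos hv', div_mul_cancel₀ _ hv'.ne']
    exact ht
  have hval : ∀ t : ℝ, lam T z (w + (t / ‖v‖) • v)
      = t / ‖v‖ * (lam T z).linear v + lam T z w := by
    intro t
    have := (lam T z).map_vadd w ((t / ‖v‖) • v)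
    rw [vadd_eq_add, add_comm] at this
    rw [this]
    simp
  have h1 := hmem r (by rw [abs_of_pos hr])
  have h2 := hmem (-r) (by rw [abs_neg, abs_of_pos hr])
  have a1 := hT.mem_convexHull_iff.1 h1 z hz
  have a2 := hT.mem_convexHull_iff.1 h2 z hz
  have b1 := hT.lam_le_one h1 hz
  have b2 := hT.lam_le_one h2 hz
  rw [hval] at a1 a2 b1 b2
  have key : |(lam T z).linear v * (2 * r) / ‖v‖| ≤ 1 := by
    have e : (lam T z).linear v * (2 * r) / ‖v‖
        = (r / ‖v‖ * (lam T z).linear v + lam T z w)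
          - (-r / ‖v‖ * (lam T z).linear v + lam T z w) := by ring
    rw [e, abs_le]
    constructor <;> linarith
  rw [abs_div, abs_of_pos hv', div_le_one hv', abs_mul, abs_of_pos (by positivity : 0 < 2 * r)]
    at key
  exact key

end IsSimplex

/-- Two nondegenerate simplices with a common face: the barycentric coordinates of the opposite
vertices are proportional. -/
theorem lam_eq_mul_lam {d : ℕ} {T T' : Finset (Pt d)} (hT : IsSimplex T) (hT' : IsSimplex T')
    {z z' : Pt d} (hz : z ∈ T) (hz' : z' ∈ T') (hF : T'.erase z' = T.erase z) (x : Pt d) :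
    lam T z x = lam T z z' * lam T' z' x := by
  -- Expand the affine function `lam T z` in the coordinates of `T'`: it vanishes at the vertices of
  -- the common face, so only the term of `z'` survives.
  rw [hT'.affine_eq_sum (lam T z) x, ← Finset.add_sum_erase _ _ hz', Finset.sum_eq_zero, add_zero,
    mul_comm]
  intro y hy
  rw [hF] at hy
  rw [hT.lam_ne hz (Finset.mem_of_mem_erase hy) (Finset.ne_of_mem_erase hy), mul_zero]

/-! ### The divergence theorem for a cone -/

/-- The cone with apex `z` over a set `S`, contracted towards `z` by the factor `t`. -/
theorem cone_near_base {d : ℕ} {S : Set (Pt d)} {z : Pt d} (hS : S.Nonempty) {t : ℝ} (ht : 0 < t)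
    {x : Pt d} (hx : x ∈ convexHull ℝ (insert z S))
    (hxt : x ∉ (fun x => z + t • (x - z)) '' convexHull ℝ (insert z S)) :
    ∃ y ∈ convexHull ℝ S, ∃ b : ℝ, t < b ∧ b ≤ 1 ∧ x = z + b • (y - z) := by
  rw [convexHull_insert hS, mem_convexJoin] at hx
  obtain ⟨w, hw, y, hy, hx⟩ := hx
  rw [Set.mem_singleton_iff] at hw
  subst hw
  obtain ⟨a, b, ha, hb, hab, rfl⟩ := hx
  have e : a • w + b • y = w + b • (y - w) := by
    rw [← eq_sub_iff_add_eq] at hab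
    rw [hab]; module
  refine ⟨y, hy, b, ?_, by linarith, e⟩
  -- A point at ratio `b ≤ t` on the ray from the apex is the image of the point at ratio `b / t ≤
  -- 1` on the same ray.
  by_contra hbt
  push Not at hbt
  refine hxt ⟨w + (b / t) • (y - w), ?_, ?_⟩
  · have hw : w ∈ convexHull ℝ (insert w S) := subset_convexHull ℝ _ (Set.mem_insert _ _)
    have hy' : y ∈ convexHull ℝ (insert w S) := convexHull_mono (Set.subset_insert _ _) hy
    have := (convex_convexHull ℝ (insert w S)) hw hy' (a := 1 - b / t) (b := b / t)
      (by rw [sub_nonneg, div_le_one ht]; exact hbt) (by positivity) (by ring)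
    convert this using 1
    module
  · rw [e]
    dsimp only
    rw [add_sub_cancel_left, smul_smul, mul_div_cancel₀ _ ht.ne']

theorem setIntegral_homothety {d : ℕ} {K : Set (Pt d)} (hK : MeasurableSet K) (z : Pt d) {t : ℝ}
    (ht : 0 < t) (ψ : Pt d → ℝ) :
    ∫ x in (fun x => z + t • (x - z)) '' K, ψ x = ∫ x in K, t ^ d * ψ (z + t • (x - z)) := by
  have hder : ∀ x ∈ K, HasFDerivWithinAt (fun x => z + t • (x - z))
      (t • ContinuousLinearMap.id ℝ (Pt d)) K x := fun x _ =>
    ((((hasFDerivAt_id x).sub_const z).const_smul t).const_add z).hasFDerivWithinAt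
  rw [integral_image_eq_integral_abs_det_fderiv_smul volume hK hder]
  · have : |(t • ContinuousLinearMap.id ℝ (Pt d)).det| = t ^ d := by
      simp [ContinuousLinearMap.det, LinearMap.det_smul, abs_of_pos ht]
    simp only [this, smul_eq_mul]
  · intro x _ y _ hxy
    simpa [ht.ne'] using hxy

/-- The integrand is the divergence of `ψ (x - z)`, a field tangent to the lateral boundary of the
cone and zero on its base. In place of a boundary integral, the integral of `ψ` over the cone shrunk
by `t` is differentiated at `t = 1`: the change of variables gives the integrand, while the geometry
of the removed layer gives zero. -/
theorem integral_cone_eq_zero {d : ℕ} {S : Set (Pt d)} (hSfin : S.Finite) (hS : S.Nonempty)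
    (z : Pt d) {ψ : Pt d → ℝ} (hψ : ContDiff ℝ 1 ψ) (h0 : ∀ y ∈ convexHull ℝ S, ψ y = 0) :
    ∫ x in convexHull ℝ (insert z S), ((d : ℝ) * ψ x + fderiv ℝ ψ x (x - z)) = 0 := by
  set K := convexHull ℝ (insert z S) with hKdef
  have hK : IsCompact K := (hSfin.insert z).isCompact_convexHull (𝕜 := ℝ)
  have hKm : MeasurableSet K := hK.isClosed.measurableSet
  have hKconv : Convex ℝ K := convex_convexHull ℝ _
  have hzK : z ∈ K := subset_convexHull ℝ _ (Set.mem_insert _ _)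
  set F : ℝ → Pt d → ℝ := fun t x => t ^ d * ψ (z + t • (x - z)) with hF
  set F' : ℝ → Pt d → ℝ := fun t x => d * t ^ (d - 1) * ψ (z + t • (x - z))
    + t ^ d * fderiv ℝ ψ (z + t • (x - z)) (x - z) with hF'
  have hψd : Continuous (fderiv ℝ ψ) := hψ.continuous_fderiv one_ne_zero
  have hψc : Continuous ψ := hψ.continuous
  have hFc : Continuous fun q : ℝ × Pt d => F q.1 q.2 := by
    simp only [hF]; fun_prop
  have hF'c : Continuous fun q : ℝ × Pt d => F' q.1 q.2 := by
    simp only [hF']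
    have : Continuous fun q : ℝ × Pt d => fderiv ℝ ψ (z + q.1 • (q.2 - z)) (q.2 - z) := by
      refine Continuous.clm_apply (hψd.comp (by fun_prop)) (by fun_prop)
    fun_prop
  have hderiv : HasDerivAt (fun t => ∫ x in K, F t x) (∫ x in K, F' 1 x) 1 := by
    obtain ⟨M, hM⟩ := ((isCompact_Icc (a := (0 : ℝ)) (b := 2)).prod hK).exists_bound_of_continuousOn
      hF'c.continuousOn
    have hintg : ∀ t, IntegrableOn (F t) K := fun t =>
      (hFc.comp (Continuous.prodMk_right t)).continuousOn.integrableOn_compact hK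
    have hball : Metric.ball (1 : ℝ) 1 ∈ 𝓝 (1 : ℝ) := Metric.ball_mem_nhds _ one_pos
    have hm : IsFiniteMeasure (volume.restrict K) := ⟨by
      rw [Measure.restrict_apply_univ]; exact hK.measure_lt_top⟩
    refine (hasDerivAt_integral_of_dominated_loc_of_deriv_le (bound := fun _ => M) hball
      (Eventually.of_forall fun t => (hintg t).aestronglyMeasurable) (hintg 1)
      (hF'c.comp (Continuous.prodMk_right 1)).aestronglyMeasurable ?_
      (integrable_const M) ?_).2
    · filter_upwards [ae_restrict_mem hKm] with x hx t ht
      rw [Metric.mem_ball, Real.dist_eq, abs_lt] at ht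
      exact hM (t, x) ⟨⟨by linarith, by linarith⟩, hx⟩
    · refine ae_of_all _ fun x t _ => ?_
      have h1 : HasDerivAt (fun t : ℝ => z + t • (x - z)) (x - z) t := by
        simpa using ((hasDerivAt_id t).smul_const (x - z)).const_add z
      have h2 := ((hψ.differentiable one_ne_zero) (z + t • (x - z))).hasFDerivAt.comp_hasDerivAt
        t h1
      exact (hasDerivAt_pow d t).mul h2
  -- A left derivative suffices, since derivatives within `Set.Iio 1` at `1` are unique.
  have hzero : HasDerivWithinAt (fun t => ∫ x in K, F t x) 0 (Set.Iio 1) 1 := by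
    obtain ⟨M, hM⟩ := hK.exists_bound_of_continuousOn hψd.continuousOn
    obtain ⟨R, hR⟩ := hK.isBounded.exists_norm_le
    have hM0 : 0 ≤ M := (norm_nonneg _).trans (hM z hzK)
    have hR0 : 0 ≤ R := (norm_nonneg _).trans (hR z hzK)
    have hbound : ∀ t ∈ Set.Ioo (0 : ℝ) 1, |(∫ x in K, F t x) - ∫ x in K, F 1 x|
        ≤ M * (2 * R) * (1 - t) * ((1 - t ^ d) * volume.real K) := by
      intro t ht
      set Kt := (fun x => z + t • (x - z)) '' K with hKt
      have hKtK : Kt ⊆ K := by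
        rintro _ ⟨x, hx, rfl⟩
        have := hKconv hzK hx (a := 1 - t) (b := t) (by linarith [ht.2]) ht.1.le (by ring)
        convert this using 1
        module
      have hKtm : MeasurableSet Kt := (hK.image (by fun_prop)).isClosed.measurableSet
      have e1 : ∫ x in K, F 1 x = ∫ x in K, ψ x := by simp [hF]
      have e2 : ∫ x in K, F t x = ∫ x in Kt, ψ x := (setIntegral_homothety hKm z ht.1 ψ).symm
      have hi : IntegrableOn ψ K := hψc.continuousOn.integrableOn_compact hK
      have e3 : (∫ x in Kt, ψ x) - ∫ x in K, ψ x = - ∫ x in K \ Kt, ψ x := by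
        rw [setIntegral_sdiff hKtm hi hKtK]; ring
      have hvol : volume.real (K \ Kt) = (1 - t ^ d) * volume.real K := by
        have h1 := setIntegral_homothety hKm z ht.1 (fun _ => (1 : ℝ))
        simp only [mul_one, integral_const, smul_eq_mul, measureReal_restrict_apply_univ] at h1
        rw [measureReal_sdiff hKtK hKtm hK.measure_ne_top, h1]
        ring
      rw [e1, e2, e3, abs_neg, ← hvol, ← Real.norm_eq_abs]
      refine norm_setIntegral_le_of_norm_le_const
        ((measure_mono Set.sdiff_subset).trans_lt hK.measure_lt_top) fun x hx => ?_
      -- A point of the removed layer is within `(1 - t) ‖z - y‖` of a point `y` of the base, where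
      -- `ψ` vanishes. So `ψ` is `O(1 - t)` on a layer of volume `(1 - t ^ d) |K|`, and the
      -- increment is `o(1 - t)`.
      obtain ⟨y, hy, b, htb, hb1, hxy⟩ := cone_near_base hS ht.1 hx.1 hx.2
      have hyK : y ∈ K := convexHull_mono (Set.subset_insert _ _) hy
      have hlip := hKconv.norm_image_sub_le_of_norm_fderiv_le
        (fun x _ => (hψ.differentiable one_ne_zero) x) hM hyK hx.1
      rw [h0 y hy, sub_zero] at hlip
      refine hlip.trans ?_
      rw [mul_assoc]
      have e : x - y = (1 - b) • (z - y) := by rw [hxy]; module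
      rw [mul_assoc]
      refine mul_le_mul_of_nonneg_left ?_ hM0
      rw [e, norm_smul, Real.norm_eq_abs, abs_of_nonneg (by linarith)]
      have : ‖z - y‖ ≤ 2 * R := (norm_sub_le _ _).trans (by linarith [hR z hzK, hR y hyK])
      nlinarith [norm_nonneg (z - y)]
    rw [hasDerivWithinAt_iff_tendsto_slope' (by simp)]
    refine squeeze_zero_norm' (a := fun t => M * (2 * R) * ((1 - t ^ d) * volume.real K)) ?_ ?_
    · filter_upwards [Ioo_mem_nhdsLT (zero_lt_one (α := ℝ))] with t ht
      have h1t : 0 < 1 - t := by linarith [ht.2]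
      rw [slope_def_field, Real.norm_eq_abs, abs_div, abs_sub_comm t 1, abs_of_pos h1t,
        div_le_iff₀ h1t]
      refine (hbound t ht).trans (le_of_eq ?_)
      ring
    · have : Tendsto (fun t : ℝ => M * (2 * R) * ((1 - t ^ d) * volume.real K)) (𝓝[<] 1)
          (𝓝 (M * (2 * R) * ((1 - 1 ^ d) * volume.real K))) :=
        (Continuous.tendsto (by fun_prop) 1).mono_left nhdsWithin_le_nhds
      simpa using this
  have huniq := (uniqueDiffWithinAt_Iio (1 : ℝ)).eq_deriv _ hderiv.hasDerivWithinAt hzero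
  simpa [hF'] using huniq

/-! ### Two simplices with a common face -/

/-- The affine map that fixes the face of `T` opposite to `z` and sends `z` to another
point. -/
def faceMap {d : ℕ} (T : Finset (Pt d)) (z z' : Pt d) : Pt d →ᵃ[ℝ] Pt d :=
  AffineMap.id ℝ (Pt d) + (LinearMap.toSpanSingleton ℝ (Pt d) (z' - z)).toAffineMap.comp (lam T z)

theorem faceMap_apply {d : ℕ} (T : Finset (Pt d)) (z z' x : Pt d) :
    faceMap T z z' x = x + lam T z x • (z' - z) := by
  simp [faceMap]

theorem affineMap_eq_linear_add {d : ℕ} {E : Type*} [AddCommGroup E] [Module ℝ E]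
    (f : Pt d →ᵃ[ℝ] E) (x y : Pt d) : f x = f.linear (x - y) + f y := by
  have := f.map_vadd y (x - y)
  simpa using this

theorem faceMap_linear_apply {d : ℕ} (T : Finset (Pt d)) (z z' x : Pt d) :
    (faceMap T z z').linear x = x + (lam T z).linear x • (z' - z) := by
  simp [faceMap]

/-- The average over the simplex `T` of the divergence of the field `φ (x - z)`. -/
def coneMean {d : ℕ} (φ : Pt d → ℝ) (T : Finset (Pt d)) (z : Pt d) : ℝ :=
  (∫ x in convexHull ℝ (T : Set (Pt d)), ((d : ℝ) * φ x + fderiv ℝ φ x (x - z)))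
    / volume.real (convexHull ℝ (T : Set (Pt d)))

/-- Up to the factor `d`, `coneMean φ T z` is the average of `φ` over the face opposite to `z`;
vanishing on that face is all that will be needed to exploit this. -/
theorem coneMean_eq_zero {d : ℕ} (hd : 1 ≤ d) {T : Finset (Pt d)} (hT : IsSimplex T) {z : Pt d}
    (hz : z ∈ T) {ψ : Pt d → ℝ} (hψ : ContDiff ℝ 1 ψ)
    (h0 : ∀ y ∈ convexHull ℝ ((T.erase z : Finset (Pt d)) : Set (Pt d)), ψ y = 0) :
    coneMean ψ T z = 0 := by
  have hne : ((T.erase z : Finset (Pt d)) : Set (Pt d)).Nonempty := by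
    rw [Finset.coe_nonempty, ← Finset.card_pos, Finset.card_erase_of_mem hz, hT.card_eq]
    omega
  have := integral_cone_eq_zero (T.erase z).finite_toSet hne z hψ h0
  rw [← Finset.coe_insert, Finset.insert_erase hz] at this
  rw [coneMean, this, zero_div]

section CommonFace

variable {d : ℕ} {T T' : Finset (Pt d)} {z z' : Pt d}

theorem lam_opposite_ne_zero (hT : IsSimplex T) (hT' : IsSimplex T') (hz : z ∈ T) (hz' : z' ∈ T')
    (hF : T'.erase z' = T.erase z) : lam T z z' ≠ 0 := by
  intro h
  have := lam_eq_mul_lam hT hT' hz hz' hF z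
  rw [hT.lam_self hz, h, zero_mul] at this
  exact one_ne_zero this

theorem faceMap_image (hT : IsSimplex T) (hz : z ∈ T) (hz' : z' ∈ T')
    (hF : T'.erase z' = T.erase z) :
    (faceMap T z z') '' convexHull ℝ (T : Set (Pt d)) = convexHull ℝ (T' : Set (Pt d)) := by
  rw [AffineMap.image_convexHull]
  congr 1
  have h1 : faceMap T z z' z = z' := by rw [faceMap_apply, hT.lam_self hz]; module
  have h2 : ∀ y ∈ T.erase z, faceMap T z z' y = y := fun y hy => by
    rw [faceMap_apply, hT.lam_ne hz (Finset.mem_of_mem_erase hy) (Finset.ne_of_mem_erase hy)]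
    module
  have e : (T : Set (Pt d)) = insert z ((T.erase z : Finset (Pt d)) : Set (Pt d)) := by
    rw [← Finset.coe_insert, Finset.insert_erase hz]
  rw [e, ← Finset.insert_erase hz', hF, Finset.coe_insert, Set.image_insert_eq, h1]
  congr 1
  exact (Set.image_congr h2).trans (Set.image_id' _)

theorem setIntegral_faceMap (hT : IsSimplex T) (hT' : IsSimplex T') (hz : z ∈ T) (hz' : z' ∈ T')
    (hF : T'.erase z' = T.erase z) (g : Pt d → ℝ) :
    ∫ x in convexHull ℝ (T' : Set (Pt d)), g x
      = |lam T z z'| * ∫ x in convexHull ℝ (T : Set (Pt d)), g (faceMap T z z' x) := by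
  have hκ := lam_opposite_ne_zero hT hT' hz hz' hF
  have hlin : (lam T z).linear (z' - z) = lam T z z' - 1 := by
    have := affineMap_eq_linear_add (lam T z) z' z
    rw [hT.lam_self hz] at this
    linarith
  set A' : Pt d →L[ℝ] Pt d := LinearMap.toContinuousLinearMap (faceMap T z z').linear with hA'
  have hder : ∀ x ∈ convexHull ℝ (T : Set (Pt d)), HasFDerivWithinAt (faceMap T z z') A'
      (convexHull ℝ (T : Set (Pt d))) x := fun x _ => by
    have h : HasFDerivAt (fun y => A' y + faceMap T z z' 0) A' x := A'.hasFDerivAt.add_const _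
    have e : (fun y => A' y + faceMap T z z' 0) = faceMap T z z' := by
      ext1 y
      rw [affineMap_eq_linear_add (faceMap T z z') y 0, sub_zero]
      rfl
    rw [e] at h
    exact h.hasFDerivWithinAt
  -- The linear part is a transvection, with determinant `1 + (lam T z).linear (z' - z)`.
  have hdet : A'.det = lam T z z' := by
    have : (faceMap T z z').linear = LinearMap.transvection (lam T z).linear (z' - z) := by
      ext1 x
      rw [faceMap_linear_apply, LinearMap.transvection.apply]
    rw [hA', LinearMap.det_toContinuousLinearMap, this, LinearMap.transvection.det, hlin]
    ring
  rw [← faceMap_image hT hz hz' hF, integral_image_eq_integral_abs_det_fderiv_smul volume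
    (T.finite_toSet.isCompact_convexHull (𝕜 := ℝ)).isClosed.measurableSet hder]
  · simp only [hdet, smul_eq_mul]
    rw [integral_const_mul]
  · intro x _ y _ hxy
    have h1 : (faceMap T z z').linear (x - y) = 0 := by
      have := affineMap_eq_linear_add (faceMap T z z') x y
      rw [hxy] at this
      simpa using this
    rw [faceMap_linear_apply] at h1
    have h2 : (lam T z).linear (x - y) * lam T z z' = 0 := by
      have := congrArg (lam T z).linear h1
      rw [map_add, map_smul, hlin, map_zero, smul_eq_mul] at this
      linarith
    have h3 : (lam T z).linear (x - y) = 0 := (mul_eq_zero.1 h2).resolve_right hκ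
    rw [h3, zero_smul, add_zero] at h1
    exact sub_eq_zero.1 h1

theorem volume_opposite (hT : IsSimplex T) (hT' : IsSimplex T') (hz : z ∈ T) (hz' : z' ∈ T')
    (hF : T'.erase z' = T.erase z) :
    volume.real (convexHull ℝ (T' : Set (Pt d)))
      = |lam T z z'| * volume.real (convexHull ℝ (T : Set (Pt d))) := by
  simpa using setIntegral_faceMap hT hT' hz hz' hF (fun _ => (1 : ℝ))

/-- Pull `T'` back to `T` by the affine map fixing the common face. The Jacobian cancels against the
ratio of the volumes, and `φ` differs from its pullback by a function vanishing on the face, whose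
`coneMean` is zero. -/
theorem coneMean_opposite (hd : 1 ≤ d) (hT : IsSimplex T) (hT' : IsSimplex T') (hz : z ∈ T)
    (hz' : z' ∈ T') (hF : T'.erase z' = T.erase z) {φ : Pt d → ℝ} (hφ : ContDiff ℝ 1 φ) :
    coneMean φ T' z' = coneMean φ T z := by
  have hκ := lam_opposite_ne_zero hT hT' hz hz' hF
  have hv := hT.volume_pos
  have hA : ContDiff ℝ 1 (faceMap T z z') := by
    have e : (faceMap T z z' : Pt d → Pt d)
        = fun y => LinearMap.toContinuousLinearMap (faceMap T z z').linear y
          + faceMap T z z' 0 := by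
      ext1 y
      rw [affineMap_eq_linear_add (faceMap T z z') y 0, sub_zero]
      rfl
    rw [e]
    exact (ContinuousLinearMap.contDiff _).add contDiff_const
  have hAd : ∀ x, HasFDerivAt (faceMap T z z')
      (LinearMap.toContinuousLinearMap (faceMap T z z').linear) x := fun x => by
    have h : HasFDerivAt (fun y => LinearMap.toContinuousLinearMap (faceMap T z z').linear y
      + faceMap T z z' 0) (LinearMap.toContinuousLinearMap (faceMap T z z').linear) x :=
      (ContinuousLinearMap.hasFDerivAt _).add_const _
    convert h using 1
    ext1 y
    rw [affineMap_eq_linear_add (faceMap T z z') y 0, sub_zero]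
    rfl
  set ψ : Pt d → ℝ := φ ∘ faceMap T z z' with hψ
  have hψc : ContDiff ℝ 1 ψ := hφ.comp hA
  have hψd : ∀ x, fderiv ℝ ψ x (x - z)
      = fderiv ℝ φ (faceMap T z z' x) (faceMap T z z' x - z') := fun x => by
    have h := ((hφ.differentiable one_ne_zero) (faceMap T z z' x)).hasFDerivAt.comp x (hAd x)
    rw [h.fderiv, ContinuousLinearMap.comp_apply]
    congr 1
    change (faceMap T z z').linear (x - z) = _
    have h3 := affineMap_eq_linear_add (lam T z) x z
    rw [hT.lam_self hz] at h3
    rw [faceMap_linear_apply, faceMap_apply, h3]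
    module
  have e1 : coneMean φ T' z' = coneMean ψ T z := by
    rw [coneMean, setIntegral_faceMap hT hT' hz hz' hF, volume_opposite hT hT' hz hz' hF, coneMean,
      mul_div_mul_left _ _ (abs_ne_zero.2 hκ)]
    simp only [← hψd]
    rfl
  have hcpt : IsCompact (convexHull ℝ (T : Set (Pt d))) :=
    T.finite_toSet.isCompact_convexHull (𝕜 := ℝ)
  have hintg : ∀ f : Pt d → ℝ, ContDiff ℝ 1 f → IntegrableOn
      (fun x => (d : ℝ) * f x + fderiv ℝ f x (x - z)) (convexHull ℝ (T : Set (Pt d))) := by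
    intro f hf
    have h1 : Continuous fun x => fderiv ℝ f x (x - z) :=
      (hf.continuous_fderiv one_ne_zero).clm_apply (by fun_prop)
    have h2 := hf.continuous
    exact ContinuousOn.integrableOn_compact hcpt (Continuous.continuousOn (by fun_prop))
  have e2 : coneMean (fun x => ψ x - φ x) T z = 0 := by
    refine coneMean_eq_zero hd hT hz (hψc.sub hφ) fun y hy => ?_
    have h0 : lam T z y = 0 :=
      hT.lam_eq_zero_of_mem_face (Finset.erase_subset _ _) hy hz (Finset.notMem_erase _ _)
    simp [hψ, faceMap_apply, h0]
  have e3 : coneMean (fun x => ψ x - φ x) T z = coneMean ψ T z - coneMean φ T z := by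
    rw [coneMean, coneMean, coneMean, ← sub_div, ← integral_sub (hintg ψ hψc) (hintg φ hφ)]
    congr 2
    ext x
    rw [fderiv_fun_sub (hψc.differentiable one_ne_zero x) (hφ.differentiable one_ne_zero x)]
    simp only [sub_apply]
    ring
  rw [e1]
  linarith

end CommonFace

/-! ### The faces of a mesh -/

namespace Mesh

variable {d : ℕ} {Ω : Set (Pt d)} (𝒯 : Mesh Ω)

theorem isSimplex {T : Finset (Pt d)} (hT : T ∈ 𝒯.cells) : IsSimplex T :=
  ⟨𝒯.cplx.indep hT.1, hT.2⟩

theorem finite_cells : 𝒯.cells.Finite := 𝒯.finite_faces.subset fun _ h => h.1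

theorem closure_eq : ⋃ T ∈ 𝒯.cells, convexHull ℝ (T : Set (Pt d)) = closure Ω := 𝒯.cover

/-- Conformity of the mesh enters the proof only through this statement. -/
theorem mem_inter {T T' : Finset (Pt d)} (hT : T ∈ 𝒯.cells) (hT' : T' ∈ 𝒯.cells) {x : Pt d}
    (hx : x ∈ convexHull ℝ (T : Set (Pt d))) (hx' : x ∈ convexHull ℝ (T' : Set (Pt d))) :
    x ∈ convexHull ℝ ((T ∩ T' : Finset (Pt d)) : Set (Pt d)) := by
  rw [Finset.coe_inter]
  exact 𝒯.cplx.inter_subset_convexHull hT.1 hT'.1 ⟨hx, hx'⟩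

end Mesh

/-- The barycentre of the face serves. Being relatively interior, it allows small moves off the face
without making the other coordinates negative. -/
theorem IsSimplex.exists_pos_face {d : ℕ} (hd : 1 ≤ d) {T : Finset (Pt d)} (hT : IsSimplex T)
    {z : Pt d} (hz : z ∈ T) :
    ∃ y ∈ convexHull ℝ ((T.erase z : Finset (Pt d)) : Set (Pt d)),
      ∀ w ∈ T.erase z, 0 < lam T w y := by
  have hcard : (T.erase z).card = d := by
    rw [Finset.card_erase_of_mem hz, hT.card_eq]; omega
  have hd0 : (0 : ℝ) < d := by exact_mod_cast hd
  have hsum : ∑ _w ∈ T.erase z, (d : ℝ)⁻¹ = 1 := by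
    rw [Finset.sum_const, hcard, nsmul_eq_mul, mul_inv_cancel₀ hd0.ne']
  refine ⟨∑ w ∈ T.erase z, (d : ℝ)⁻¹ • w, ?_, fun w hw => ?_⟩
  · exact (convex_convexHull ℝ _).sum_mem (fun _ _ => by positivity) hsum
      fun y hy => subset_convexHull ℝ _ hy
  · have h : lam T w (∑ y ∈ T.erase z, (d : ℝ)⁻¹ • y)
        = ∑ y ∈ T.erase z, (d : ℝ)⁻¹ * lam T w y := by
      rw [affineMap_eq_linear_add (lam T w) _ 0, sub_zero, map_sum]
      have : ∀ y ∈ T.erase z, (d : ℝ)⁻¹ * lam T w y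
          = (lam T w).linear ((d : ℝ)⁻¹ • y) + (d : ℝ)⁻¹ * lam T w 0 := fun y _ => by
        rw [affineMap_eq_linear_add (lam T w) y 0, sub_zero, map_smul, smul_eq_mul]; ring
      rw [Finset.sum_congr rfl this, Finset.sum_add_distrib, ← Finset.sum_mul, hsum, one_mul]
    have hwT := Finset.mem_of_mem_erase hw
    rw [h, Finset.sum_eq_single w (fun y hy hne => by
      rw [hT.lam_ne hwT (Finset.mem_of_mem_erase hy) hne, mul_zero]) (fun h => absurd hw h),
      hT.lam_self hwT, mul_one]
    positivity

theorem lam_add_smul {d : ℕ} (f : Pt d →ᵃ[ℝ] ℝ) (x y : Pt d) (t : ℝ) :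
    f (y + t • (x - y)) = (1 - t) * f y + t * f x := by
  rw [affineMap_eq_linear_add f (y + t • (x - y)) y, affineMap_eq_linear_add f x y]
  simp
  ring

namespace Mesh

variable {d : ℕ} {Ω : Set (Pt d)} (𝒯 : Mesh Ω)

/-- Two cells lie on different sides of a common face. Otherwise a small move from a relatively
interior point of the face towards `z'` would stay in both cells, hence in the hull of their common
vertices, where `lam T z` vanishes although it is positive there. -/
theorem lam_opposite_neg (hd : 1 ≤ d) {T T' : Finset (Pt d)} (hT : T ∈ 𝒯.cells)
    (hT' : T' ∈ 𝒯.cells) (hne : T' ≠ T) {z z' : Pt d} (hz : z ∈ T) (hz' : z' ∈ T')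
    (hF : T'.erase z' = T.erase z) : lam T z z' < 0 := by
  have sT := 𝒯.isSimplex hT
  have sT' := 𝒯.isSimplex hT'
  by_contra hcon
  have hκ : 0 < lam T z z' :=
    lt_of_le_of_ne (not_lt.1 hcon) (lam_opposite_ne_zero sT sT' hz hz' hF).symm
  obtain ⟨y, hyF, hpos⟩ := sT.exists_pos_face hd hz
  have hzT' : z ∉ T' := by
    intro hzT'
    refine hne (Finset.eq_of_subset_of_card_le ?_ (by rw [sT.card_eq, sT'.card_eq])).symm
    rw [← Finset.insert_erase hz]
    refine Finset.insert_subset hzT' ?_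
    rw [← hF]
    exact Finset.erase_subset _ _
  have hev : ∀ᶠ t in 𝓝[>] (0 : ℝ), ∀ w ∈ T.erase z, 0 < lam T w (y + t • (z' - y)) := by
    rw [eventually_all_finset]
    intro w hw
    simp only [lam_add_smul]
    have : Tendsto (fun t : ℝ => (1 - t) * lam T w y + t * lam T w z') (𝓝[>] 0)
        (𝓝 ((1 - 0) * lam T w y + 0 * lam T w z')) :=
      (Continuous.tendsto (by fun_prop) 0).mono_left nhdsWithin_le_nhds
    exact this.eventually_const_lt (by simpa using hpos w hw)
  obtain ⟨t, ht, ht01⟩ := (hev.and (Ioo_mem_nhdsGT (zero_lt_one (α := ℝ)))).exists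
  have h0 : lam T z y = 0 :=
    sT.lam_eq_zero_of_mem_face (Finset.erase_subset _ _) hyF hz (Finset.notMem_erase _ _)
  have hzpos : 0 < lam T z (y + t • (z' - y)) := by
    rw [lam_add_smul, h0, mul_zero, zero_add]
    exact mul_pos ht01.1 hκ
  have hxT : y + t • (z' - y) ∈ convexHull ℝ (T : Set (Pt d)) := by
    rw [sT.mem_convexHull_iff]
    intro w hw
    by_cases hwz : w = z
    · rw [hwz]; exact hzpos.le
    · exact (ht w (Finset.mem_erase.2 ⟨hwz, hw⟩)).le
  have hxT' : y + t • (z' - y) ∈ convexHull ℝ (T' : Set (Pt d)) := by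
    have hy' : y ∈ convexHull ℝ (T' : Set (Pt d)) := by
      rw [← hF] at hyF
      exact convexHull_mono (by exact_mod_cast Finset.erase_subset _ _) hyF
    exact (convex_convexHull ℝ _).add_smul_sub_mem hy' (subset_convexHull ℝ _ hz')
      ⟨ht01.1.le, ht01.2.le⟩
  have := sT.lam_eq_zero_of_mem_face Finset.inter_subset_left (𝒯.mem_inter hT hT' hxT hxT') hz
    (by simp [hzT'])
  exact hzpos.ne' this

/-- A face has two sides only: among three cells with this face two would be on the same side. In
signs, a product of two negative ratios cannot be the negative third one. -/
theorem opposite_unique (hd : 1 ≤ d) {T T₁ T₂ : Finset (Pt d)} (hT : T ∈ 𝒯.cells)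
    (hT₁ : T₁ ∈ 𝒯.cells) (hT₂ : T₂ ∈ 𝒯.cells) (hne₁ : T₁ ≠ T) (hne₂ : T₂ ≠ T) {z z₁ z₂ : Pt d}
    (hz : z ∈ T) (hz₁ : z₁ ∈ T₁) (hz₂ : z₂ ∈ T₂) (hF₁ : T₁.erase z₁ = T.erase z)
    (hF₂ : T₂.erase z₂ = T.erase z) : T₁ = T₂ ∧ z₁ = z₂ := by
  have hTT : T₁ = T₂ := by
    by_contra hne
    have h1 := 𝒯.lam_opposite_neg hd hT hT₂ hne₂ hz hz₂ hF₂
    have h2 := 𝒯.lam_opposite_neg hd hT₁ hT hne₁.symm hz₁ hz hF₁.symm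
    have h3 := 𝒯.lam_opposite_neg hd hT₁ hT₂ (Ne.symm hne) hz₁ hz₂ (hF₂.trans hF₁.symm)
    have h4 := lam_eq_mul_lam (𝒯.isSimplex hT₁) (𝒯.isSimplex hT) hz₁ hz hF₁.symm z₂
    nlinarith [mul_pos_of_neg_of_neg h2 h1]
  refine ⟨hTT, ?_⟩
  subst hTT
  by_contra hne
  have : z₁ ∈ T₁.erase z₂ := Finset.mem_erase.2 ⟨hne, hz₁⟩
  rw [hF₂, ← hF₁] at this
  exact Finset.notMem_erase _ _ this

/-- A test function vanishes on the faces that belong to one element only. -/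
theorem eq_zero_on_boundary_face (hd : 1 ≤ d) (hΩ : IsOpen Ω) {T : Finset (Pt d)}
    (hT : T ∈ 𝒯.cells) {z : Pt d} (hz : z ∈ T)
    (hbd : ∀ T' ∈ 𝒯.cells, T.erase z ⊆ T' → T' = T) {φ : Pt d → ℝ} (hφ : Continuous φ)
    (hsupp : tsupport φ ⊆ Ω) {y : Pt d}
    (hy : y ∈ convexHull ℝ ((T.erase z : Finset (Pt d)) : Set (Pt d))) : φ y = 0 := by
  have sT := 𝒯.isSimplex hT
  have hzero : ∀ y ∈ convexHull ℝ ((T.erase z : Finset (Pt d)) : Set (Pt d)), lam T z y = 0 :=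
    fun y hy => sT.lam_eq_zero_of_mem_face (Finset.erase_subset _ _) hy hz
      (Finset.notMem_erase _ _)
  have hface : ∀ y ∈ convexHull ℝ ((T.erase z : Finset (Pt d)) : Set (Pt d)),
      y ∈ convexHull ℝ (T : Set (Pt d)) := fun y hy =>
    convexHull_mono (by exact_mod_cast Finset.erase_subset _ _) hy
  -- Were such a point `y` in `Ω`, points slightly beyond the face would lie in `Ω`, hence in a cell
  -- `T' ≠ T`. By finiteness and closedness of the cells `y` also belongs to `T'`, and positivity of
  -- its coordinates forces the whole face into `T'`.
  have hrel : ∀ y ∈ convexHull ℝ ((T.erase z : Finset (Pt d)) : Set (Pt d)),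
      (∀ w ∈ T.erase z, 0 < lam T w y) → y ∉ Ω := by
    intro y hy hpos hyΩ
    have hev1 : ∀ᶠ x in 𝓝 y, ∀ T' ∈ 𝒯.cells, x ∈ convexHull ℝ (T' : Set (Pt d)) →
        y ∈ convexHull ℝ (T' : Set (Pt d)) := by
      rw [eventually_all_finite 𝒯.finite_cells]
      intro T' _
      by_cases h : y ∈ convexHull ℝ (T' : Set (Pt d))
      · exact Eventually.of_forall fun _ _ => h
      · filter_upwards [(T'.finite_toSet.isCompact_convexHull
          (𝕜 := ℝ)).isClosed.isOpen_compl.mem_nhds h] with x hx hx'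
        exact absurd hx' hx
    have hev2 := hev1.and (hΩ.mem_nhds hyΩ)
    have htend : Tendsto (fun t : ℝ => y + (-t) • (z - y)) (𝓝[>] 0) (𝓝 y) := by
      have : Tendsto (fun t : ℝ => y + (-t) • (z - y)) (𝓝 0) (𝓝 (y + (-(0 : ℝ)) • (z - y))) :=
        Continuous.tendsto (by fun_prop) 0
      rw [neg_zero, zero_smul, add_zero] at this
      exact this.mono_left nhdsWithin_le_nhds
    obtain ⟨t, ⟨ht1, ht2⟩, ht0⟩ := ((htend.eventually hev2).and self_mem_nhdsWithin).exists
    have hcl : y + (-t) • (z - y) ∈ closure Ω := subset_closure ht2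
    rw [← 𝒯.closure_eq, Set.mem_iUnion₂] at hcl
    obtain ⟨T', hT', hx⟩ := hcl
    have hyT' := ht1 T' hT' hx
    have hneg : lam T z (y + (-t) • (z - y)) < 0 := by
      rw [lam_add_smul, hzero y hy, sT.lam_self hz]
      have : 0 < t := ht0
      linarith
    have hTT' : T' ≠ T := by
      rintro rfl
      exact absurd (sT.mem_convexHull_iff.1 hx z hz) (not_le.2 hneg)
    refine hTT' (hbd T' hT' fun w hw => ?_)
    by_contra hwT'
    exact (hpos w hw).ne' (sT.lam_eq_zero_of_mem_face Finset.inter_subset_left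
      (𝒯.mem_inter hT hT' (hface y hy) hyT') (Finset.mem_of_mem_erase hw) (by simp [hwT']))
  obtain ⟨y₀, hy₀, hpos₀⟩ := sT.exists_pos_face hd hz
  -- An arbitrary point of the face is a limit of relatively interior ones, so continuity of `φ`
  -- finishes the argument.
  have hev : ∀ᶠ t in 𝓝[>] (0 : ℝ), φ (y + t • (y₀ - y)) = 0 := by
    filter_upwards [Ioo_mem_nhdsGT (zero_lt_one (α := ℝ))] with t ht
    have hmem := (convex_convexHull ℝ _).add_smul_sub_mem hy hy₀ ⟨ht.1.le, ht.2.le⟩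
    have hnot := hrel _ hmem fun w hw => by
      rw [lam_add_smul]
      have h1 := mul_pos ht.1 (hpos₀ w hw)
      have h2 : 0 ≤ (1 - t) * lam T w y := mul_nonneg (by linarith [ht.2])
        (sT.mem_convexHull_iff.1 (hface y hy) w (Finset.mem_of_mem_erase hw))
      linarith
    by_contra h
    exact hnot (hsupp (subset_tsupport _ h))
  have htend : Tendsto (fun t : ℝ => φ (y + t • (y₀ - y))) (𝓝[>] 0) (𝓝 (φ y)) := by
    have : Tendsto (fun t : ℝ => φ (y + t • (y₀ - y))) (𝓝 0) (𝓝 (φ (y + (0 : ℝ) • (y₀ - y)))) :=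
      Continuous.tendsto (by fun_prop) 0
    rw [zero_smul, add_zero] at this
    exact this.mono_left nhdsWithin_le_nhds
  exact tendsto_nhds_unique htend (tendsto_const_nhds.congr' (hev.mono fun _ h => h.symm))

end Mesh

/-! ### Integration over a mesh -/

theorem isCompact_simplex {d : ℕ} (T : Finset (Pt d)) :
    IsCompact (convexHull ℝ (T : Set (Pt d))) := T.finite_toSet.isCompact_convexHull (𝕜 := ℝ)

theorem isFiniteMeasure_restrict_simplex {d : ℕ} (T : Finset (Pt d)) :
    IsFiniteMeasure (volume.restrict (convexHull ℝ (T : Set (Pt d)))) :=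
  ⟨by rw [Measure.restrict_apply_univ]; exact (isCompact_simplex T).measure_lt_top⟩

theorem isFiniteMeasure_restrict {d : ℕ} {Ω : Set (Pt d)} (hbdd : Bornology.IsBounded Ω) :
    IsFiniteMeasure (volume.restrict Ω) :=
  ⟨by rw [Measure.restrict_apply_univ]; exact hbdd.measure_lt_top⟩

namespace Mesh

variable {d : ℕ} {Ω : Set (Pt d)} (𝒯 : Mesh Ω)

/-- The elements of the mesh as a finite set. -/
def cellsF : Finset (Finset (Pt d)) := 𝒯.finite_cells.toFinset

theorem mem_cellsF {T : Finset (Pt d)} : T ∈ 𝒯.cellsF ↔ T ∈ 𝒯.cells :=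
  𝒯.finite_cells.mem_toFinset

/-- A vertex `z` of `T` outside `T'` exists by cardinality, and the intersection lies in the
hyperplane where `lam T z` vanishes. -/
theorem aedisjoint {T T' : Finset (Pt d)} (hT : T ∈ 𝒯.cells) (hT' : T' ∈ 𝒯.cells) (hne : T ≠ T') :
    volume (convexHull ℝ (T : Set (Pt d)) ∩ convexHull ℝ (T' : Set (Pt d))) = 0 := by
  have sT := 𝒯.isSimplex hT
  have sT' := 𝒯.isSimplex hT'
  obtain ⟨z, hz, hzT'⟩ : ∃ z ∈ T, z ∉ T' := by
    by_contra h
    push Not at h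
    exact hne (Finset.eq_of_subset_of_card_le h (by rw [sT.card_eq, sT'.card_eq]))
  set H : AffineSubspace ℝ (Pt d) := (AffineSubspace.mk' (0 : ℝ) ⊥).comap (lam T z) with hH
  have hmem : ∀ x, x ∈ H ↔ lam T z x = 0 := fun x => by
    rw [hH, AffineSubspace.mem_comap, AffineSubspace.mem_mk']
    simp
  have hHtop : H ≠ ⊤ := by
    intro h
    have : z ∈ H := by rw [h]; exact AffineSubspace.mem_top _ _ _
    rw [hmem, sT.lam_self hz] at this
    exact one_ne_zero this
  refine measure_mono_null (fun x hx => ?_) (Measure.addHaar_affineSubspace volume H hHtop)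
  exact (hmem x).2 (sT.lam_eq_zero_of_mem_face Finset.inter_subset_left
    (𝒯.mem_inter hT hT' hx.1 hx.2) hz (by simp [hzT']))

theorem interior_subset_domain (hreg : interior (closure Ω) = Ω) {T : Finset (Pt d)}
    (hT : T ∈ 𝒯.cells) : interior (convexHull ℝ (T : Set (Pt d))) ⊆ Ω := by
  rw [← hreg]
  refine interior_mono ?_
  rw [← 𝒯.closure_eq]
  exact Set.subset_biUnion_of_mem (u := fun T : Finset (Pt d) => convexHull ℝ (T : Set (Pt d))) hT

theorem ae_eq_interior (T : Finset (Pt d)) :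
    (interior (convexHull ℝ (T : Set (Pt d))) : Set (Pt d)) =ᵐ[volume]
      convexHull ℝ (T : Set (Pt d)) :=
  interior_ae_eq_of_null_frontier ((convex_convexHull ℝ _).addHaar_frontier volume)

/-- Regularity of `Ω` puts the interiors of the cells into `Ω`. Thus `closure Ω \ Ω` is covered by
finitely many frontiers of convex sets, which are null sets. -/
theorem restrict_eq (hreg : interior (closure Ω) = Ω) :
    volume.restrict Ω
      = ∑ T ∈ 𝒯.cellsF, volume.restrict (convexHull ℝ (T : Set (Pt d))) := by
  have h1 : (Ω : Set (Pt d)) =ᵐ[volume] closure Ω := by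
    refine (LE.le.eventuallyLE subset_closure).antisymm ?_
    rw [ae_le_set]
    have hsub : closure Ω \ Ω ⊆ ⋃ T ∈ 𝒯.cells, frontier (convexHull ℝ (T : Set (Pt d))) := by
      rintro x ⟨hx, hxΩ⟩
      rw [← 𝒯.closure_eq, Set.mem_iUnion₂] at hx
      obtain ⟨T, hT, hx⟩ := hx
      refine Set.mem_iUnion₂.2 ⟨T, hT, subset_closure hx, fun hi => hxΩ ?_⟩
      exact 𝒯.interior_subset_domain hreg hT hi
    refine measure_mono_null hsub ((measure_biUnion_null_iff 𝒯.finite_cells.countable).2 ?_)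
    intro T _
    exact (convex_convexHull ℝ _).addHaar_frontier volume
  rw [Measure.restrict_congr_set h1, ← 𝒯.closure_eq, ← Finset.sum_coe_sort,
    ← Measure.sum_fintype, ← Measure.restrict_iUnion_ae]
  · congr 1
    ext x
    simp [mem_cellsF]
  · intro T T' hne
    exact 𝒯.aedisjoint (𝒯.mem_cellsF.1 T.2) (𝒯.mem_cellsF.1 T'.2) (fun h => hne (Subtype.ext h))
  · exact fun T => (isCompact_simplex _).measurableSet.nullMeasurableSet

theorem ae_iff (hreg : interior (closure Ω) = Ω) {P : Pt d → Prop} :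
    (∀ᵐ x ∂(volume.restrict Ω), P x) ↔
      ∀ T ∈ 𝒯.cells, ∀ᵐ x ∂(volume.restrict (convexHull ℝ (T : Set (Pt d)))), P x := by
  rw [𝒯.restrict_eq hreg, ae_finsetSum_measure_iff]
  simp only [mem_cellsF]

theorem ae_mem_imp_iff (hreg : interior (closure Ω) = Ω) {T : Finset (Pt d)} (hT : T ∈ 𝒯.cells)
    {P : Pt d → Prop} :
    (∀ᵐ x ∂(volume.restrict Ω), x ∈ convexHull ℝ (T : Set (Pt d)) → P x) ↔
      ∀ᵐ x ∂(volume.restrict (convexHull ℝ (T : Set (Pt d)))), P x := by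
  rw [𝒯.ae_iff hreg]
  constructor
  · intro h
    filter_upwards [h T hT, ae_restrict_mem (isCompact_simplex T).measurableSet] with x h1 h2
    exact h1 h2
  · intro h T' hT'
    by_cases hne : T = T'
    · subst hne
      filter_upwards [h] with x hx _ using hx
    · rw [ae_restrict_iff' (isCompact_simplex T').measurableSet]
      have h0 := 𝒯.aedisjoint hT hT' hne
      filter_upwards [measure_eq_zero_iff_ae_notMem.1 h0] with x hx h1 h2
      exact absurd ⟨h2, h1⟩ hx

theorem integrable_cell (hreg : interior (closure Ω) = Ω) {E : Type*} [NormedAddCommGroup E]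
    {f : Pt d → E} (hf : Integrable f (volume.restrict Ω)) {T : Finset (Pt d)}
    (hT : T ∈ 𝒯.cells) : Integrable f (volume.restrict (convexHull ℝ (T : Set (Pt d)))) := by
  rw [𝒯.restrict_eq hreg, integrable_finsetSum_measure] at hf
  exact hf T (𝒯.mem_cellsF.2 hT)

theorem integral_eq_sum (hreg : interior (closure Ω) = Ω) {f : Pt d → ℝ}
    (hf : Integrable f (volume.restrict Ω)) :
    ∫ x in Ω, f x = ∑ T ∈ 𝒯.cellsF, ∫ x in convexHull ℝ (T : Set (Pt d)), f x := by
  have h := fun (T : Finset (Pt d)) (hT : T ∈ 𝒯.cellsF) =>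
    𝒯.integrable_cell hreg hf (𝒯.mem_cellsF.1 hT)
  rw [𝒯.restrict_eq hreg, integral_finsetSum_measure h]

/-- Overlaps of cells are null sets, so the sum of the truncated pieces agrees a.e. on each cell
with its own piece. -/
theorem exists_piecewise (hreg : interior (closure Ω) = Ω) (hbdd : Bornology.IsBounded Ω)
    {E : Type*} [NormedAddCommGroup E] [SecondCountableTopology E] (F : Finset (Pt d) → Pt d → E)
    (hF : ∀ T, Continuous (F T)) :
    ∃ v : Lp E 2 (volume.restrict Ω), ∀ T ∈ 𝒯.cells,
      ∀ᵐ x ∂(volume.restrict (convexHull ℝ (T : Set (Pt d)))), v x = F T x := by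
  classical
  have := isFiniteMeasure_restrict hbdd
  have hmem : MemLp (fun x => ∑ T ∈ 𝒯.cellsF,
      Set.indicator (convexHull ℝ (T : Set (Pt d))) (F T) x) 2 (volume.restrict Ω) := by
    refine memLp_finsetSum _ fun T _ => ?_
    obtain ⟨M, hM⟩ := (isCompact_simplex T).exists_bound_of_continuousOn (hF T).continuousOn
    refine MemLp.of_bound (C := max M 0) ?_ (ae_of_all _ fun x => ?_)
    · exact ((hF T).aestronglyMeasurable).indicator (isCompact_simplex T).measurableSet
    · by_cases hx : x ∈ convexHull ℝ (T : Set (Pt d))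
      · rw [Set.indicator_of_mem hx]
        exact (hM x hx).trans (le_max_left _ _)
      · rw [Set.indicator_of_notMem hx, norm_zero]
        exact le_max_right _ _
  refine ⟨hmem.toLp _, fun T hT => ?_⟩
  have h1 := (𝒯.ae_iff hreg).1 hmem.coeFn_toLp T hT
  have h2 : ∀ᵐ x ∂(volume.restrict (convexHull ℝ (T : Set (Pt d)))), ∀ T' ∈ 𝒯.cells, T' ≠ T →
      x ∉ convexHull ℝ (T' : Set (Pt d)) := by
    rw [ae_ball_iff 𝒯.finite_cells.countable]
    intro T' hT'
    by_cases hne : T' = T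
    · exact ae_of_all _ fun _ h => absurd hne h
    · rw [ae_restrict_iff' (isCompact_simplex T).measurableSet]
      filter_upwards [measure_eq_zero_iff_ae_notMem.1 (𝒯.aedisjoint hT' hT hne)] with x hx h1 _ h2
      exact hx ⟨h2, h1⟩
  filter_upwards [h1, h2, ae_restrict_mem (isCompact_simplex T).measurableSet] with x hx1 hx2 hx3
  rw [hx1, Finset.sum_eq_single T]
  · rw [Set.indicator_of_mem hx3]
  · intro T' hT' hne
    exact Set.indicator_of_notMem (hx2 T' (𝒯.mem_cellsF.1 hT') hne) _
  · intro h
    exact absurd (𝒯.mem_cellsF.2 hT) h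

theorem mem_W_iff (hreg : interior (closure Ω) = Ω) {w : L2 Ω} :
    w ∈ 𝒯.W ↔ ∀ T ∈ 𝒯.cells, ∃ c : ℝ,
      ∀ᵐ x ∂(volume.restrict (convexHull ℝ (T : Set (Pt d)))), w x = c := by
  refine forall₂_congr fun T hT => exists_congr fun c => ?_
  exact 𝒯.ae_mem_imp_iff hreg hT

theorem mem_V_iff (hreg : interior (closure Ω) = Ω) {v : L2v Ω} :
    v ∈ 𝒯.V ↔ v ∈ Hdiv Ω ∧ ∀ T ∈ 𝒯.cells, ∃ (a : Pt d) (b : ℝ),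
      ∀ᵐ x ∂(volume.restrict (convexHull ℝ (T : Set (Pt d)))), v x = a + b • x := by
  refine and_congr_right fun _ => forall₂_congr fun T hT => exists_congr fun a =>
    exists_congr fun b => ?_
  exact 𝒯.ae_mem_imp_iff hreg hT

end Mesh

/-! ### The weak divergence on one element -/

theorem IsSimplex.pos_of_mem_interior {d : ℕ} {T : Finset (Pt d)} (hT : IsSimplex T)
    {x z : Pt d} (hx : x ∈ interior (convexHull ℝ (T : Set (Pt d)))) (hz : z ∈ T) :
    0 < lam T z x := by
  have htend : Tendsto (fun t : ℝ => x + (-t) • (z - x)) (𝓝[>] 0) (𝓝 x) := by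
    have : Tendsto (fun t : ℝ => x + (-t) • (z - x)) (𝓝 0) (𝓝 (x + (-(0 : ℝ)) • (z - x))) :=
      Continuous.tendsto (by fun_prop) 0
    rw [neg_zero, zero_smul, add_zero] at this
    exact this.mono_left nhdsWithin_le_nhds
  obtain ⟨t, ht, ht0⟩ := ((htend.eventually (mem_interior_iff_mem_nhds.1 hx)).and
    self_mem_nhdsWithin).exists
  have h := hT.mem_convexHull_iff.1 ht z hz
  rw [lam_add_smul, hT.lam_self hz] at h
  have ht0 : 0 < t := ht0
  by_contra hneg
  push Not at hneg
  nlinarith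

/-- The coefficients must have sum `b` and satisfy `∑ c z • z = -a`; they come from the identity `∑
lam T z y • z = y` at `y = 0` and `y = a`. -/
theorem IsSimplex.exists_affine_decomp {d : ℕ} {T : Finset (Pt d)} (hT : IsSimplex T) (a : Pt d)
    (b : ℝ) : ∃ c : Pt d → ℝ, ∑ z ∈ T, c z = b ∧ ∀ x, ∑ z ∈ T, c z • (x - z) = a + b • x := by
  refine ⟨fun z => b * lam T z 0 - (lam T z a - lam T z 0), ?_, fun x => ?_⟩
  · rw [Finset.sum_sub_distrib, Finset.sum_sub_distrib, ← Finset.mul_sum, hT.sum_lam, hT.sum_lam]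
    ring
  · simp only [smul_sub, sub_smul, mul_smul, Finset.sum_sub_distrib, ← Finset.smul_sum,
      hT.sum_lam_smul, ← Finset.sum_smul, hT.sum_lam]
    module

theorem integral_fderiv_simplex {d : ℕ} {T : Finset (Pt d)}
    (hT : IsSimplex T) (z : Pt d) {φ : Pt d → ℝ} (hφ : ContDiff ℝ 1 φ) :
    ∫ x in convexHull ℝ (T : Set (Pt d)), fderiv ℝ φ x (x - z)
      = volume.real (convexHull ℝ (T : Set (Pt d))) * coneMean φ T z
        - d * ∫ x in convexHull ℝ (T : Set (Pt d)), φ x := by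
  have h1 : Continuous fun x => fderiv ℝ φ x (x - z) :=
    (hφ.continuous_fderiv one_ne_zero).clm_apply (by fun_prop)
  have h2 := hφ.continuous
  have i1 := h1.continuousOn.integrableOn_compact (μ := volume) (isCompact_simplex T)
  have i2 := (h2.const_mul (d : ℝ)).continuousOn.integrableOn_compact (μ := volume)
    (isCompact_simplex T)
  rw [coneMean, mul_div_cancel₀ _ hT.volume_pos.ne', integral_add i2 i1, integral_const_mul]
  ring

namespace Mesh

variable {d : ℕ} {Ω : Set (Pt d)} (𝒯 : Mesh Ω)

/-- A test function supported inside the cell vanishes on all its faces, so no face term survives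
and each summand `c z • (x - z)` contributes its pointwise divergence `d * c z`. -/
theorem weakDiv_cell (hd : 1 ≤ d) (hreg : interior (closure Ω) = Ω) {v : L2v Ω} {g : L2 Ω}
    (hv : HasWeakDiv v g) {T : Finset (Pt d)} (hT : T ∈ 𝒯.cells) {a : Pt d} {b : ℝ}
    (hab : ∀ᵐ x ∂(volume.restrict (convexHull ℝ (T : Set (Pt d)))), v x = a + b • x) :
    ∀ᵐ x ∂(volume.restrict (convexHull ℝ (T : Set (Pt d)))), g x = d * b := by
  have sT := 𝒯.isSimplex hT
  set K := convexHull ℝ (T : Set (Pt d)) with hK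
  have hUΩ := 𝒯.interior_subset_domain hreg hT
  have hKm : MeasurableSet K := (isCompact_simplex T).measurableSet
  have := isFiniteMeasure_restrict_simplex T
  have hgK : MemLp g 2 (volume.restrict K) := by
    rw [← Measure.restrict_congr_set (ae_eq_interior T)]
    exact (Lp.memLp g).mono_measure (Measure.restrict_mono hUΩ le_rfl)
  have hmem : MemLp (fun x => g x - d * b) 2 (volume.restrict K) := hgK.sub (memLp_const _)
  have hloc : LocallyIntegrable (fun x => g x - d * b) (volume.restrict K) :=
    hmem.locallyIntegrable (by norm_num)
  have key : ∀ᵐ x ∂(volume.restrict K), x ∈ interior K → g x - d * b = 0 := by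
    refine isOpen_interior.ae_eq_zero_of_integral_contDiff_smul_eq_zero
      (hloc.locallyIntegrableOn _) fun φ h1 h2 h3 => ?_
    have hφ1 : ContDiff ℝ 1 φ := h1.of_le (by exact_mod_cast le_top)
    have hφ0 : ∀ x, x ∉ interior K → φ x = 0 := fun x hx => by
      by_contra h
      exact hx (h3 (subset_tsupport _ h))
    have hφ'0 : ∀ x, x ∉ interior K → fderiv ℝ φ x = 0 := fun x hx => by
      by_contra h
      exact hx (h3 (support_fderiv_subset ℝ h))
    have e := hv φ h1 h2 (h3.trans hUΩ)
    have hset : ∀ f : Pt d → ℝ, (∀ x, x ∉ interior K → f x = 0) →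
        ∫ x in Ω, f x = ∫ x in K, f x := fun f hf => by
      rw [setIntegral_eq_integral_of_forall_compl_eq_zero fun x hx => hf x fun h => hx (hUΩ h),
        setIntegral_eq_integral_of_forall_compl_eq_zero fun x hx =>
          hf x fun h => hx (interior_subset h)]
    rw [hset _ fun x hx => by rw [hφ'0 x hx]; rfl,
      hset _ fun x hx => by rw [hφ0 x hx, mul_zero]] at e
    obtain ⟨c, hc, hcx⟩ := sT.exists_affine_decomp a b
    have e2 : ∫ x in K, fderiv ℝ φ x (v x) = - (d * b) * ∫ x in K, φ x := by
      have hintg : ∀ z ∈ T, Integrable (fun x => c z * fderiv ℝ φ x (x - z))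
          (volume.restrict K) := fun z _ => by
        have : Continuous fun x => c z * fderiv ℝ φ x (x - z) :=
          ((hφ1.continuous_fderiv one_ne_zero).clm_apply (by fun_prop)).const_mul _
        exact this.continuousOn.integrableOn_compact (isCompact_simplex T)
      have : ∫ x in K, fderiv ℝ φ x (v x) = ∫ x in K, ∑ z ∈ T, c z * fderiv ℝ φ x (x - z) := by
        refine integral_congr_ae ?_
        filter_upwards [hab] with x hx
        rw [hx, ← hcx x, map_sum]
        simp
      rw [this, integral_finsetSum _ hintg, ← hc, Finset.mul_sum, ← Finset.sum_neg_distrib,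
        Finset.sum_mul]
      refine Finset.sum_congr rfl fun z hz => ?_
      rw [integral_const_mul, integral_fderiv_simplex sT z hφ1, coneMean_eq_zero hd sT hz hφ1]
      · ring
      · intro y hy
        refine hφ0 y fun hyi => ?_
        exact (sT.pos_of_mem_interior hyi hz).ne' (sT.lam_eq_zero_of_mem_face
          (Finset.erase_subset _ _) hy hz (Finset.notMem_erase _ _))
    have hφ2 : MemLp φ 2 (volume.restrict K) := h1.continuous.memLp_of_hasCompactSupport h2
    have i1 : Integrable (fun x => g x * φ x) (volume.restrict K) := hgK.integrable_mul hφ2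
    have i2 : Integrable (fun x => d * b * φ x) (volume.restrict K) :=
      (hφ2.integrable (by norm_num)).const_mul _
    have e3 : ∀ x, φ x • (g x - d * b) = g x * φ x - d * b * φ x := fun x => by
      simp only [smul_eq_mul]; ring
    simp only [e3]
    rw [integral_sub i1 i2, integral_const_mul]
    linarith
  have hintg : ∀ᵐ x ∂(volume.restrict K), x ∈ interior K := by
    rw [← Measure.restrict_congr_set (ae_eq_interior T)]
    exact ae_restrict_mem isOpen_interior.measurableSet
  filter_upwards [key, hintg] with x h1 h2
  linarith [h1 h2]

end Mesh

/-! ### Flows on a finite graph -/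

section Flow

variable {K I : Type*}

theorem sum_comp_involutive [Fintype I] {f : I → ℝ} {inv : I → I} (hinv : Function.Involutive inv) :
    ∑ i, f (inv i) = ∑ i, f i :=
  Equiv.sum_comp hinv.toPerm f

/-- The jump of a function on the vertices; loops of `inv` are edges to the exterior, where the
function is taken to vanish. -/
def jump [DecidableEq I] (c : I → K) (inv : I → I) (p : K → ℝ) (i : I) : ℝ :=
  if inv i = i then p (c i) else p (c i) - p (c (inv i))

theorem jump_inv [DecidableEq I] {c : I → K} {inv : I → I} (hinv : Function.Involutive inv)
    (p : K → ℝ) {i : I} (hi : inv i ≠ i) : jump c inv p (inv i) = - jump c inv p i := by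
  have hi' : inv (inv i) ≠ inv i := by rw [hinv i]; exact hi.symm
  rw [jump, jump, if_neg hi, if_neg hi', hinv i]
  ring

/-- The energy controls the jumps. -/
theorem sum_jump_sq_le [Fintype I] [DecidableEq I] {c : I → K} {inv : I → I}
    (hinv : Function.Involutive inv) (p : K → ℝ)
    {wt : I → ℝ} (hwt : ∀ i, 0 < wt i) (hwtinv : ∀ i, wt (inv i) = wt i) :
    ∑ i, wt i * jump c inv p i ^ 2 ≤ 2 * ∑ i, wt i * jump c inv p i * p (c i) := by
  -- Symmetrize under `inv`: an edge and its reverse together give jump times jump. A loop gives `2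
  -- * wt * p ^ 2`, whence an inequality and not an equality.
  have h := sum_comp_involutive (f := fun i => wt i * jump c inv p i * p (c i)) hinv
  rw [two_mul]
  nth_rewrite 1 [← h]
  rw [← Finset.sum_add_distrib]
  refine Finset.sum_le_sum fun i _ => ?_
  by_cases hi : inv i = i
  · rw [hi, jump, if_pos hi]
    nlinarith [mul_nonneg (hwt i).le (sq_nonneg (p (c i)))]
  · rw [jump_inv hinv p hi, hwtinv, jump, if_neg hi]
    refine le_of_eq ?_
    ring

/-- A discrete Poincaré inequality. -/
theorem sum_sq_le_sum_jump_sq [Fintype K] [DecidableEq K] [Fintype I] [DecidableEq I]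
    {c : I → K} {inv : I → I} (hinv : Function.Involutive inv) {m θ : K → ℝ}
    (hm : ∀ k, 0 < m k) (hθ : ∀ k, 0 < θ k) {Φ : I → ℝ}
    (hsum : ∀ k, ∑ i with c i = k, Φ i = m k) (hanti : ∀ i, inv i ≠ i → Φ (inv i) = - Φ i)
    {N : ℕ} (hcard : ∀ k, (Finset.univ.filter fun i => c i = k).card = N) {A μ : ℝ}
    (hA : ∀ i, Φ i ^ 2 * θ (c i) ≤ A * m (c i)) (hA0 : 0 ≤ A)
    (hμ : ∀ i, m (c (inv i)) ≤ μ * m (c i)) (p : K → ℝ) :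
    ∑ k, m k * p k ^ 2
      ≤ A * N * (1 + μ) * ∑ i, (θ (c i) + θ (c (inv i)))⁻¹ * jump c inv p i ^ 2 := by
  have hfib : ∀ f : I → ℝ, ∑ k, ∑ i with c i = k, f i = ∑ i, f i := fun f =>
    Finset.sum_fiberwise Finset.univ c f
  set P := ∑ k, m k * p k ^ 2 with hP
  set D := ∑ i, (θ (c i) + θ (c (inv i)))⁻¹ * jump c inv p i ^ 2 with hD
  have hθ2 : ∀ i, 0 < θ (c i) + θ (c (inv i)) := fun i => add_pos (hθ _) (hθ _)
  have hP0 : 0 ≤ P := Finset.sum_nonneg fun k _ => mul_nonneg (hm k).le (sq_nonneg _)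
  -- Discrete form of writing `∫ p²` as `∫ p² div F` for a field `F` of divergence one.
  have hPΦ : P = ∑ i, Φ i * p (c i) ^ 2 := by
    rw [← hfib]
    refine Finset.sum_congr rfl fun k _ => ?_
    rw [← hsum k, Finset.sum_mul]
    refine Finset.sum_congr rfl fun i hi => ?_
    rw [(Finset.mem_filter.1 hi).2]
  have hPN : ∑ i, m (c i) * p (c i) ^ 2 = N * P := by
    rw [← hfib, hP, Finset.mul_sum]
    refine Finset.sum_congr rfl fun k _ => ?_
    rw [Finset.sum_congr rfl (g := fun _ => m k * p k ^ 2) fun i hi => by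
      rw [(Finset.mem_filter.1 hi).2], Finset.sum_const, hcard, nsmul_eq_mul]
  have hΦabs : ∀ i, Φ (inv i) ^ 2 = Φ i ^ 2 := fun i => by
    by_cases hi : inv i = i
    · rw [hi]
    · rw [hanti i hi, neg_sq]
  -- Summation by parts: antisymmetry of `Φ` turns `p ^ 2` into differences of squares, which factor
  -- into a jump and a sum.
  have h2P : 2 * P ≤ ∑ i, |jump c inv p i| * (|Φ i| * (|p (c i)| + |p (c (inv i))|)) := by
    have h := sum_comp_involutive (f := fun i => Φ i * p (c i) ^ 2) hinv
    rw [two_mul, hPΦ]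
    nth_rewrite 1 [← h]
    rw [← Finset.sum_add_distrib]
    refine Finset.sum_le_sum fun i _ => ?_
    by_cases hi : inv i = i
    · rw [hi, jump, if_pos hi]
      have h1 : Φ i * p (c i) ^ 2 ≤ |Φ i| * |p (c i)| ^ 2 := by
        rw [sq_abs]
        exact mul_le_mul_of_nonneg_right (le_abs_self _) (sq_nonneg _)
      refine (add_le_add h1 h1).trans (le_of_eq ?_)
      ring
    · rw [hanti i hi, jump, if_neg hi]
      calc -Φ i * p (c (inv i)) ^ 2 + Φ i * p (c i) ^ 2
          = (p (c i) - p (c (inv i))) * (Φ i * (p (c i) + p (c (inv i)))) := by ring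
        _ ≤ |(p (c i) - p (c (inv i))) * (Φ i * (p (c i) + p (c (inv i))))| := le_abs_self _
        _ ≤ _ := by
          rw [abs_mul, abs_mul]
          gcongr
          exact abs_add_le _ _
  -- Cauchy–Schwarz with the weights `(θ + θ')⁻¹` on the jumps and `θ + θ'` on the rest. The rest is
  -- bounded by `P` because `Φ ^ 2 * θ` is controlled by `m` and neighbouring masses are comparable.
  -- One factor `P` then cancels.
  have hCS : (2 * P) ^ 2 ≤ D * (4 * (A * N * (1 + μ)) * P) := by
    have hE : ∑ i, (θ (c i) + θ (c (inv i))) * (|Φ i| * (|p (c i)| + |p (c (inv i))|)) ^ 2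
        ≤ 4 * (A * N * (1 + μ)) * P := by
      have hterm : ∀ i, (θ (c i) + θ (c (inv i))) * (|Φ i| * (|p (c i)| + |p (c (inv i))|)) ^ 2
          ≤ 2 * A * (1 + μ) * (m (c i) * p (c i) ^ 2)
            + 2 * A * (1 + μ) * (m (c (inv i)) * p (c (inv i)) ^ 2) := by
        intro i
        have h1 := hA i
        have h2 := hA (inv i)
        rw [hΦabs] at h2
        have h3 := hμ i
        have h4 := hμ (inv i)
        rw [hinv i] at h4
        have h5 : (|p (c i)| + |p (c (inv i))|) ^ 2 ≤ 2 * (p (c i) ^ 2 + p (c (inv i)) ^ 2) := by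
          rw [← sq_abs (p (c i)), ← sq_abs (p (c (inv i)))]
          nlinarith [sq_nonneg (|p (c i)| - |p (c (inv i))|)]
        have h6 : (θ (c i) + θ (c (inv i))) * Φ i ^ 2 ≤ A * (m (c i) + m (c (inv i))) := by
          linarith
        have h7 : 0 ≤ (θ (c i) + θ (c (inv i))) * Φ i ^ 2 :=
          mul_nonneg (hθ2 i).le (sq_nonneg _)
        calc (θ (c i) + θ (c (inv i))) * (|Φ i| * (|p (c i)| + |p (c (inv i))|)) ^ 2
            = (θ (c i) + θ (c (inv i))) * Φ i ^ 2 * (|p (c i)| + |p (c (inv i))|) ^ 2 := by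
              rw [mul_pow, sq_abs]; ring
          _ ≤ (θ (c i) + θ (c (inv i))) * Φ i ^ 2 * (2 * (p (c i) ^ 2 + p (c (inv i)) ^ 2)) :=
              mul_le_mul_of_nonneg_left h5 h7
          _ ≤ A * (m (c i) + m (c (inv i))) * (2 * (p (c i) ^ 2 + p (c (inv i)) ^ 2)) :=
              mul_le_mul_of_nonneg_right h6 (by positivity)
          _ = 2 * A * ((m (c i) + m (c (inv i))) * p (c i) ^ 2
                + (m (c i) + m (c (inv i))) * p (c (inv i)) ^ 2) := by ring
          _ ≤ 2 * A * (((1 + μ) * m (c i)) * p (c i) ^ 2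
                + ((1 + μ) * m (c (inv i))) * p (c (inv i)) ^ 2) := by
              have h8 : m (c i) + m (c (inv i)) ≤ (1 + μ) * m (c i) := by linarith
              have h9 : m (c i) + m (c (inv i)) ≤ (1 + μ) * m (c (inv i)) := by linarith
              gcongr
          _ = _ := by ring
      refine (Finset.sum_le_sum fun i _ => hterm i).trans (le_of_eq ?_)
      rw [Finset.sum_add_distrib, ← Finset.mul_sum, ← Finset.mul_sum,
        sum_comp_involutive (f := fun i => m (c i) * p (c i) ^ 2) hinv, hPN]
      ring
    have hD0 : 0 ≤ D := Finset.sum_nonneg fun i _ =>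
      mul_nonneg (inv_nonneg.2 (hθ2 i).le) (sq_nonneg _)
    refine (pow_le_pow_left₀ (by linarith) h2P 2).trans ?_
    refine le_trans ?_ (mul_le_mul_of_nonneg_left hE hD0)
    refine Finset.sum_sq_le_sum_mul_sum_of_sq_le_mul _ (fun i _ => ?_) (fun i _ => ?_)
      (fun i _ => ?_)
    · exact mul_nonneg (inv_nonneg.2 (hθ2 i).le) (sq_nonneg _)
    · exact mul_nonneg (hθ2 i).le (sq_nonneg _)
    · rw [mul_pow, sq_abs]
      have := (hθ2 i).ne'
      refine le_of_eq ?_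
      field_simp
  rcases hP0.eq_or_lt with h0 | hpos
  · rw [← h0]
    by_cases hK : Nonempty I
    · obtain ⟨i⟩ := hK
      have hμ0 : 0 ≤ μ := by
        by_contra hneg
        push Not at hneg
        nlinarith [hμ i, hm (c (inv i)), hm (c i)]
      refine mul_nonneg (by positivity) (Finset.sum_nonneg fun i _ =>
        mul_nonneg (inv_nonneg.2 (hθ2 i).le) (sq_nonneg _))
    · rw [not_nonempty_iff] at hK
      simp [hD]
  · have : P * (4 * P) ≤ P * (4 * (A * N * (1 + μ) * D)) := by nlinarith
    have := le_of_mul_le_mul_left this hpos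
    linarith

/-- Every source is balanced by an antisymmetric flow of comparable energy. -/
theorem exists_flow [Fintype K] [DecidableEq K] [Fintype I] [DecidableEq I]
    {c : I → K} {inv : I → I} (hinv : Function.Involutive inv) {m θ : K → ℝ}
    (hm : ∀ k, 0 < m k) (hθ : ∀ k, 0 < θ k) {Φ : I → ℝ}
    (hsum : ∀ k, ∑ i with c i = k, Φ i = m k) (hanti : ∀ i, inv i ≠ i → Φ (inv i) = - Φ i)
    {N : ℕ} (hcard : ∀ k, (Finset.univ.filter fun i => c i = k).card = N) {A μ : ℝ}
    (hA : ∀ i, Φ i ^ 2 * θ (c i) ≤ A * m (c i)) (hA0 : 0 ≤ A)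
    (hμ : ∀ i, m (c (inv i)) ≤ μ * m (c i)) (w : K → ℝ) :
    ∃ g : I → ℝ, (∀ i, inv i ≠ i → g (inv i) = - g i) ∧
      (∀ k, ∑ i with c i = k, g i = m k * w k) ∧
      ∑ i, g i ^ 2 * θ (c i) ≤ 4 * (A * N * (1 + μ)) * ∑ k, m k * w k ^ 2 := by
  set wt : I → ℝ := fun i => (θ (c i) + θ (c (inv i)))⁻¹ with hwt
  have hθ2 : ∀ i, 0 < θ (c i) + θ (c (inv i)) := fun i => add_pos (hθ _) (hθ _)
  have hwtpos : ∀ i, 0 < wt i := fun i => inv_pos.2 (hθ2 i)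
  have hwtinv : ∀ i, wt (inv i) = wt i := fun i => by
    simp only [hwt]; rw [hinv i, add_comm]
  have hfib : ∀ f : I → ℝ, ∑ k, ∑ i with c i = k, f i = ∑ i, f i := fun f =>
    Finset.sum_fiberwise Finset.univ c f
  have hpoin := sum_sq_le_sum_jump_sq hinv hm hθ hsum hanti hcard hA hA0 hμ
  -- The weighted graph Laplacian with zero potential outside; the flow sought is the weighted jump
  -- of a potential `p` with `Lap p = m w`.
  let Lap : (K → ℝ) →ₗ[ℝ] (K → ℝ) :=
    { toFun := fun p k => ∑ i with c i = k, wt i * jump c inv p i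
      map_add' := fun p q => by
        ext k
        simp only [Pi.add_apply]
        rw [← Finset.sum_add_distrib]
        refine Finset.sum_congr rfl fun i _ => ?_
        simp only [jump, Pi.add_apply]
        split_ifs <;> ring
      map_smul' := fun a p => by
        ext k
        simp only [Pi.smul_apply, smul_eq_mul, RingHom.id_apply]
        rw [Finset.mul_sum]
        refine Finset.sum_congr rfl fun i _ => ?_
        simp only [jump, Pi.smul_apply, smul_eq_mul]
        split_ifs <;> ring }
  have hLap : ∀ p, ∑ k, Lap p k * p k = ∑ i, wt i * jump c inv p i * p (c i) := fun p => by
    rw [← hfib]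
    refine Finset.sum_congr rfl fun k _ => ?_
    change (∑ i with c i = k, wt i * jump c inv p i) * p k = _
    rw [Finset.sum_mul]
    refine Finset.sum_congr rfl fun i hi => ?_
    rw [(Finset.mem_filter.1 hi).2]
  have hnn : ∀ p, 0 ≤ ∑ i, wt i * jump c inv p i ^ 2 := fun p =>
    Finset.sum_nonneg fun i _ => mul_nonneg (hwtpos i).le (sq_nonneg _)
  -- The Poincaré inequality makes `Lap` injective, hence surjective in finite dimension.
  have hinj : Function.Injective Lap := by
    rw [← LinearMap.ker_eq_bot, LinearMap.ker_eq_bot']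
    intro p hp
    have h1 := sum_jump_sq_le (c := c) hinv p hwtpos hwtinv
    rw [← hLap p, hp] at h1
    simp only [Pi.zero_apply, zero_mul, Finset.sum_const_zero, mul_zero] at h1
    have h2 := hpoin p
    have h3 : ∑ i, wt i * jump c inv p i ^ 2 = 0 := le_antisymm h1 (hnn p)
    rw [h3, mul_zero] at h2
    have h4 := (Finset.sum_eq_zero_iff_of_nonneg fun k _ =>
      mul_nonneg (hm k).le (sq_nonneg (p k))).1
      (le_antisymm h2 (Finset.sum_nonneg fun k _ => mul_nonneg (hm k).le (sq_nonneg (p k))))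
    ext k
    have := h4 k (Finset.mem_univ k)
    simpa [(hm k).ne'] using this
  obtain ⟨p, hp⟩ := LinearMap.injective_iff_surjective.1 hinj (fun k => m k * w k)
  refine ⟨fun i => wt i * jump c inv p i, fun i hi => ?_, fun k => ?_, ?_⟩
  · dsimp only
    rw [jump_inv hinv p hi, hwtinv]; ring
  · exact congrFun hp k
  · set D := ∑ i, wt i * jump c inv p i ^ 2 with hD
    set Q := ∑ k, m k * w k ^ 2 with hQ
    have hQ0 : 0 ≤ Q := Finset.sum_nonneg fun k _ => mul_nonneg (hm k).le (sq_nonneg _)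
    -- The weight was chosen so that `wt * θ ≤ 1`; the energy of the flow is then at most that of
    -- the jumps.
    have hgD : ∑ i, (wt i * jump c inv p i) ^ 2 * θ (c i) ≤ D := by
      refine Finset.sum_le_sum fun i _ => ?_
      have h1 : wt i * θ (c i) ≤ 1 := by
        simp only [hwt]
        rw [inv_mul_le_iff₀ (hθ2 i)]
        linarith [hθ (c (inv i))]
      calc (wt i * jump c inv p i) ^ 2 * θ (c i)
          = (wt i * jump c inv p i ^ 2) * (wt i * θ (c i)) := by ring
        _ ≤ (wt i * jump c inv p i ^ 2) * 1 :=
            mul_le_mul_of_nonneg_left h1 (mul_nonneg (hwtpos i).le (sq_nonneg _))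
        _ = _ := mul_one _
    refine hgD.trans ?_
    have h1 := sum_jump_sq_le (c := c) hinv p hwtpos hwtinv
    rw [← hLap p, hp] at h1
    have h2 : (∑ k, m k * w k * p k) ^ 2 ≤ Q * ∑ k, m k * p k ^ 2 := by
      refine Finset.sum_sq_le_sum_mul_sum_of_sq_le_mul _ (fun k _ => ?_) (fun k _ => ?_)
        (fun k _ => ?_)
      · exact mul_nonneg (hm k).le (sq_nonneg _)
      · exact mul_nonneg (hm k).le (sq_nonneg _)
      · exact le_of_eq (by ring)
    -- Testing the equation with `p`, then Cauchy–Schwarz and Poincaré, bounds `D ^ 2` by `D` times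
    -- the source; dividing by `D` gives the claim.
    have h3 : D ^ 2 ≤ D * (4 * (A * N * (1 + μ)) * Q) := by
      calc D ^ 2 ≤ (2 * ∑ k, m k * w k * p k) ^ 2 := pow_le_pow_left₀ (hnn p) h1 2
        _ = 4 * (∑ k, m k * w k * p k) ^ 2 := by ring
        _ ≤ 4 * (Q * ∑ k, m k * p k ^ 2) := by linarith
        _ ≤ 4 * (Q * (A * N * (1 + μ) * D)) := by
            have := mul_le_mul_of_nonneg_left (hpoin p) hQ0
            linarith
        _ = _ := by ring
    rcases (hnn p).eq_or_lt with h0 | hpos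
    · rw [hD, ← h0]
      by_cases hI : Nonempty I
      · obtain ⟨i⟩ := hI
        have hμ0 : 0 ≤ μ := by
          by_contra hneg
          push Not at hneg
          nlinarith [hμ i, hm (c (inv i)), hm (c i)]
        positivity
      · rw [not_nonempty_iff] at hI
        have hQz : Q = 0 := by
          refine Finset.sum_eq_zero fun k _ => ?_
          have := hsum k
          simp at this
          exact absurd this (hm k).ne
        rw [hQz, mul_zero]
    · rw [sq] at h3
      exact le_of_mul_le_mul_left h3 hpos

end Flow

/-! ### Raviart–Thomas fields from fluxes -/

theorem norm_sq_eq_integral {d : ℕ} {Ω : Set (Pt d)} {E : Type*} [NormedAddCommGroup E]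
    [InnerProductSpace ℝ E] (v : Lp E 2 (volume.restrict Ω)) :
    ‖v‖ ^ 2 = ∫ x in Ω, ‖v x‖ ^ 2 := by
  rw [← real_inner_self_eq_norm_sq, L2.inner_def]
  simp only [real_inner_self_eq_norm_sq]

theorem integrable_norm_sq {d : ℕ} {Ω : Set (Pt d)} {E : Type*} [NormedAddCommGroup E]
    (v : Lp E 2 (volume.restrict Ω)) : Integrable (fun x => ‖v x‖ ^ 2) (volume.restrict Ω) :=
  (memLp_two_iff_integrable_sq_norm (Lp.memLp v).1).1 (Lp.memLp v)

theorem integrable_fderiv_apply {d : ℕ} {Ω : Set (Pt d)} {φ : Pt d → ℝ} (hφ : ContDiff ℝ 1 φ)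
    (hsupp : HasCompactSupport φ) (v : L2v Ω) :
    Integrable (fun x => fderiv ℝ φ x (v x)) (volume.restrict Ω) := by
  have hφ' : MemLp (fderiv ℝ φ) 2 (volume.restrict Ω) :=
    (hφ.continuous_fderiv one_ne_zero).memLp_of_hasCompactSupport (hsupp.fderiv ℝ)
  refine memLp_one_iff_integrable.1 (MemLp.of_bilin (r := 1) (fun (f : Pt d →L[ℝ] ℝ) x => f x) 1
    hφ' (Lp.memLp v) ?_ (ae_of_all _ fun x => ?_))
  · exact (ContinuousLinearMap.apply ℝ ℝ : Pt d →L[ℝ] _).aestronglyMeasurable_comp₂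
      (Lp.memLp v).1 hφ'.1
  · simpa using (fderiv ℝ φ x).le_opNNNorm (v x)

namespace Mesh

variable {d : ℕ} {Ω : Set (Pt d)} (𝒯 : Mesh Ω)

/-- The facets of the elements of the mesh, each given by an element and the opposite vertex. -/
abbrev Facet := Σ T : 𝒯.cellsF, T.1

/-- The facets `i` and `j` are the same face, seen from different elements. -/
def Opposite (i j : 𝒯.Facet) : Prop := j.1 ≠ i.1 ∧ j.1.1.erase j.2.1 = i.1.1.erase i.2.1

open Classical in
/-- The same face seen from the neighbouring element, or the facet itself if it lies on the
boundary. -/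
def flip (i : 𝒯.Facet) : 𝒯.Facet := if h : ∃ j, 𝒯.Opposite i j then h.choose else i

theorem cell_mem (i : 𝒯.Facet) : i.1.1 ∈ 𝒯.cells := 𝒯.mem_cellsF.1 i.1.2

/-- This makes the choice in `flip` unambiguous, which is why `flip` is an involution. -/
theorem Opposite.eq {𝒯 : Mesh Ω} (hd : 1 ≤ d) {i j k : 𝒯.Facet} (hj : 𝒯.Opposite i j)
    (hk : 𝒯.Opposite i k) : j = k := by
  obtain ⟨hT, hz⟩ := 𝒯.opposite_unique hd (𝒯.cell_mem i) (𝒯.cell_mem j) (𝒯.cell_mem k)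
    (fun h => hj.1 (Subtype.ext h)) (fun h => hk.1 (Subtype.ext h)) i.2.2 j.2.2 k.2.2 hj.2 hk.2
  obtain ⟨⟨T₁, h₁⟩, ⟨z₁, h₁'⟩⟩ := j
  obtain ⟨⟨T₂, h₂⟩, ⟨z₂, h₂'⟩⟩ := k
  dsimp only at hT hz
  subst hT
  subst hz
  rfl

theorem Opposite.symm {𝒯 : Mesh Ω} {i j : 𝒯.Facet} (h : 𝒯.Opposite i j) : 𝒯.Opposite j i :=
  ⟨h.1.symm, h.2.symm⟩

theorem flip_eq (hd : 1 ≤ d) {i j : 𝒯.Facet} (h : 𝒯.Opposite i j) : 𝒯.flip i = j := by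
  have hex : ∃ j, 𝒯.Opposite i j := ⟨j, h⟩
  rw [flip, dif_pos hex]
  exact hex.choose_spec.eq hd h

theorem opposite_flip {i : 𝒯.Facet} (h : 𝒯.flip i ≠ i) : 𝒯.Opposite i (𝒯.flip i) := by
  by_cases hex : ∃ j, 𝒯.Opposite i j
  · rw [flip, dif_pos hex]
    exact hex.choose_spec
  · exact absurd (by rw [flip, dif_neg hex]) h

theorem flip_involutive (hd : 1 ≤ d) : Function.Involutive 𝒯.flip := by
  intro i
  by_cases h : 𝒯.flip i = i
  · rw [h, h]
  · exact 𝒯.flip_eq hd (𝒯.opposite_flip h).symm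

/-- Another cell containing the face would have exactly one further vertex, and would therefore
provide an opposite facet. -/
theorem boundary_of_flip_eq (hd : 1 ≤ d) {i : 𝒯.Facet} (h : 𝒯.flip i = i) :
    ∀ T' ∈ 𝒯.cells, i.1.1.erase i.2.1 ⊆ T' → T' = i.1.1 := by
  intro T' hT' hsub
  by_contra hne
  have sT := 𝒯.isSimplex (𝒯.cell_mem i)
  have sT' := 𝒯.isSimplex hT'
  have hcard : (T' \ i.1.1.erase i.2.1).card = 1 := by
    rw [Finset.card_sdiff_of_subset hsub, Finset.card_erase_of_mem i.2.2, sT.card_eq, sT'.card_eq]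
    omega
  obtain ⟨z', hz'⟩ := Finset.card_eq_one.1 hcard
  have hz'T : z' ∈ T' := by
    have : z' ∈ T' \ i.1.1.erase i.2.1 := by rw [hz']; exact Finset.mem_singleton_self _
    exact (Finset.mem_sdiff.1 this).1
  have hF : T'.erase z' = i.1.1.erase i.2.1 := by
    rw [Finset.erase_eq, ← hz', Finset.sdiff_sdiff_eq_self hsub]
  have hopp : 𝒯.Opposite i ⟨⟨T', 𝒯.mem_cellsF.2 hT'⟩, ⟨z', hz'T⟩⟩ :=
    ⟨fun h => hne (congrArg Subtype.val h), hF⟩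
  have := 𝒯.flip_eq hd hopp
  rw [h] at this
  exact hopp.1 (congrArg Sigma.fst this).symm

/-- The volume of an element. -/
def vol (T : 𝒯.cellsF) : ℝ := volume.real (convexHull ℝ (T.1 : Set (Pt d)))

/-- The diameter of an element. -/
def diam (T : 𝒯.cellsF) : ℝ := Metric.diam (convexHull ℝ (T.1 : Set (Pt d)))

theorem vol_pos (T : 𝒯.cellsF) : 0 < 𝒯.vol T := (𝒯.isSimplex (𝒯.mem_cellsF.1 T.2)).volume_pos

/-- Weak form of the continuity of normal components: the two contributions of an interior face
cancel, and on a boundary face the test function vanishes. -/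
theorem sum_flux_coneMean (hd : 1 ≤ d) (hΩ : IsOpen Ω) {g : 𝒯.Facet → ℝ}
    (hg : ∀ i, 𝒯.flip i ≠ i → g (𝒯.flip i) = - g i) {φ : Pt d → ℝ} (hφ : ContDiff ℝ 1 φ)
    (hsupp : tsupport φ ⊆ Ω) : ∑ i : 𝒯.Facet, g i * coneMean φ i.1.1 i.2.1 = 0 := by
  have h0 : ∀ i, 𝒯.flip i = i → coneMean φ i.1.1 i.2.1 = 0 := fun i hi =>
    coneMean_eq_zero hd (𝒯.isSimplex (𝒯.cell_mem i)) i.2.2 hφ fun y hy =>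
      𝒯.eq_zero_on_boundary_face hd hΩ (𝒯.cell_mem i) i.2.2 (𝒯.boundary_of_flip_eq hd hi)
        hφ.continuous hsupp hy
  refine Finset.sum_involution (fun i _ => 𝒯.flip i) (fun i _ => ?_) (fun i _ hi h => ?_)
    (fun i _ => Finset.mem_univ _) (fun i _ => 𝒯.flip_involutive hd i)
  · by_cases h : 𝒯.flip i = i
    · rw [h, h0 i h]; ring
    · have hopp := 𝒯.opposite_flip h
      rw [hg i h, coneMean_opposite hd (𝒯.isSimplex (𝒯.cell_mem i))
        (𝒯.isSimplex (𝒯.cell_mem _)) i.2.2 (𝒯.flip i).2.2 hopp.2 hφ]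
      ring
  · exact hi (by rw [h0 i h, mul_zero])

theorem sum_cells (f : Finset (Pt d) → ℝ) : ∑ T ∈ 𝒯.cellsF, f T = ∑ T : 𝒯.cellsF, f T.1 :=
  (Finset.sum_coe_sort 𝒯.cellsF f).symm

/-- On `T` the field is the sum of `g / vol T • (x - z)` over the vertices `z`, so that `d * g` is
the outward flux through the face opposite to `z`. Cell by cell its weak divergence is the pointwise
one plus face terms, which `sum_flux_coneMean` cancels. The norm bound uses `‖x - z‖ ≤ diam T` and
Cauchy–Schwarz over the `d + 1` vertices. -/
theorem exists_flux_field (hd : 1 ≤ d) (hreg : interior (closure Ω) = Ω)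
    (hbdd : Bornology.IsBounded Ω) {g : 𝒯.Facet → ℝ}
    (hg : ∀ i, 𝒯.flip i ≠ i → g (𝒯.flip i) = - g i) {w : L2 Ω}
    (hw : ∀ T : 𝒯.cellsF, ∀ᵐ x ∂(volume.restrict (convexHull ℝ (T.1 : Set (Pt d)))),
      w x = d * (∑ z : T.1, g ⟨T, z⟩) / 𝒯.vol T) :
    ∃ v ∈ 𝒯.V, weakDiv v = w ∧
      ‖v‖ ^ 2 ≤ (d + 1) * ∑ i : 𝒯.Facet, g i ^ 2 * (𝒯.diam i.1 ^ 2 / 𝒯.vol i.1) := by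
  classical
  have hΩ : IsOpen Ω := by rw [← hreg]; exact isOpen_interior
  set F : Finset (Pt d) → Pt d → Pt d := fun T x =>
    if hT : T ∈ 𝒯.cellsF then ∑ z : T, (g ⟨⟨T, hT⟩, z⟩ / 𝒯.vol ⟨T, hT⟩) • (x - z.1) else 0 with hF
  have hFc : ∀ T, Continuous (F T) := by
    intro T
    by_cases hT : T ∈ 𝒯.cellsF
    · simp only [hF, dif_pos hT]
      fun_prop
    · simp only [hF, dif_neg hT]
      fun_prop
  obtain ⟨v, hv⟩ := 𝒯.exists_piecewise hreg hbdd F hFc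
  have hv' : ∀ T : 𝒯.cellsF, ∀ᵐ x ∂(volume.restrict (convexHull ℝ (T.1 : Set (Pt d)))),
      v x = ∑ z : T.1, (g ⟨T, z⟩ / 𝒯.vol T) • (x - z.1) := fun T => by
    filter_upwards [hv T.1 (𝒯.mem_cellsF.1 T.2)] with x hx
    rw [hx]
    simp only [hF, dif_pos T.2]
  have hdiv : HasWeakDiv v w := by
    intro φ h1 h2 h3
    have hφ1 : ContDiff ℝ 1 φ := h1.of_le (by exact_mod_cast le_top)
    have i1 := integrable_fderiv_apply hφ1 h2 v
    have hφ2 : MemLp φ 2 (volume.restrict Ω) := h1.continuous.memLp_of_hasCompactSupport h2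
    have i2 : Integrable (fun x => w x * φ x) (volume.restrict Ω) :=
      (Lp.memLp w).integrable_mul hφ2
    rw [𝒯.integral_eq_sum hreg i1, 𝒯.integral_eq_sum hreg i2, 𝒯.sum_cells, 𝒯.sum_cells]
    have hcell : ∀ T : 𝒯.cellsF,
        ∫ x in convexHull ℝ (T.1 : Set (Pt d)), fderiv ℝ φ x (v x)
          = (∑ z : T.1, g ⟨T, z⟩ * coneMean φ T.1 z.1)
            - ∫ x in convexHull ℝ (T.1 : Set (Pt d)), w x * φ x := by
      intro T
      have sT := 𝒯.isSimplex (𝒯.mem_cellsF.1 T.2)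
      have hvol : volume.real (convexHull ℝ (T.1 : Set (Pt d))) = 𝒯.vol T := rfl
      have hpos := 𝒯.vol_pos T
      have e1 : ∫ x in convexHull ℝ (T.1 : Set (Pt d)), fderiv ℝ φ x (v x)
          = ∑ z : T.1, g ⟨T, z⟩ / 𝒯.vol T
            * ∫ x in convexHull ℝ (T.1 : Set (Pt d)), fderiv ℝ φ x (x - z.1) := by
        have hintg : ∀ z ∈ (Finset.univ : Finset T.1),
            Integrable (fun x => g ⟨T, z⟩ / 𝒯.vol T * fderiv ℝ φ x (x - z.1))
            (volume.restrict (convexHull ℝ (T.1 : Set (Pt d)))) := fun z _ => by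
          have : Continuous fun x => g ⟨T, z⟩ / 𝒯.vol T * fderiv ℝ φ x (x - z.1) :=
            ((hφ1.continuous_fderiv one_ne_zero).clm_apply (by fun_prop)).const_mul _
          exact this.continuousOn.integrableOn_compact (isCompact_simplex T.1)
        simp only [← integral_const_mul]
        rw [← integral_finsetSum _ hintg]
        refine integral_congr_ae ?_
        filter_upwards [hv' T] with x hx
        rw [hx, map_sum]
        simp
      have e2 : ∫ x in convexHull ℝ (T.1 : Set (Pt d)), w x * φ x
          = d * (∑ z : T.1, g ⟨T, z⟩) / 𝒯.vol T
            * ∫ x in convexHull ℝ (T.1 : Set (Pt d)), φ x := by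
        rw [← integral_const_mul]
        refine integral_congr_ae ?_
        filter_upwards [hw T] with x hx
        rw [hx]
      rw [e1, e2]
      simp only [integral_fderiv_simplex sT _ hφ1, hvol]
      rw [Finset.mul_sum, Finset.sum_div, Finset.sum_mul, ← Finset.sum_sub_distrib]
      refine Finset.sum_congr rfl fun z _ => ?_
      field_simp
    rw [Finset.sum_congr rfl fun T _ => hcell T, Finset.sum_sub_distrib]
    have hz := 𝒯.sum_flux_coneMean hd hΩ hg hφ1 h3
    rw [Fintype.sum_sigma] at hz
    rw [hz, zero_sub]
  refine ⟨v, ?_, hdiv.weakDiv_eq hΩ, ?_⟩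
  · rw [𝒯.mem_V_iff hreg]
    refine ⟨⟨w, hdiv⟩, fun T hT => ?_⟩
    refine ⟨-∑ z : T, (g ⟨⟨T, 𝒯.mem_cellsF.2 hT⟩, z⟩ / 𝒯.vol ⟨T, 𝒯.mem_cellsF.2 hT⟩) • z.1,
      ∑ z : T, g ⟨⟨T, 𝒯.mem_cellsF.2 hT⟩, z⟩ / 𝒯.vol ⟨T, 𝒯.mem_cellsF.2 hT⟩, ?_⟩
    filter_upwards [hv' ⟨T, 𝒯.mem_cellsF.2 hT⟩] with x hx
    rw [hx]
    simp only [smul_sub, Finset.sum_sub_distrib, Finset.sum_smul]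
    abel
  · rw [norm_sq_eq_integral, 𝒯.integral_eq_sum hreg (integrable_norm_sq v), 𝒯.sum_cells,
      Fintype.sum_sigma, Finset.mul_sum]
    refine Finset.sum_le_sum fun T _ => ?_
    have sT := 𝒯.isSimplex (𝒯.mem_cellsF.1 T.2)
    have hpos := 𝒯.vol_pos T
    have hfm := isFiniteMeasure_restrict_simplex T.1
    have hdiam : 0 ≤ 𝒯.diam T := Metric.diam_nonneg
    have hbound : ∀ᵐ x ∂(volume.restrict (convexHull ℝ (T.1 : Set (Pt d)))),
        ‖v x‖ ^ 2 ≤ (𝒯.diam T / 𝒯.vol T) ^ 2 * ((d + 1) * ∑ z : T.1, g ⟨T, z⟩ ^ 2) := by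
      filter_upwards [hv' T, ae_restrict_mem (isCompact_simplex T.1).measurableSet] with x hx hxT
      have h1 : ‖v x‖ ≤ 𝒯.diam T / 𝒯.vol T * ∑ z : T.1, |g ⟨T, z⟩| := by
        rw [hx, Finset.mul_sum]
        refine (norm_sum_le _ _).trans (Finset.sum_le_sum fun z _ => ?_)
        rw [norm_smul, Real.norm_eq_abs, abs_div, abs_of_pos hpos, ← dist_eq_norm]
        have : dist x z.1 ≤ 𝒯.diam T := Metric.dist_le_diam_of_mem
          (isCompact_simplex T.1).isBounded hxT (subset_convexHull ℝ _ z.2)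
        calc |g ⟨T, z⟩| / 𝒯.vol T * dist x z.1 ≤ |g ⟨T, z⟩| / 𝒯.vol T * 𝒯.diam T := by gcongr
          _ = _ := by ring
      calc ‖v x‖ ^ 2 ≤ (𝒯.diam T / 𝒯.vol T * ∑ z : T.1, |g ⟨T, z⟩|) ^ 2 :=
            pow_le_pow_left₀ (norm_nonneg _) h1 2
        _ = (𝒯.diam T / 𝒯.vol T) ^ 2 * (∑ z : T.1, |g ⟨T, z⟩|) ^ 2 := mul_pow _ _ _
        _ ≤ _ := by
            refine mul_le_mul_of_nonneg_left ?_ (sq_nonneg _)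
            have := sq_sum_le_card_mul_sum_sq (s := (Finset.univ : Finset T.1))
              (f := fun z => |g ⟨T, z⟩|)
            simp only [sq_abs, Finset.card_univ, Fintype.card_coe, sT.card_eq] at this
            exact_mod_cast this
    have hintg := 𝒯.integrable_cell hreg (integrable_norm_sq v) (𝒯.mem_cellsF.1 T.2)
    refine (integral_mono_ae hintg (integrable_const _) hbound).trans (le_of_eq ?_)
    rw [integral_const, measureReal_restrict_apply_univ, smul_eq_mul]
    change 𝒯.vol T * _ = _
    dsimp only
    rw [← Finset.sum_mul]
    field_simp

theorem norm_sq_eq_sum (hreg : interior (closure Ω) = Ω) {w : L2 Ω} {c : 𝒯.cellsF → ℝ}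
    (hc : ∀ T : 𝒯.cellsF, ∀ᵐ x ∂(volume.restrict (convexHull ℝ (T.1 : Set (Pt d)))),
      w x = c T) : ‖w‖ ^ 2 = ∑ T, 𝒯.vol T * c T ^ 2 := by
  rw [norm_sq_eq_integral, 𝒯.integral_eq_sum hreg (integrable_norm_sq w), 𝒯.sum_cells]
  refine Finset.sum_congr rfl fun T _ => ?_
  have : ∫ x in convexHull ℝ (T.1 : Set (Pt d)), ‖w x‖ ^ 2
      = ∫ _x in convexHull ℝ (T.1 : Set (Pt d)), c T ^ 2 := by
    refine integral_congr_ae ?_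
    filter_upwards [hc T] with x hx
    rw [hx, Real.norm_eq_abs, sq_abs]
  rw [this, integral_const, measureReal_restrict_apply_univ, smul_eq_mul]
  rfl

theorem exists_cell_values (hreg : interior (closure Ω) = Ω) {w : L2 Ω} (hw : w ∈ 𝒯.W) :
    ∃ c : 𝒯.cellsF → ℝ, ∀ T : 𝒯.cellsF,
      ∀ᵐ x ∂(volume.restrict (convexHull ℝ (T.1 : Set (Pt d)))), w x = c T := by
  have h := (𝒯.mem_W_iff hreg).1 hw
  choose c hc using fun T : 𝒯.cellsF => h T.1 (𝒯.mem_cellsF.1 T.2)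
  exact ⟨c, hc⟩

end Mesh

/-! ### Uniform stability of the divergence -/

theorem sum_filter_fst {K : Type*} [Fintype K] [DecidableEq K] {A : K → Type*}
    [∀ k, Fintype (A k)] {M : Type*} [AddCommMonoid M] (f : (Σ k, A k) → M) (k : K) :
    ∑ i : (Σ k, A k) with i.1 = k, f i = ∑ a : A k, f ⟨k, a⟩ := by
  rw [Finset.sum_filter, Fintype.sum_sigma, Finset.sum_eq_single k]
  · simp
  · intro k' _ hne
    simp [hne]
  · simp

theorem volume_ball_le {d : ℕ} {s : Set (Pt d)} (hs : volume s ≠ ⊤) {z : Pt d} {r : ℝ}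
    (hr : 0 ≤ r) (h : Metric.closedBall z r ⊆ s) :
    r ^ d * volume.real (Metric.ball (0 : Pt d) 1) ≤ volume.real s := by
  have h1 : volume.real (Metric.closedBall z r)
      = r ^ d * volume.real (Metric.ball (0 : Pt d) 1) := by
    rw [Measure.real, Measure.addHaar_closedBall volume z hr, ENNReal.toReal_mul,
      ENNReal.toReal_ofReal (by positivity), finrank_euclideanSpace_fin]
    rfl
  rw [← h1]
  exact measureReal_mono h hs

theorem le_volume_ball {d : ℕ} {s : Set (Pt d)} {z : Pt d} {r : ℝ}
    (hr : 0 ≤ r) (h : s ⊆ Metric.closedBall z r) :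
    volume.real s ≤ r ^ d * volume.real (Metric.ball (0 : Pt d) 1) := by
  have h1 : volume.real (Metric.closedBall z r)
      = r ^ d * volume.real (Metric.ball (0 : Pt d) 1) := by
    rw [Measure.real, Measure.addHaar_closedBall volume z hr, ENNReal.toReal_mul,
      ENNReal.toReal_ofReal (by positivity), finrank_euclideanSpace_fin]
    rfl
  rw [← h1]
  exact measureReal_mono h (isCompact_closedBall z r).measure_ne_top

theorem volume_unitBall_pos (d : ℕ) : 0 < volume.real (Metric.ball (0 : Pt d) 1) :=
  ENNReal.toReal_pos (Metric.isOpen_ball.measure_pos _ ⟨0, by simp⟩).ne' measure_ball_lt_top.ne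

namespace Mesh

variable {d : ℕ} {Ω : Set (Pt d)} (𝒯 : Mesh Ω)

theorem exists_inball {σ : ℝ} (hσ : 𝒯.ShapeRegular σ) (T : 𝒯.cellsF) :
    ∃ z : Pt d, ∃ r : ℝ, 0 < r ∧ Metric.closedBall z r ⊆ convexHull ℝ (T.1 : Set (Pt d)) ∧
      𝒯.diam T ≤ max σ 1 * (2 * r) := by
  obtain ⟨z, r, hr, h1, h2⟩ := hσ T.1 (𝒯.mem_cellsF.1 T.2)
  exact ⟨z, r, hr, h1, h2.trans (mul_le_mul_of_nonneg_right (le_max_left _ _) (by positivity))⟩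

theorem diam_pos (hd : 1 ≤ d) (T : 𝒯.cellsF) : 0 < 𝒯.diam T := by
  have sT := 𝒯.isSimplex (𝒯.mem_cellsF.1 T.2)
  have hcard : 1 < T.1.card := by rw [sT.card_eq]; omega
  obtain ⟨a, ha, b, hb, hab⟩ := Finset.one_lt_card.1 hcard
  exact (dist_pos.2 hab).trans_le (Metric.dist_le_diam_of_mem (isCompact_simplex T.1).isBounded
    (subset_convexHull ℝ _ ha) (subset_convexHull ℝ _ hb))

theorem norm_le_of_mem_cell {R : ℝ} (hR : Ω ⊆ Metric.closedBall 0 R) (T : 𝒯.cellsF) {y : Pt d}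
    (hy : y ∈ T.1) : ‖y‖ ≤ R := by
  have h1 : y ∈ closure Ω := by
    rw [← 𝒯.closure_eq]
    exact Set.mem_iUnion₂.2 ⟨T.1, 𝒯.mem_cellsF.1 T.2, subset_convexHull ℝ _ hy⟩
  have := closure_minimal hR Metric.isClosed_closedBall h1
  simpa using this

/-- For `d ≥ 2` the common face contains an edge, which is at least as long as the inball diameter
of one cell and at most the diameter of the other. Shape regularity of both cells then compares
their sizes. For `d = 1` neighbours can have arbitrary length ratios. -/
theorem vol_opposite_le (hd : 2 ≤ d) {σ : ℝ} (hσ : 𝒯.ShapeRegular σ) {i j : 𝒯.Facet}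
    (h : 𝒯.Opposite i j) : 𝒯.vol j.1 ≤ (2 * max σ 1 ^ 2) ^ d * 𝒯.vol i.1 := by
  have si := 𝒯.isSimplex (𝒯.cell_mem i)
  have sj := 𝒯.isSimplex (𝒯.cell_mem j)
  obtain ⟨zi, ri, hri, hbi, hdi⟩ := 𝒯.exists_inball hσ i.1
  obtain ⟨zj, rj, hrj, hbj, hdj⟩ := 𝒯.exists_inball hσ j.1
  have hcard : 1 < (i.1.1.erase i.2.1).card := by
    rw [Finset.card_erase_of_mem i.2.2, si.card_eq]; omega
  obtain ⟨a, ha, b, hb, hab⟩ := Finset.one_lt_card.1 hcard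
  have hai := Finset.mem_of_mem_erase ha
  have hbi' := Finset.mem_of_mem_erase hb
  rw [← h.2] at ha hb
  have haj := Finset.mem_of_mem_erase ha
  have hbj' := Finset.mem_of_mem_erase hb
  have hedge : 2 * rj ≤ 𝒯.diam i.1 := by
    have h1 := sj.lam_linear_le hrj haj hbj (a - b)
    have h2 : (lam j.1.1 a).linear (a - b) = 1 := by
      have := affineMap_eq_linear_add (lam j.1.1 a) a b
      rw [sj.lam_self haj, sj.lam_ne haj hbj' hab.symm] at this
      linarith
    rw [h2, abs_one, one_mul, ← dist_eq_norm] at h1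
    exact h1.trans (Metric.dist_le_diam_of_mem (isCompact_simplex i.1.1).isBounded
      (subset_convexHull ℝ _ hai) (subset_convexHull ℝ _ hbi'))
  set κ := max σ 1 with hκ
  have hκ1 : 1 ≤ κ := le_max_right _ _
  have hdj' : 𝒯.diam j.1 ≤ 2 * κ ^ 2 * ri := by
    calc 𝒯.diam j.1 ≤ κ * (2 * rj) := hdj
      _ ≤ κ * (κ * (2 * ri)) :=
          mul_le_mul_of_nonneg_left (hedge.trans hdi) (zero_le_one.trans hκ1)
      _ = _ := by ring
  have hsub : convexHull ℝ (j.1.1 : Set (Pt d)) ⊆ Metric.closedBall a (𝒯.diam j.1) :=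
    fun x hx => Metric.mem_closedBall.2 (Metric.dist_le_diam_of_mem
      (isCompact_simplex j.1.1).isBounded hx (subset_convexHull ℝ _ haj))
  have hdj0 : 0 ≤ 𝒯.diam j.1 := Metric.diam_nonneg
  have hc := (volume_unitBall_pos d).le
  calc 𝒯.vol j.1 ≤ 𝒯.diam j.1 ^ d * volume.real (Metric.ball (0 : Pt d) 1) :=
        le_volume_ball hdj0 hsub
    _ ≤ (2 * κ ^ 2 * ri) ^ d * volume.real (Metric.ball (0 : Pt d) 1) := by gcongr
    _ = (2 * κ ^ 2) ^ d * (ri ^ d * volume.real (Metric.ball (0 : Pt d) 1)) := by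
        rw [mul_pow _ ri]; ring
    _ ≤ _ := mul_le_mul_of_nonneg_left
        (volume_ball_le (isCompact_simplex i.1.1).measure_ne_top hri.le hbi) (by positivity)

theorem exists_facet_flow (hd : 2 ≤ d) {R : ℝ} (hR : Ω ⊆ Metric.closedBall 0 R) {σ : ℝ}
    (hσ : 𝒯.ShapeRegular σ) (c : 𝒯.cellsF → ℝ) :
    ∃ g : 𝒯.Facet → ℝ, (∀ i, 𝒯.flip i ≠ i → g (𝒯.flip i) = - g i) ∧
      (∀ T : 𝒯.cellsF, ∑ z : T.1, g ⟨T, z⟩ = 𝒯.vol T * c T) ∧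
      ∑ i : 𝒯.Facet, g i ^ 2 * (𝒯.diam i.1 ^ 2 / 𝒯.vol i.1)
        ≤ 4 * ((max σ 1 * R) ^ 2 * (d + 1 : ℕ) * (1 + (2 * max σ 1 ^ 2) ^ d))
          * ∑ T, 𝒯.vol T * c T ^ 2 := by
  classical
  have hd1 : 1 ≤ d := by omega
  set κ := max σ 1 with hκ
  have hκ1 : 1 ≤ κ := le_max_right _ _
  have hμ1 : 1 ≤ (2 * κ ^ 2) ^ d := one_le_pow₀ (by nlinarith)
  have hsimp := fun T : 𝒯.cellsF => 𝒯.isSimplex (𝒯.mem_cellsF.1 T.2)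
  suffices h : ∃ g : 𝒯.Facet → ℝ, (∀ i, 𝒯.flip i ≠ i → g (𝒯.flip i) = - g i) ∧
      (∀ T : 𝒯.cellsF, ∑ i : 𝒯.Facet with i.1 = T, g i = 𝒯.vol T * c T) ∧
      ∑ i : 𝒯.Facet, g i ^ 2 * (𝒯.diam i.1 ^ 2 / 𝒯.vol i.1)
        ≤ 4 * ((κ * R) ^ 2 * (d + 1 : ℕ) * (1 + (2 * κ ^ 2) ^ d)) * ∑ T, 𝒯.vol T * c T ^ 2 by
    obtain ⟨g, h1, h2, h3⟩ := h
    exact ⟨g, h1, fun T => (sum_filter_fst g T).symm.trans (h2 T), h3⟩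
  -- The reference flow `Φ` belongs to the position field: `x = ∑ lam T z 0 • (x - z)` on every
  -- cell. Its continuity is the antisymmetry of `Φ`, and `∑ lam T z 0 = 1` gives total flow `vol
  -- T`.
  refine exists_flow (c := fun i : 𝒯.Facet => i.1)
    (𝒯.flip_involutive hd1) 𝒯.vol_pos (θ := fun T => 𝒯.diam T ^ 2 / 𝒯.vol T)
    (fun T => div_pos (pow_pos (𝒯.diam_pos hd1 T) 2) (𝒯.vol_pos T))
    (Φ := fun i => 𝒯.vol i.1 * lam i.1.1 i.2.1 0) (fun T => ?_) (fun i hi => ?_) (N := d + 1)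
    (fun T => ?_) (A := (κ * R) ^ 2) (μ := (2 * κ ^ 2) ^ d) (fun i => ?_) (sq_nonneg _)
    (fun i => ?_) c
  · rw [sum_filter_fst]
    dsimp only
    rw [← Finset.mul_sum, Finset.sum_coe_sort T.1 (fun z => lam T.1 z 0), (hsimp T).sum_lam,
      mul_one]
  · have hopp := 𝒯.opposite_flip hi
    have hneg := 𝒯.lam_opposite_neg hd1 (𝒯.cell_mem i) (𝒯.cell_mem (𝒯.flip i))
      (fun h => hopp.1 (Subtype.ext h)) i.2.2 (𝒯.flip i).2.2 hopp.2
    have hv : 𝒯.vol (𝒯.flip i).1 = |lam i.1.1 i.2.1 (𝒯.flip i).2.1| * 𝒯.vol i.1 :=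
      volume_opposite (hsimp _) (hsimp _) i.2.2 (𝒯.flip i).2.2 hopp.2
    have hl := lam_eq_mul_lam (hsimp _) (hsimp _) i.2.2 (𝒯.flip i).2.2 hopp.2 0
    rw [hv, abs_of_neg hneg, hl]
    ring
  · rw [Finset.card_eq_sum_ones, sum_filter_fst]
    simp [(hsimp T).card_eq]
  · have sT := hsimp i.1
    have hcard : 0 < (i.1.1.erase i.2.1).card := by
      rw [Finset.card_erase_of_mem i.2.2, sT.card_eq]; omega
    obtain ⟨y, hy⟩ := Finset.card_pos.1 hcard
    obtain ⟨z, r, hr, hb, hdiam⟩ := 𝒯.exists_inball hσ i.1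
    have h1 := sT.lam_linear_le hr i.2.2 hb (0 - y)
    have h2 := affineMap_eq_linear_add (lam i.1.1 i.2.1) 0 y
    rw [sT.lam_ne i.2.2 (Finset.mem_of_mem_erase hy) (Finset.ne_of_mem_erase hy), add_zero] at h2
    rw [← h2, zero_sub, norm_neg] at h1
    -- The coordinate vanishes at `y`, at distance at most `R` from the origin, and has slope at
    -- most `1 / (2 * r)`; the diameter compensates the inradius.
    have h3 : |lam i.1.1 i.2.1 0| * 𝒯.diam i.1 ≤ κ * R := by
      calc |lam i.1.1 i.2.1 0| * 𝒯.diam i.1 ≤ |lam i.1.1 i.2.1 0| * (κ * (2 * r)) := by gcongr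
        _ = κ * (|lam i.1.1 i.2.1 0| * (2 * r)) := by ring
        _ ≤ κ * R := by
          gcongr
          exact h1.trans (𝒯.norm_le_of_mem_cell hR i.1 (Finset.mem_of_mem_erase hy))
    have h4 : (|lam i.1.1 i.2.1 0| * 𝒯.diam i.1) ^ 2 ≤ (κ * R) ^ 2 :=
      pow_le_pow_left₀ (mul_nonneg (abs_nonneg _) Metric.diam_nonneg) h3 2
    rw [mul_pow, sq_abs] at h4
    have hpos := 𝒯.vol_pos i.1
    calc (𝒯.vol i.1 * lam i.1.1 i.2.1 0) ^ 2 * (𝒯.diam i.1 ^ 2 / 𝒯.vol i.1)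
        = (lam i.1.1 i.2.1 0 ^ 2 * 𝒯.diam i.1 ^ 2) * 𝒯.vol i.1 := by field_simp
      _ ≤ _ := mul_le_mul_of_nonneg_right h4 hpos.le
  · by_cases h : 𝒯.flip i = i
    · rw [h]
      nlinarith [𝒯.vol_pos i.1]
    · exact 𝒯.vol_opposite_le hd hσ (𝒯.opposite_flip h)

theorem exists_stable_field_of_two_le (hd : 2 ≤ d) (hreg : interior (closure Ω) = Ω)
    (hbdd : Bornology.IsBounded Ω) {R : ℝ} (hR : Ω ⊆ Metric.closedBall 0 R) {σ : ℝ}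
    (hσ : 𝒯.ShapeRegular σ) {w : L2 Ω} (hw : w ∈ 𝒯.W) :
    ∃ v ∈ 𝒯.V, weakDiv v = w ∧ ‖v‖ ^ 2 ≤ (d + 1) * (4 * ((max σ 1 * R) ^ 2 * (d + 1 : ℕ)
      * (1 + (2 * max σ 1 ^ 2) ^ d))) * ‖w‖ ^ 2 := by
  have hd1 : 1 ≤ d := by omega
  have hd0 : (0 : ℝ) < d := by exact_mod_cast hd1
  obtain ⟨c, hc⟩ := 𝒯.exists_cell_values hreg hw
  -- The source is divided by `d` because the field built from `g` has divergence `d * ∑ g / vol T`.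
  obtain ⟨g, hg1, hg2, hg3⟩ := 𝒯.exists_facet_flow hd hR hσ fun T => c T / d
  have hw' : ∀ T : 𝒯.cellsF, ∀ᵐ x ∂(volume.restrict (convexHull ℝ (T.1 : Set (Pt d)))),
      w x = d * (∑ z : T.1, g ⟨T, z⟩) / 𝒯.vol T := fun T => by
    filter_upwards [hc T] with x hx
    rw [hx, hg2 T]
    have := (𝒯.vol_pos T).ne'
    field_simp
  obtain ⟨v, hv, hdiv, hnorm⟩ := 𝒯.exists_flux_field hd1 hreg hbdd hg1 hw'
  refine ⟨v, hv, hdiv, hnorm.trans ?_⟩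
  rw [mul_assoc ((d : ℝ) + 1)]
  refine mul_le_mul_of_nonneg_left (hg3.trans ?_) (by positivity)
  refine mul_le_mul_of_nonneg_left ?_ (by positivity)
  rw [𝒯.norm_sq_eq_sum hreg hc]
  refine Finset.sum_le_sum fun T _ => mul_le_mul_of_nonneg_left ?_ (𝒯.vol_pos T).le
  rw [div_pow]
  exact div_le_self (sq_nonneg _) (one_le_pow₀ (by exact_mod_cast hd1))

end Mesh

/-! ### Stability of the divergence in one space dimension -/

theorem abs_integral_le_sqrt_mul_norm {d : ℕ} {Ω : Set (Pt d)} (hbdd : Bornology.IsBounded Ω)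
    (w : L2 Ω) (S : Set (Pt d)) (hS : MeasurableSet S) :
    (∫ x in Ω, S.indicator (fun x => w x) x) ^ 2 ≤ volume.real Ω * ‖w‖ ^ 2 := by
  have hf := isFiniteMeasure_restrict hbdd
  have hm : MemLp (S.indicator fun _ => (1 : ℝ)) 2 (volume.restrict Ω) :=
    (memLp_const (1 : ℝ)).indicator hS
  set χ : L2 Ω := hm.toLp _ with hχ
  have e1 : ∫ x in Ω, S.indicator (fun x => w x) x = inner ℝ χ w := by
    rw [L2.inner_def]
    refine integral_congr_ae ?_
    filter_upwards [hm.coeFn_toLp] with x hx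
    rw [hχ, hx]
    by_cases h : x ∈ S <;> simp [h]
  have e2 : ‖χ‖ ^ 2 ≤ volume.real Ω := by
    rw [norm_sq_eq_integral]
    refine (integral_mono_ae (integrable_norm_sq χ) (integrable_const (1 : ℝ)) ?_).trans ?_
    · filter_upwards [hm.coeFn_toLp] with x hx
      rw [hχ, hx]
      by_cases h : x ∈ S <;> simp [h]
    · simp
  rw [e1]
  calc (inner ℝ χ w) ^ 2 ≤ (‖χ‖ * ‖w‖) ^ 2 :=
        sq_le_sq' (neg_le_of_abs_le (abs_real_inner_le_norm χ w)) (real_inner_le_norm χ w)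
    _ = ‖χ‖ ^ 2 * ‖w‖ ^ 2 := mul_pow _ _ _
    _ ≤ _ := mul_le_mul_of_nonneg_right e2 (sq_nonneg _)

/-- The primitive of `w`, extended by zero outside of `Ω`. -/
def primitive {Ω : Set (Pt 1)} (w : L2 Ω) (y : Pt 1) : ℝ :=
  ∫ x in Ω, Set.indicator {x : Pt 1 | x 0 ≤ y 0} (fun x => w x) x

theorem measurableSet_coord_le {d : ℕ} (j : Fin d) (t : ℝ) : MeasurableSet {x : Pt d | x j ≤ t} :=
  (isClosed_le (by fun_prop) continuous_const).measurableSet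

namespace Mesh

variable {Ω : Set (Pt 1)} (𝒯 : Mesh Ω)

/-- Up to null sets the part of `Ω` between the endpoints is the cell itself, since the interior of
the cell lies in `Ω`. -/
theorem primitive_sub (hreg : interior (closure Ω) = Ω) (hbdd : Bornology.IsBounded Ω)
    (w : L2 Ω) {a b : Pt 1} (hT : ({a, b} : Finset (Pt 1)) ∈ 𝒯.cells) (hab : a 0 < b 0) :
    primitive w b - primitive w a
      = ∫ x in convexHull ℝ (({a, b} : Finset (Pt 1)) : Set (Pt 1)), w x := by
  have hΩ : IsOpen Ω := by rw [← hreg]; exact isOpen_interior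
  have hf := isFiniteMeasure_restrict hbdd
  have hw : Integrable (fun x => w x) (volume.restrict Ω) := (Lp.memLp w).integrable (by norm_num)
  set S : Set (Pt 1) := {x | x 0 ≤ b 0} \ {x | x 0 ≤ a 0} with hS
  have hSm : MeasurableSet S := (measurableSet_coord_le 0 _).diff (measurableSet_coord_le 0 _)
  have e1 : primitive w b - primitive w a = ∫ x in Ω, S.indicator (fun x => w x) x := by
    rw [primitive, primitive, ← integral_sub (hw.indicator (measurableSet_coord_le 0 _))
      (hw.indicator (measurableSet_coord_le 0 _))]
    congr 1
    ext x
    by_cases h1 : x 0 ≤ a 0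
    · have h2 : x 0 ≤ b 0 := h1.trans hab.le
      simp [hS, h1, h2]
    · by_cases h2 : x 0 ≤ b 0 <;> simp [hS, h1, h2]
  have hseg : convexHull ℝ (({a, b} : Finset (Pt 1)) : Set (Pt 1)) = segment ℝ a b := by
    rw [Finset.coe_pair, convexHull_pair]
  have hcoord : ∀ x ∈ segment ℝ a b, a 0 ≤ x 0 ∧ x 0 ≤ b 0 := by
    rintro x ⟨s, t, hs, ht, hst, rfl⟩
    simp only [PiLp.add_apply, PiLp.smul_apply, smul_eq_mul]
    have : s = 1 - t := by linarith
    subst this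
    constructor <;> nlinarith
  have hSsub : S ⊆ segment ℝ a b := by
    rintro x ⟨h1, h2⟩
    simp only [Set.mem_ofPred_eq, not_le] at h1 h2
    have hpos : 0 < b 0 - a 0 := by linarith
    refine ⟨(b 0 - x 0) / (b 0 - a 0), (x 0 - a 0) / (b 0 - a 0), ?_, ?_, ?_, ?_⟩
    · exact div_nonneg (by linarith) hpos.le
    · exact div_nonneg (by linarith) hpos.le
    · field_simp
      ring
    · ext j
      rw [Subsingleton.elim j 0]
      simp only [PiLp.add_apply, PiLp.smul_apply, smul_eq_mul]
      field_simp
      ring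
  have hae : (Ω ∩ S : Set (Pt 1)) =ᵐ[volume]
      convexHull ℝ (({a, b} : Finset (Pt 1)) : Set (Pt 1)) := by
    refine (LE.le.eventuallyLE ?_).antisymm ?_
    · rw [hseg]
      exact Set.inter_subset_right.trans hSsub
    · rw [ae_le_set]
      refine measure_mono_null (t := frontier (convexHull ℝ
        (({a, b} : Finset (Pt 1)) : Set (Pt 1))) ∪ {a}) ?_ ?_
      · rintro x ⟨h1, h2⟩
        by_cases hi : x ∈ interior (convexHull ℝ (({a, b} : Finset (Pt 1)) : Set (Pt 1)))
        · right
          have hxΩ := 𝒯.interior_subset_domain hreg hT hi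
          rw [hseg] at h1
          obtain ⟨h3, h4⟩ := hcoord x h1
          have h5 : x 0 ≤ a 0 := by
            by_contra h
            exact h2 ⟨hxΩ, h4, h⟩
          rw [Set.mem_singleton_iff]
          ext j
          rw [Subsingleton.elim j 0]
          exact le_antisymm h5 h3
        · left
          exact ⟨subset_closure h1, hi⟩
      · exact measure_union_null ((convex_convexHull ℝ _).addHaar_frontier volume)
          (measure_singleton a)
  rw [e1, setIntegral_indicator hSm, setIntegral_congr_set hae]

/-- The flux through an endpoint is the value there of the primitive of `w`, which Cauchy–Schwarz
bounds by `|Ω|^(1/2) ‖w‖`. No comparison of neighbouring cells is needed; the weights `diam² / vol`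
are at most multiples of the lengths, which add up to `|Ω|`. -/
theorem exists_stable_field_one (hreg : interior (closure Ω) = Ω)
    (hbdd : Bornology.IsBounded Ω) {σ : ℝ} (hσ : 𝒯.ShapeRegular σ) {w : L2 Ω} (hw : w ∈ 𝒯.W) :
    ∃ v ∈ 𝒯.V, weakDiv v = w ∧ ‖v‖ ^ 2 ≤ 4 * (volume.real Ω
      * (2 * max σ 1 / volume.real (Metric.ball (0 : Pt 1) 1))) ^ 2 * ‖w‖ ^ 2 := by
  classical
  obtain ⟨c, hc⟩ := 𝒯.exists_cell_values hreg hw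
  have hsimp := fun T : 𝒯.cellsF => 𝒯.isSimplex (𝒯.mem_cellsF.1 T.2)
  have hf := isFiniteMeasure_restrict hbdd
  set β := volume.real (Metric.ball (0 : Pt 1) 1) with hβ
  have hβ0 : 0 < β := volume_unitBall_pos 1
  set sg : Pt 1 → Pt 1 → ℝ := fun z y => if z 0 < y 0 then 1 else -1 with hsg
  -- The face opposite to `z` is the other endpoint `y`, and `sg z y` is the outward normal there.
  set g : 𝒯.Facet → ℝ := fun i => ∑ y ∈ i.1.1.erase i.2.1, sg i.2.1 y * primitive w y with hg
  have hface : ∀ i : 𝒯.Facet, ∃ y, i.1.1.erase i.2.1 = {y} := fun i => by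
    rw [← Finset.card_eq_one, Finset.card_erase_of_mem i.2.2, (hsimp i.1).card_eq]
  have hanti : ∀ i, 𝒯.flip i ≠ i → g (𝒯.flip i) = - g i := by
    intro i hi
    have hopp := 𝒯.opposite_flip hi
    obtain ⟨y, hy⟩ := hface i
    have hyi : y ∈ i.1.1.erase i.2.1 := by rw [hy]; exact Finset.mem_singleton_self _
    have hneg := 𝒯.lam_opposite_neg le_rfl (𝒯.cell_mem i) (𝒯.cell_mem (𝒯.flip i))
      (fun h => hopp.1 (Subtype.ext h)) i.2.2 (𝒯.flip i).2.2 hopp.2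
    set z := i.2.1 with hz
    set z' := (𝒯.flip i).2.1 with hz'
    set κ := lam i.1.1 z z' with hκ
    have hyT := Finset.mem_of_mem_erase hyi
    have hne : y ≠ z := Finset.ne_of_mem_erase hyi
    have h1 := (hsimp i.1).sum_lam z'
    have h2 := (hsimp i.1).sum_lam_smul z'
    rw [← Finset.add_sum_erase _ _ i.2.2, hy, Finset.sum_singleton] at h1 h2
    have h3 : z' 0 - y 0 = κ * (z 0 - y 0) := by
      have h4 := congrArg (fun x : Pt 1 => x 0) h2
      simp only [PiLp.add_apply, PiLp.smul_apply, smul_eq_mul] at h4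
      have h5 : lam i.1.1 y z' = 1 - κ := by rw [hκ]; linarith
      rw [h5] at h4
      rw [← h4, hκ]
      ring
    have hne0 : z 0 ≠ y 0 := by
      intro h
      refine hne ?_
      ext j
      rw [Subsingleton.elim j 0]
      exact h.symm
    -- The ratio `κ` is negative, so `y` lies between `z` and `z'` and the two outward normals are
    -- opposite.
    have hs : sg z' y = - sg z y := by
      simp only [hsg]
      rcases lt_or_gt_of_ne hne0 with h | h
      · have : ¬ z' 0 < y 0 := by nlinarith
        rw [if_pos h, if_neg this]
      · have : z' 0 < y 0 := by nlinarith
        rw [if_neg h.not_gt, if_pos this]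
        ring
    simp only [hg]
    rw [hopp.2, hy, Finset.sum_singleton, Finset.sum_singleton, ← hz', hs]
    ring
  have hsum : ∀ T : 𝒯.cellsF, ∑ z : T.1, g ⟨T, z⟩ = 𝒯.vol T * c T := by
    intro T
    have hintg : ∫ x in convexHull ℝ (T.1 : Set (Pt 1)), w x = 𝒯.vol T * c T := by
      have : ∫ x in convexHull ℝ (T.1 : Set (Pt 1)), w x
          = ∫ _x in convexHull ℝ (T.1 : Set (Pt 1)), c T := integral_congr_ae (hc T)
      rw [this, integral_const, measureReal_restrict_apply_univ, smul_eq_mul]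
      rfl
    rw [← hintg]
    have key : ∀ a b : Pt 1, T.1 = {a, b} → a 0 < b 0 → ∑ z : T.1, g ⟨T, z⟩
        = ∫ x in convexHull ℝ (T.1 : Set (Pt 1)), w x := by
      intro a b hTab hab
      have hne : a ≠ b := by rintro rfl; exact lt_irrefl _ hab
      have hT : ({a, b} : Finset (Pt 1)) ∈ 𝒯.cells := hTab ▸ 𝒯.mem_cellsF.1 T.2
      have e : ∑ z : T.1, g ⟨T, z⟩
          = ∑ z ∈ T.1, ∑ y ∈ T.1.erase z, sg z y * primitive w y :=
        Finset.sum_coe_sort T.1 fun z => ∑ y ∈ T.1.erase z, sg z y * primitive w y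
      have ea : ({a, b} : Finset (Pt 1)).erase a = {b} := by
        ext x
        simp only [Finset.mem_erase, Finset.mem_insert, Finset.mem_singleton]
        constructor
        · rintro ⟨h1, h2⟩
          exact h2.resolve_left h1
        · rintro rfl
          exact ⟨hne.symm, Or.inr rfl⟩
      have eb : ({a, b} : Finset (Pt 1)).erase b = {a} := by
        ext x
        simp only [Finset.mem_erase, Finset.mem_insert, Finset.mem_singleton]
        constructor
        · rintro ⟨h1, h2⟩
          exact h2.resolve_right h1
        · rintro rfl
          exact ⟨hne, Or.inl rfl⟩
      rw [e, hTab, Finset.sum_pair hne, ea, eb, Finset.sum_singleton, Finset.sum_singleton,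
        ← 𝒯.primitive_sub hreg hbdd w hT hab]
      simp only [hsg]
      rw [if_pos hab, if_neg hab.not_gt]
      ring
    obtain ⟨a, b, hne, hTab⟩ := Finset.card_eq_two.1 (hsimp T).card_eq
    have hne0 : a 0 ≠ b 0 := by
      intro h
      refine hne ?_
      ext j
      rw [Subsingleton.elim j 0]
      exact h
    rcases lt_or_gt_of_ne hne0 with h | h
    · exact key a b hTab h
    · exact key b a (by rw [hTab, Finset.pair_comm]) h
  have hw' : ∀ T : 𝒯.cellsF, ∀ᵐ x ∂(volume.restrict (convexHull ℝ (T.1 : Set (Pt 1)))),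
      w x = (1 : ℕ) * (∑ z : T.1, g ⟨T, z⟩) / 𝒯.vol T := fun T => by
    filter_upwards [hc T] with x hx
    rw [hx, hsum T]
    have := (𝒯.vol_pos T).ne'
    field_simp
    simp
  obtain ⟨v, hv, hdiv, hnorm⟩ := 𝒯.exists_flux_field le_rfl hreg hbdd hanti hw'
  refine ⟨v, hv, hdiv, hnorm.trans ?_⟩
  have hgb : ∀ i, g i ^ 2 ≤ volume.real Ω * ‖w‖ ^ 2 := by
    intro i
    obtain ⟨y, hy⟩ := hface i
    have hs : sg i.2.1 y ^ 2 = 1 := by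
      simp only [hsg]
      split_ifs <;> norm_num
    simp only [hg]
    rw [hy, Finset.sum_singleton, mul_pow, hs, one_mul]
    exact abs_integral_le_sqrt_mul_norm hbdd w _ (measurableSet_coord_le 0 _)
  have hθ : ∀ T : 𝒯.cellsF, 𝒯.diam T ^ 2 / 𝒯.vol T ≤ (2 * max σ 1 / β) ^ 2 * 𝒯.vol T := by
    intro T
    obtain ⟨z, r, hr, hb, hdiam⟩ := 𝒯.exists_inball hσ T
    have h1 : r * β ≤ 𝒯.vol T := by
      have := volume_ball_le (isCompact_simplex T.1).measure_ne_top hr.le hb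
      rwa [pow_one] at this
    have hpos := 𝒯.vol_pos T
    have h2 : 𝒯.diam T ≤ 2 * max σ 1 / β * 𝒯.vol T := by
      have hκ : 0 ≤ max σ 1 := zero_le_one.trans (le_max_right _ _)
      calc 𝒯.diam T ≤ max σ 1 * (2 * r) := hdiam
        _ = 2 * max σ 1 / β * (r * β) := by field_simp
        _ ≤ _ := mul_le_mul_of_nonneg_left h1 (by positivity)
    rw [div_le_iff₀ hpos]
    calc 𝒯.diam T ^ 2 ≤ (2 * max σ 1 / β * 𝒯.vol T) ^ 2 :=
          pow_le_pow_left₀ Metric.diam_nonneg h2 2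
      _ = _ := by ring
  have hvolsum : ∑ T : 𝒯.cellsF, 𝒯.vol T = volume.real Ω := by
    have := 𝒯.integral_eq_sum hreg (integrable_const (μ := volume.restrict Ω) (1 : ℝ))
    rw [𝒯.sum_cells] at this
    simp only [integral_const, measureReal_restrict_apply_univ, smul_eq_mul, mul_one] at this
    exact this.symm
  have hsumθ : ∑ i : 𝒯.Facet, g i ^ 2 * (𝒯.diam i.1 ^ 2 / 𝒯.vol i.1)
      ≤ volume.real Ω * ‖w‖ ^ 2 * ((2 * max σ 1 / β) ^ 2 * (2 * volume.real Ω)) := by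
    calc ∑ i : 𝒯.Facet, g i ^ 2 * (𝒯.diam i.1 ^ 2 / 𝒯.vol i.1)
        ≤ ∑ i : 𝒯.Facet, volume.real Ω * ‖w‖ ^ 2 * ((2 * max σ 1 / β) ^ 2 * 𝒯.vol i.1) := by
          refine Finset.sum_le_sum fun i _ => ?_
          refine mul_le_mul (hgb i) (hθ i.1) ?_ (by positivity)
          exact div_nonneg (sq_nonneg _) (𝒯.vol_pos _).le
      _ = _ := by
          rw [← Finset.mul_sum, ← Finset.mul_sum, Fintype.sum_sigma, ← hvolsum]
          simp [(hsimp _).card_eq, Finset.mul_sum]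
  calc _ ≤ (((1 : ℕ) : ℝ) + 1)
        * (volume.real Ω * ‖w‖ ^ 2 * ((2 * max σ 1 / β) ^ 2 * (2 * volume.real Ω))) :=
        mul_le_mul_of_nonneg_left hsumθ (by positivity)
    _ = _ := by push_cast; ring

end Mesh

/-- The divergence has a right inverse on the Raviart–Thomas spaces that is bounded uniformly over
all shape regular meshes. -/
theorem exists_stability_constant {d : ℕ} (hd : 1 ≤ d) (Ω : Set (Pt d))
    (hbdd : Bornology.IsBounded Ω) (hreg : interior (closure Ω) = Ω) (σ : ℝ) :
    ∃ C : ℝ, 0 < C ∧ ∀ 𝒯 : Mesh Ω, 𝒯.ShapeRegular σ →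
      ∀ w ∈ 𝒯.W, ∃ v ∈ 𝒯.V, weakDiv v = w ∧ ‖v‖ ≤ C * ‖w‖ := by
  have hfin : ∀ A : ℝ, 0 ≤ A → (∀ 𝒯 : Mesh Ω, 𝒯.ShapeRegular σ →
      ∀ w ∈ 𝒯.W, ∃ v ∈ 𝒯.V, weakDiv v = w ∧ ‖v‖ ^ 2 ≤ A * ‖w‖ ^ 2) →
      ∃ C : ℝ, 0 < C ∧ ∀ 𝒯 : Mesh Ω, 𝒯.ShapeRegular σ →
        ∀ w ∈ 𝒯.W, ∃ v ∈ 𝒯.V, weakDiv v = w ∧ ‖v‖ ≤ C * ‖w‖ := by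
    intro A hA h
    -- Since `A ≤ (A + 1) ^ 2`, no square root is needed and positivity is automatic.
    refine ⟨A + 1, by linarith, fun 𝒯 h𝒯 w hw => ?_⟩
    obtain ⟨v, hv, hdiv, hn⟩ := h 𝒯 h𝒯 w hw
    refine ⟨v, hv, hdiv, abs_le_of_sq_le_sq' ?_ (by positivity) |>.2⟩
    calc ‖v‖ ^ 2 ≤ A * ‖w‖ ^ 2 := hn
      _ ≤ (A + 1) ^ 2 * ‖w‖ ^ 2 := mul_le_mul_of_nonneg_right (by nlinarith) (sq_nonneg _)
      _ = _ := by ring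
  rcases hd.eq_or_lt with h1 | h2
  · subst h1
    exact hfin _ (by positivity) fun 𝒯 h𝒯 w hw => 𝒯.exists_stable_field_one hreg hbdd h𝒯 hw
  · obtain ⟨R, hR⟩ := hbdd.subset_closedBall 0
    refine hfin _ ?_ fun 𝒯 h𝒯 w hw => 𝒯.exists_stable_field_of_two_le h2 hreg hbdd hR h𝒯 hw
    positivity

/-! ### Abstract mixed problems -/

section Mixed

variable {W V : Type*} [NormedAddCommGroup W] [InnerProductSpace ℝ W] [NormedAddCommGroup V]
  [InnerProductSpace ℝ V]

/-- Unique solvability of the two coupled mixed problems of one step of the scheme. -/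
theorem existsUnique_mixed [FiniteDimensional ℝ W] [FiniteDimensional ℝ V] {D : V →ₗ[ℝ] W}
    (hD : Function.Surjective D) {A N : V →ₗ[ℝ] V →ₗ[ℝ] ℝ} {α : ℝ} (hα : 0 < α)
    (hA : ∀ v, α * ‖v‖ ^ 2 ≤ A v v) {L τ : ℝ} (hL : 0 < L) (hτ : 0 < τ)
    (l₁ l₃ : W →ₗ[ℝ] ℝ) (l₂ l₄ : V →ₗ[ℝ] ℝ) :
    ∃! x : W × V × W × V,
      (∀ w, L * inner ℝ x.1 w + τ * inner ℝ (D x.2.1) w = l₁ w) ∧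
      (∀ v, inner ℝ x.2.1 v - inner ℝ x.1 (D v) - N x.2.2.2 v = l₂ v) ∧
      (∀ w, inner ℝ (D x.2.2.2) w = l₃ w) ∧
      (∀ v, A x.2.2.2 v - inner ℝ x.2.2.1 (D v) = l₄ v) := by
  let M : (W × V × W × V) →ₗ[ℝ]
      (W →ₗ[ℝ] ℝ) × (V →ₗ[ℝ] ℝ) × (W →ₗ[ℝ] ℝ) × (V →ₗ[ℝ] ℝ) :=
    { toFun := fun x =>
        (L • innerₗ W x.1 + τ • innerₗ W (D x.2.1),
          innerₗ V x.2.1 - (innerₗ W x.1).comp D - N x.2.2.2,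
          innerₗ W (D x.2.2.2), A x.2.2.2 - (innerₗ W x.2.2.1).comp D)
      map_add' := fun x y => by
        ext <;> simp <;> ring
      map_smul' := fun a x => by
        ext <;> simp <;> ring }
  have hM : Function.Injective M := by
    rw [← LinearMap.ker_eq_bot, LinearMap.ker_eq_bot']
    rintro ⟨Θ, q, p, u⟩ hx
    have e₁ : ∀ w, L * inner ℝ Θ w + τ * inner ℝ (D q) w = 0 := fun w => by
      simpa [M] using LinearMap.congr_fun (congrArg Prod.fst hx) w
    have e₂ : ∀ v, inner ℝ q v - inner ℝ Θ (D v) - N u v = 0 := fun v => by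
      simpa [M] using LinearMap.congr_fun (congrArg (fun y => y.2.1) hx) v
    have e₃ : ∀ w, inner ℝ (D u) w = 0 := fun w => by
      simpa [M] using LinearMap.congr_fun (congrArg (fun y => y.2.2.1) hx) w
    have e₄ : ∀ v, A u v - inner ℝ p (D v) = 0 := fun v => by
      simpa [M] using LinearMap.congr_fun (congrArg (fun y => y.2.2.2) hx) v
    -- The flow pair decouples: `D u = 0` and coercivity give `u = 0`, and testing with a preimage
    -- of `p` under `D` gives `p = 0`.
    have hDu : D u = 0 := inner_self_eq_zero.1 (e₃ (D u))
    have hu : u = 0 := by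
      have h1 := e₄ u
      rw [hDu, inner_zero_right, sub_zero] at h1
      have h2 := hA u
      rw [h1] at h2
      have : ‖u‖ ^ 2 = 0 := le_antisymm (by nlinarith) (sq_nonneg _)
      simpa using this
    have hp : p = 0 := by
      obtain ⟨v, hv⟩ := hD p
      have h1 := e₄ v
      rw [hu, hv] at h1
      simpa using h1
    have h1 := e₁ Θ
    have h2 := e₂ q
    rw [hu] at h2
    simp only [map_zero, LinearMap.zero_apply, sub_zero] at h2
    rw [real_inner_self_eq_norm_sq] at h1 h2
    rw [real_inner_comm] at h1
    -- Testing the first equation with `Θ` and the second with `q` makes the coupling terms cancel.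
    have h3 : L * ‖Θ‖ ^ 2 + τ * ‖q‖ ^ 2 = 0 := by linear_combination h1 + τ * h2
    have h4 := mul_nonneg hL.le (sq_nonneg ‖Θ‖)
    have h5 := mul_nonneg hτ.le (sq_nonneg ‖q‖)
    have hq : ‖q‖ ^ 2 = 0 := (mul_eq_zero.1 (by linarith : τ * ‖q‖ ^ 2 = 0)).resolve_left hτ.ne'
    have hΘ : ‖Θ‖ ^ 2 = 0 := (mul_eq_zero.1 (by linarith : L * ‖Θ‖ ^ 2 = 0)).resolve_left hL.ne'
    have hq' : q = 0 := by simpa using hq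
    have hΘ' : Θ = 0 := by simpa using hΘ
    rw [hu, hp, hq', hΘ']
    rfl
  have hfin : Module.finrank ℝ (W × V × W × V)
      = Module.finrank ℝ ((W →ₗ[ℝ] ℝ) × (V →ₗ[ℝ] ℝ) × (W →ₗ[ℝ] ℝ) × (V →ₗ[ℝ] ℝ)) := by
    have hW : Module.finrank ℝ (W →ₗ[ℝ] ℝ) = Module.finrank ℝ W := Subspace.dual_finrank_eq
    have hV : Module.finrank ℝ (V →ₗ[ℝ] ℝ) = Module.finrank ℝ V := Subspace.dual_finrank_eq
    simp only [Module.finrank_prod, hW, hV]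
  have hsurj := (LinearMap.injective_iff_surjective_of_finrank_eq_finrank hfin).1 hM
  have hiff : ∀ x, M x = (l₁, l₂, l₃, l₄) ↔
      (∀ w, L * inner ℝ x.1 w + τ * inner ℝ (D x.2.1) w = l₁ w) ∧
      (∀ v, inner ℝ x.2.1 v - inner ℝ x.1 (D v) - N x.2.2.2 v = l₂ v) ∧
      (∀ w, inner ℝ (D x.2.2.2) w = l₃ w) ∧
      (∀ v, A x.2.2.2 v - inner ℝ x.2.2.1 (D v) = l₄ v) := by
    intro x
    simp only [M, LinearMap.coe_mk, AddHom.coe_mk, Prod.mk.injEq, LinearMap.ext_iff]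
    rfl
  obtain ⟨x, hx⟩ := hsurj (l₁, l₂, l₃, l₄)
  refine ⟨x, (hiff x).1 hx, fun y hy => hM ?_⟩
  rw [hx]
  exact (hiff y).2 hy

/-- Stability of the scalar unknown in a mixed problem. -/
theorem mixed_scalar_le {D : V →ₗ[ℝ] W} {C : ℝ} (hC : 0 < C)
    (hD : ∀ w, ∃ v, D v = w ∧ ‖v‖ ≤ C * ‖w‖) {p : W} {l : V → ℝ} {b : ℝ} (hb : 0 ≤ b)
    (hl : ∀ v, |l v| ≤ b * ‖v‖) (h : ∀ v, inner ℝ p (D v) = l v) : ‖p‖ ≤ C * b := by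
  obtain ⟨v, hv, hvn⟩ := hD p
  have h1 := h v
  rw [hv, real_inner_self_eq_norm_sq] at h1
  have h2 : ‖p‖ ^ 2 ≤ b * ‖v‖ := by rw [h1]; exact (le_abs_self _).trans (hl v)
  rcases (norm_nonneg p).eq_or_lt with h0 | hpos
  · rw [← h0]
    positivity
  · have h3 : ‖p‖ * ‖p‖ ≤ ‖p‖ * (C * b) := by
      nlinarith [mul_le_mul_of_nonneg_left hvn hb]
    exact le_of_mul_le_mul_left h3 hpos

/-- With `A = C * aUp * f`, Young's inequality absorbs the terms linear in `U`. The cross term `2 (A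
/ aLow) (m / aUp)` is split as a product of two ratios, which is the origin of the summand `m ^ 2 /
aUp ^ 2` in `C₁`. -/
theorem flux_sq_le {U S C f m mS aLow aUp : ℝ} (hlow : 0 < aLow)
    (hup : 0 < aUp) (hm : m ^ 2 ≤ 2 * mS)
    (h : aLow * U ^ 2 ≤ C * (aUp * U + m * S) * (f * S) + m * S * U) :
    U ^ 2 ≤ (4 * (mS + 2 * aUp ^ 2 * C ^ 2 * f ^ 2) / aLow ^ 2 + m ^ 2 / aUp ^ 2) * S ^ 2 := by
  set A := C * aUp * f with hA
  have h1 : (A + m) * S * U ≤ aLow * U ^ 2 / 2 + (A + m) ^ 2 * S ^ 2 / (2 * aLow) := by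
    have := sq_nonneg (aLow * U - (A + m) * S)
    have e : aLow * U ^ 2 / 2 + (A + m) ^ 2 * S ^ 2 / (2 * aLow) - (A + m) * S * U
        = (aLow * U - (A + m) * S) ^ 2 / (2 * aLow) := by
      field_simp
      ring
    have : 0 ≤ (aLow * U - (A + m) * S) ^ 2 / (2 * aLow) := by positivity
    linarith
  have h2 : aLow * U ^ 2 ≤ (A + m) * S * U + A * m / aUp * S ^ 2 := by
    refine h.trans (le_of_eq ?_)
    rw [hA]
    field_simp
    ring
  have h3 : U ^ 2 ≤ ((A + m) ^ 2 / aLow ^ 2 + 2 * (A / aLow) * (m / aUp)) * S ^ 2 := by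
    have e : ((A + m) ^ 2 / aLow ^ 2 + 2 * (A / aLow) * (m / aUp)) * S ^ 2
        = 2 / aLow * ((A + m) ^ 2 * S ^ 2 / (2 * aLow) + A * m / aUp * S ^ 2) := by
      field_simp
    have e2 : U ^ 2 = 2 / aLow * (aLow * U ^ 2 / 2) := by field_simp
    rw [e, e2]
    refine mul_le_mul_of_nonneg_left ?_ (by positivity)
    linarith
  refine h3.trans (mul_le_mul_of_nonneg_right ?_ (sq_nonneg _))
  have h4 : 2 * (A / aLow) * (m / aUp) ≤ (A / aLow) ^ 2 + (m / aUp) ^ 2 :=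
    two_mul_le_add_sq _ _
  have h5 : (A + m) ^ 2 + A ^ 2 ≤ 4 * (mS + 2 * aUp ^ 2 * C ^ 2 * f ^ 2) := by
    have e : aUp ^ 2 * C ^ 2 * f ^ 2 = A ^ 2 := by rw [hA]; ring
    nlinarith [sq_nonneg (A - m), sq_nonneg A]
  have h6 : (A + m) ^ 2 / aLow ^ 2 + (A / aLow) ^ 2
      ≤ 4 * (mS + 2 * aUp ^ 2 * C ^ 2 * f ^ 2) / aLow ^ 2 := by
    rw [div_pow, ← add_div]
    exact div_le_div_of_nonneg_right h5 (by positivity)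
  rw [div_pow m] at h4
  linarith

theorem sq_add_add_le (x y z : ℝ) : (x + y + z) ^ 2 ≤ 3 * (x ^ 2 + y ^ 2 + z ^ 2) := by
  nlinarith [sq_nonneg (x - y), sq_nonneg (x - z), sq_nonneg (y - z)]

theorem two_mul_sq_add_add_le (x y z : ℝ) :
    2 * (x + (y + z)) ^ 2 ≤ 4 * x ^ 2 + 8 * y ^ 2 + 8 * z ^ 2 := by
  nlinarith [sq_nonneg (x - (y + z)), sq_nonneg (y - z)]

/-- After doubling `hmain` and absorbing `G * Q`, there remains `3 τ Q² / 2`. The part `τ Q²` is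
traded through `hq` for `τ E² / (3 C²)`, the gain that gives the contraction factor; `τ Q² / 2` is
kept. The costs `k - c` and `c` of the two steps add up to `k`. -/
theorem contraction_of_energy {C L τ E E' Q S G c k : ℝ} (hC : 0 < C) (hL : 0 < L) (hτ : 0 < τ)
    (hq : 1 / (3 * C ^ 2) * E ^ 2 - c * S ^ 2 ≤ Q ^ 2)
    (hmain : L / 2 * E ^ 2 + S ^ 2 / (2 * L) + τ * Q ^ 2 ≤ L / 2 * E' ^ 2 + τ * (G * Q))
    (hG : 2 * G ^ 2 ≤ (k - c) * S ^ 2) :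
    E ^ 2 + 3 * C ^ 2 * τ / (2 * (3 * C ^ 2 * L + τ)) * Q ^ 2
        + 3 * C ^ 2 * (1 - τ * L * k) / (L * (3 * C ^ 2 * L + τ)) * S ^ 2
      ≤ 3 * C ^ 2 * L / (3 * C ^ 2 * L + τ) * E' ^ 2 := by
  have hGQ : 2 * (G * Q) ≤ Q ^ 2 / 2 + 2 * G ^ 2 := by nlinarith [sq_nonneg (Q - 2 * G)]
  have hden : 0 < 3 * C ^ 2 * L + τ := by positivity
  have h1 : E ^ 2 ≤ 3 * C ^ 2 * (Q ^ 2 + c * S ^ 2) := by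
    have : 1 / (3 * C ^ 2) * E ^ 2 ≤ Q ^ 2 + c * S ^ 2 := by linarith
    rwa [one_div, inv_mul_le_iff₀ (by positivity)] at this
  have h2 : L * E ^ 2 + S ^ 2 / L + 2 * τ * Q ^ 2
      ≤ L * E' ^ 2 + τ * (Q ^ 2 / 2 + (k - c) * S ^ 2) := by
    have e : S ^ 2 / L = 2 * (S ^ 2 / (2 * L)) := by field_simp
    have h3 : τ * (2 * (G * Q)) ≤ τ * (Q ^ 2 / 2 + (k - c) * S ^ 2) :=
      mul_le_mul_of_nonneg_left (by linarith) hτ.le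
    rw [e]
    linarith
  have h4 := mul_le_mul_of_nonneg_left h1 hτ.le
  have h5 := mul_le_mul_of_nonneg_left h2 (by positivity : 0 ≤ 3 * C ^ 2)
  have key : E ^ 2 * (3 * C ^ 2 * L + τ) + 3 * C ^ 2 * τ / 2 * Q ^ 2
      + 3 * C ^ 2 * (1 - τ * L * k) / L * S ^ 2 ≤ 3 * C ^ 2 * L * E' ^ 2 := by
    have e : 3 * C ^ 2 * (1 - τ * L * k) / L * S ^ 2
        = 3 * C ^ 2 * (S ^ 2 / L) - 3 * C ^ 2 * (τ * k * S ^ 2) := by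
      field_simp
    rw [e]
    linarith
  have e1 : E ^ 2 + 3 * C ^ 2 * τ / (2 * (3 * C ^ 2 * L + τ)) * Q ^ 2
        + 3 * C ^ 2 * (1 - τ * L * k) / (L * (3 * C ^ 2 * L + τ)) * S ^ 2
      = (E ^ 2 * (3 * C ^ 2 * L + τ) + 3 * C ^ 2 * τ / 2 * Q ^ 2
      + 3 * C ^ 2 * (1 - τ * L * k) / L * S ^ 2) / (3 * C ^ 2 * L + τ) := by
    field_simp
  have e2 : 3 * C ^ 2 * L / (3 * C ^ 2 * L + τ) * E' ^ 2
      = 3 * C ^ 2 * L * E' ^ 2 / (3 * C ^ 2 * L + τ) := by ring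
  rw [e1, e2]
  exact div_le_div_of_nonneg_right key hden.le

/-- The error estimates for one step of the scheme, in terms of the error equations. -/
theorem mixed_error_bounds {D : V →ₗ[ℝ] W} {C : ℝ} (hC : 0 < C)
    (hD : ∀ w, ∃ v, D v = w ∧ ‖v‖ ≤ C * ‖w‖) {B : Consts} (hlow : 0 < B.aLow)
    (hup : 0 < B.aUp) {L τ : ℝ} (hL : 0 < L) (hτ : 0 < τ) {S : ℝ} (hS : 0 ≤ S)
    {eΘ eΘ' ep : W} {eq eu : V} {a δ γ : V → ℝ} {ρ : W →ₗ[ℝ] ℝ}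
    (ha : ∀ v, |a v| ≤ B.aUp * ‖eu‖ * ‖v‖) (hau : B.aLow * ‖eu‖ ^ 2 ≤ a eu)
    (hδ : ∀ v, |δ v| ≤ ((B.Mu : ℝ) * B.La + B.Lf3) * S * ‖v‖)
    (hpu : ∀ v, a v - inner ℝ ep (D v) + δ v = 0) (hdiv : ‖D eu‖ ≤ B.Lf2 * S)
    (hγ : ∀ v, |γ v| ≤ (B.Mfw * ‖eu‖ + ((B.Mu : ℝ) * B.Lfw + B.Lf1) * S) * ‖v‖)
    (hΘq : ∀ v, inner ℝ eq v - inner ℝ eΘ (D v) = γ v)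
    (hρ : ∀ w, |ρ w| ≤ S * ‖w‖) (hρ' : S ^ 2 ≤ L * ρ eΘ')
    (hΘ : ∀ w, L * inner ℝ (eΘ - eΘ') w + ρ w + τ * inner ℝ (D eq) w = 0) :
    ‖eu‖ ^ 2 ≤ B.C1 C * S ^ 2 ∧ ‖ep‖ ^ 2 ≤ B.C2 C * S ^ 2 ∧
      1 / (3 * C ^ 2) * ‖eΘ‖ ^ 2 - B.C3 C * S ^ 2 ≤ ‖eq‖ ^ 2 ∧
      ‖eΘ‖ ^ 2 + 3 * C ^ 2 * τ / (2 * (3 * C ^ 2 * L + τ)) * ‖eq‖ ^ 2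
        + 3 * C ^ 2 * (1 - τ * L * B.K C) / (L * (3 * C ^ 2 * L + τ)) * S ^ 2
      ≤ 3 * C ^ 2 * L / (3 * C ^ 2 * L + τ) * ‖eΘ'‖ ^ 2 := by
  set m : ℝ := (B.Mu : ℝ) * B.La + B.Lf3 with hm
  set U := ‖eu‖ with hU
  have hU0 : 0 ≤ U := norm_nonneg _
  have hm0 : 0 ≤ m := by positivity
  -- The flux is not yet known to be bounded by `S`; this first bound on `ep` is used to control the
  -- flux and only afterwards becomes the pressure estimate.
  have hp : ‖ep‖ ≤ C * (B.aUp * U + m * S) := by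
    refine mixed_scalar_le hC hD (l := fun v => a v + δ v) (by positivity) (fun v => ?_)
      fun v => by linarith [hpu v]
    refine (abs_add_le _ _).trans ?_
    linarith [ha v, hδ v]
  have hu : U ^ 2 ≤ B.C1 C * S ^ 2 := by
    have h1 := hpu eu
    have h2 : inner ℝ ep (D eu) ≤ C * (B.aUp * U + m * S) * (B.Lf2 * S) :=
      (real_inner_le_norm _ _).trans (mul_le_mul hp hdiv (norm_nonneg _) (by positivity))
    have h3 := hδ eu
    have h4 := neg_abs_le (δ eu)
    have h5 := flux_sq_le (U := U) (S := S) (C := C) (f := B.Lf2) (m := m)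
      (mS := (B.Mu : ℝ) ^ 2 * (B.La : ℝ) ^ 2 + (B.Lf3 : ℝ) ^ 2) hlow hup
      (by rw [hm]; nlinarith [sq_nonneg ((B.Mu : ℝ) * B.La - B.Lf3)])
      (by linarith)
    exact h5
  refine ⟨hu, ?_, ?_⟩
  · calc ‖ep‖ ^ 2 ≤ (C * (B.aUp * U + m * S)) ^ 2 := pow_le_pow_left₀ (norm_nonneg _) hp 2
      _ ≤ 2 * C ^ 2 * B.aUp ^ 2 * U ^ 2 + 2 * C ^ 2 * m ^ 2 * S ^ 2 := by
          have := mul_nonneg (sq_nonneg C) (sq_nonneg (B.aUp * U - m * S))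
          linarith
      _ ≤ 2 * C ^ 2 * B.aUp ^ 2 * (B.C1 C * S ^ 2) + 2 * C ^ 2 * m ^ 2 * S ^ 2 := by gcongr
      _ = B.C2 C * S ^ 2 := by rw [Consts.C2]; ring
  set n : ℝ := (B.Mu : ℝ) * B.Lfw + B.Lf1 with hn
  have hn0 : 0 ≤ n := by positivity
  set G := B.Mfw * U + n * S with hG
  have hG0 : 0 ≤ G := by positivity
  set Q := ‖eq‖ with hQ
  have hQ0 : 0 ≤ Q := norm_nonneg _
  have hE : ‖eΘ‖ ≤ C * (Q + G) := by
    refine mixed_scalar_le hC hD (l := fun v => inner ℝ eq v - γ v) (by positivity) (fun v => ?_)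
      fun v => by linarith [hΘq v]
    refine (abs_sub _ _).trans ?_
    linarith [abs_real_inner_le_norm eq v, hγ v]
  have hMU : (B.Mfw : ℝ) ^ 2 * U ^ 2 ≤ (B.Mfw : ℝ) ^ 2 * (B.C1 C * S ^ 2) := by gcongr
  have hq : 1 / (3 * C ^ 2) * ‖eΘ‖ ^ 2 - B.C3 C * S ^ 2 ≤ Q ^ 2 := by
    have h1 : ‖eΘ‖ ^ 2 ≤ C ^ 2 * (3 * (Q ^ 2 + B.Mfw ^ 2 * U ^ 2 + n ^ 2 * S ^ 2)) := by
      calc ‖eΘ‖ ^ 2 ≤ (C * (Q + G)) ^ 2 := pow_le_pow_left₀ (norm_nonneg _) hE 2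
        _ = C ^ 2 * (Q + B.Mfw * U + n * S) ^ 2 := by rw [hG]; ring
        _ ≤ _ := by
          refine mul_le_mul_of_nonneg_left ?_ (sq_nonneg _)
          refine (sq_add_add_le Q (B.Mfw * U) (n * S)).trans (le_of_eq ?_)
          ring
    have h2 : 1 / (3 * C ^ 2) * ‖eΘ‖ ^ 2 ≤ Q ^ 2 + B.Mfw ^ 2 * U ^ 2 + n ^ 2 * S ^ 2 := by
      rw [one_div, inv_mul_le_iff₀ (by positivity)]
      linarith
    have h3 : B.C3 C * S ^ 2 = B.Mfw ^ 2 * (B.C1 C * S ^ 2) + n ^ 2 * S ^ 2 := by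
      rw [Consts.C3]; ring
    linarith
  refine ⟨hq, ?_⟩
  set E := ‖eΘ‖ with hEdef
  set E' := ‖eΘ'‖ with hE'def
  -- Test with `eΘ` and `eq`. The form `ρ` is evaluated at `eΘ'`, where `hρ'` makes it at least `S ^
  -- 2 / L`, plus a remainder at `eΘ - eΘ'`. Young's inequality bounds that remainder by half of
  -- this gain and the square `L / 2 * ‖eΘ - eΘ'‖ ^ 2` supplied by polarization.
  have hmain : L / 2 * E ^ 2 + S ^ 2 / (2 * L) + τ * Q ^ 2 ≤ L / 2 * E' ^ 2 + τ * (G * Q) := by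
    have h1 := hΘ eΘ
    have h2 := hΘq eq
    rw [real_inner_self_eq_norm_sq] at h2
    rw [real_inner_comm eΘ (D eq)] at h1
    have h3 : ρ eΘ = ρ eΘ' + ρ (eΘ - eΘ') := by rw [map_sub]; ring
    have h4 : inner ℝ (eΘ - eΘ') eΘ = (E ^ 2 - E' ^ 2 + ‖eΘ - eΘ'‖ ^ 2) / 2 := by
      have h5 := norm_sub_sq_real eΘ eΘ'
      rw [inner_sub_left, real_inner_self_eq_norm_sq, real_inner_comm]
      rw [h5]
      ring
    have h6 : -(S ^ 2 / (2 * L) + L / 2 * ‖eΘ - eΘ'‖ ^ 2) ≤ ρ (eΘ - eΘ') := by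
      have h7 := (abs_le.1 (hρ (eΘ - eΘ'))).1
      have e : S ^ 2 / (2 * L) + L / 2 * ‖eΘ - eΘ'‖ ^ 2 - S * ‖eΘ - eΘ'‖
          = (S - L * ‖eΘ - eΘ'‖) ^ 2 / (2 * L) := by
        field_simp
        ring
      have : 0 ≤ (S - L * ‖eΘ - eΘ'‖) ^ 2 / (2 * L) := by positivity
      linarith
    have h8 : S ^ 2 / L ≤ ρ eΘ' := by
      rw [div_le_iff₀ hL]; linarith
    have h9 : S ^ 2 / L = S ^ 2 / (2 * L) + S ^ 2 / (2 * L) := by field_simp; ring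
    have h10 : γ eq ≤ G * Q := (le_abs_self _).trans (hγ eq)
    have h11 := mul_le_mul_of_nonneg_left h10 hτ.le
    have h12 : inner ℝ eΘ (D eq) = Q ^ 2 - γ eq := by linarith
    rw [h12, h4, h3] at h1
    linarith
  -- The three summands of `K - C₃` are exactly those of this expansion.
  have hG2 : 2 * G ^ 2 ≤ (B.K C - B.C3 C) * S ^ 2 := by
    have h1 : 2 * G ^ 2 ≤ 4 * (B.Lf1 : ℝ) ^ 2 * S ^ 2 + 8 * (B.Lfw : ℝ) ^ 2 * (B.Mu : ℝ) ^ 2 * S ^ 2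
        + 8 * ((B.Mfw : ℝ) ^ 2 * U ^ 2) := by
      have e : G = B.Lf1 * S + (B.Lfw * B.Mu * S + B.Mfw * U) := by rw [hG, hn]; ring
      rw [e]
      refine (two_mul_sq_add_add_le (B.Lf1 * S) (B.Lfw * B.Mu * S) (B.Mfw * U)).trans (le_of_eq ?_)
      ring
    have h2 : (B.K C - B.C3 C) * S ^ 2 = 4 * (B.Lf1 : ℝ) ^ 2 * S ^ 2
        + 8 * (B.Lfw : ℝ) ^ 2 * (B.Mu : ℝ) ^ 2 * S ^ 2
        + 8 * ((B.Mfw : ℝ) ^ 2 * (B.C1 C * S ^ 2)) := by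
      rw [Consts.K]; ring
    linarith
  exact contraction_of_energy hC hL hτ hq hmain hG2

end Mixed

/-! ### The discrete spaces as finite dimensional vector spaces -/

theorem HasWeakDiv.add {d : ℕ} {Ω : Set (Pt d)} {v v' : L2v Ω} {g g' : L2 Ω}
    (h : HasWeakDiv v g) (h' : HasWeakDiv v' g') : HasWeakDiv (v + v') (g + g') := by
  intro φ h1 h2 h3
  have hφ1 : ContDiff ℝ 1 φ := h1.of_le (by exact_mod_cast le_top)
  have hφ : MemLp φ 2 (volume.restrict Ω) := h1.continuous.memLp_of_hasCompactSupport h2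
  have i1 : Integrable (fun x => g x * φ x) (volume.restrict Ω) := (Lp.memLp g).integrable_mul hφ
  have i2 : Integrable (fun x => g' x * φ x) (volume.restrict Ω) :=
    (Lp.memLp g').integrable_mul hφ
  have e1 : ∫ x in Ω, fderiv ℝ φ x ((v + v') x)
      = (∫ x in Ω, fderiv ℝ φ x (v x)) + ∫ x in Ω, fderiv ℝ φ x (v' x) := by
    rw [← integral_add (integrable_fderiv_apply hφ1 h2 v) (integrable_fderiv_apply hφ1 h2 v')]
    refine integral_congr_ae ?_
    filter_upwards [Lp.coeFn_add v v'] with x hx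
    rw [hx, Pi.add_apply, map_add]
  have e2 : ∫ x in Ω, (g + g') x * φ x = (∫ x in Ω, g x * φ x) + ∫ x in Ω, g' x * φ x := by
    rw [← integral_add i1 i2]
    refine integral_congr_ae ?_
    filter_upwards [Lp.coeFn_add g g'] with x hx
    rw [hx, Pi.add_apply, add_mul]
  rw [e1, e2, h φ h1 h2 h3, h' φ h1 h2 h3]
  ring

theorem HasWeakDiv.smul {d : ℕ} {Ω : Set (Pt d)} {v : L2v Ω} {g : L2 Ω} (h : HasWeakDiv v g)
    (a : ℝ) : HasWeakDiv (a • v) (a • g) := by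
  intro φ h1 h2 h3
  have e1 : ∫ x in Ω, fderiv ℝ φ x ((a • v) x) = a * ∫ x in Ω, fderiv ℝ φ x (v x) := by
    rw [← integral_const_mul]
    refine integral_congr_ae ?_
    filter_upwards [Lp.coeFn_smul a v] with x hx
    rw [hx, Pi.smul_apply, map_smul, smul_eq_mul]
  have e2 : ∫ x in Ω, (a • g) x * φ x = a * ∫ x in Ω, g x * φ x := by
    rw [← integral_const_mul]
    refine integral_congr_ae ?_
    filter_upwards [Lp.coeFn_smul a g] with x hx
    rw [hx, Pi.smul_apply, smul_eq_mul, mul_assoc]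
  rw [e1, e2, h φ h1 h2 h3]
  ring

theorem HasWeakDiv.zero {d : ℕ} {Ω : Set (Pt d)} : HasWeakDiv (0 : L2v Ω) (0 : L2 Ω) := by
  intro φ _ _ _
  have e1 : ∫ x in Ω, fderiv ℝ φ x ((0 : L2v Ω) x) = ∫ _x in Ω, (0 : ℝ) := by
    refine integral_congr_ae ?_
    filter_upwards [Lp.coeFn_zero (Pt d) 2 (volume.restrict Ω)] with x hx
    rw [hx, Pi.zero_apply, map_zero]
  have e2 : ∫ x in Ω, (0 : L2 Ω) x * φ x = ∫ _x in Ω, (0 : ℝ) := by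
    refine integral_congr_ae ?_
    filter_upwards [Lp.coeFn_zero ℝ 2 (volume.restrict Ω)] with x hx
    rw [hx, Pi.zero_apply, zero_mul]
  rw [e1, e2]
  simp

theorem hasWeakDiv_weakDiv {d : ℕ} {Ω : Set (Pt d)} {v : L2v Ω} (hv : v ∈ Hdiv Ω) :
    HasWeakDiv v (weakDiv v) := by
  have hex : ∃ g : L2 Ω, HasWeakDiv v g := hv
  rw [weakDiv, dif_pos hex]
  exact hex.choose_spec

namespace Mesh

variable {d : ℕ} {Ω : Set (Pt d)} (𝒯 : Mesh Ω)

/-- The piecewise constant functions as a vector space. -/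
def Wsub : Submodule ℝ (L2 Ω) where
  carrier := 𝒯.W
  add_mem' := by
    intro w w' hw hw' T hT
    obtain ⟨c, hc⟩ := hw T hT
    obtain ⟨c', hc'⟩ := hw' T hT
    refine ⟨c + c', ?_⟩
    filter_upwards [hc, hc', Lp.coeFn_add w w'] with x h1 h2 h3 hx
    rw [h3, Pi.add_apply, h1 hx, h2 hx]
  zero_mem' := by
    intro T _
    refine ⟨0, ?_⟩
    filter_upwards [Lp.coeFn_zero ℝ 2 (volume.restrict Ω)] with x hx _
    rw [hx, Pi.zero_apply]
  smul_mem' := by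
    intro a w hw T hT
    obtain ⟨c, hc⟩ := hw T hT
    refine ⟨a * c, ?_⟩
    filter_upwards [hc, Lp.coeFn_smul a w] with x h1 h2 hx
    rw [h2, Pi.smul_apply, h1 hx, smul_eq_mul]

/-- The Raviart–Thomas fields as a vector space. -/
def Vsub : Submodule ℝ (L2v Ω) where
  carrier := 𝒯.V
  add_mem' := by
    rintro v v' ⟨⟨g, hg⟩, hv⟩ ⟨⟨g', hg'⟩, hv'⟩
    refine ⟨⟨g + g', hg.add hg'⟩, fun T hT => ?_⟩
    obtain ⟨a, b, hab⟩ := hv T hT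
    obtain ⟨a', b', hab'⟩ := hv' T hT
    refine ⟨a + a', b + b', ?_⟩
    filter_upwards [hab, hab', Lp.coeFn_add v v'] with x h1 h2 h3 hx
    rw [h3, Pi.add_apply, h1 hx, h2 hx]
    module
  zero_mem' := by
    refine ⟨⟨0, HasWeakDiv.zero⟩, fun T _ => ⟨0, 0, ?_⟩⟩
    filter_upwards [Lp.coeFn_zero (Pt d) 2 (volume.restrict Ω)] with x hx _
    rw [hx, Pi.zero_apply]
    module
  smul_mem' := by
    rintro r v ⟨⟨g, hg⟩, hv⟩
    refine ⟨⟨r • g, hg.smul r⟩, fun T hT => ?_⟩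
    obtain ⟨a, b, hab⟩ := hv T hT
    refine ⟨r • a, r * b, ?_⟩
    filter_upwards [hab, Lp.coeFn_smul r v] with x h1 h2 hx
    rw [h2, Pi.smul_apply, h1 hx]
    module

theorem weakDiv_add (hΩ : IsOpen Ω) {v v' : L2v Ω} (hv : v ∈ Hdiv Ω) (hv' : v' ∈ Hdiv Ω) :
    weakDiv (v + v') = weakDiv v + weakDiv v' :=
  ((hasWeakDiv_weakDiv hv).add (hasWeakDiv_weakDiv hv')).weakDiv_eq hΩ

theorem weakDiv_smul (hΩ : IsOpen Ω) {v : L2v Ω} (hv : v ∈ Hdiv Ω) (a : ℝ) :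
    weakDiv (a • v) = a • weakDiv v :=
  ((hasWeakDiv_weakDiv hv).smul a).weakDiv_eq hΩ

theorem weakDiv_mem (hd : 1 ≤ d) (hreg : interior (closure Ω) = Ω) {v : L2v Ω} (hv : v ∈ 𝒯.V) :
    weakDiv v ∈ 𝒯.W := by
  rw [𝒯.mem_W_iff hreg]
  rw [𝒯.mem_V_iff hreg] at hv
  intro T hT
  obtain ⟨a, b, hab⟩ := hv.2 T hT
  exact ⟨d * b, 𝒯.weakDiv_cell hd hreg (hasWeakDiv_weakDiv hv.1) hT hab⟩

/-- The divergence as a linear map from the Raviart–Thomas fields to the piecewise constants. -/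
def divL (hd : 1 ≤ d) (hreg : interior (closure Ω) = Ω) : 𝒯.Vsub →ₗ[ℝ] 𝒯.Wsub where
  toFun v := ⟨weakDiv v.1, 𝒯.weakDiv_mem hd hreg v.2⟩
  map_add' v v' := Subtype.ext
    (weakDiv_add (by rw [← hreg]; exact isOpen_interior) v.2.1 v'.2.1)
  map_smul' a v := Subtype.ext
    (weakDiv_smul (by rw [← hreg]; exact isOpen_interior) v.2.1 a)

/-- A field is determined a.e. by its coefficients on the finitely many cells, so the space lies in
the range of a linear map from these coefficients. -/
theorem finiteDimensional_Vsub (hreg : interior (closure Ω) = Ω) (hbdd : Bornology.IsBounded Ω) :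
    FiniteDimensional ℝ 𝒯.Vsub := by
  classical
  have hex := fun ab : 𝒯.cellsF → Pt d × ℝ => 𝒯.exists_piecewise hreg hbdd
    (fun T x => if hT : T ∈ 𝒯.cellsF then (ab ⟨T, hT⟩).1 + (ab ⟨T, hT⟩).2 • x else 0)
    (fun T => by split_ifs <;> fun_prop)
  choose Ψ hΨ using hex
  have hΨ' : ∀ ab (T : 𝒯.cellsF), ∀ᵐ x ∂(volume.restrict (convexHull ℝ (T.1 : Set (Pt d)))),
      Ψ ab x = (ab T).1 + (ab T).2 • x := fun ab T => by
    filter_upwards [hΨ ab T.1 (𝒯.mem_cellsF.1 T.2)] with x hx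
    rw [hx, dif_pos T.2]
  have hext : ∀ v v' : L2v Ω, (∀ T : 𝒯.cellsF,
      ∀ᵐ x ∂(volume.restrict (convexHull ℝ (T.1 : Set (Pt d)))), v x = v' x) → v = v' :=
    fun v v' h => Lp.ext ((𝒯.ae_iff hreg).2 fun T hT => h ⟨T, 𝒯.mem_cellsF.2 hT⟩)
  have hcell : ∀ {P : Pt d → Prop} (T : 𝒯.cellsF), (∀ᵐ x ∂(volume.restrict Ω), P x) →
      ∀ᵐ x ∂(volume.restrict (convexHull ℝ (T.1 : Set (Pt d)))), P x := fun T h =>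
    (𝒯.ae_iff hreg).1 h T.1 (𝒯.mem_cellsF.1 T.2)
  let Ψl : (𝒯.cellsF → Pt d × ℝ) →ₗ[ℝ] L2v Ω :=
    { toFun := Ψ
      map_add' := fun ab ab' => hext _ _ fun T => by
        filter_upwards [hΨ' (ab + ab') T, hΨ' ab T, hΨ' ab' T,
          hcell T (Lp.coeFn_add (Ψ ab) (Ψ ab'))] with x h1 h2 h3 h4
        rw [h1, h4]
        simp only [Pi.add_apply, h2, h3, Prod.fst_add, Prod.snd_add]
        module
      map_smul' := fun r ab => hext _ _ fun T => by
        filter_upwards [hΨ' (r • ab) T, hΨ' ab T, hcell T (Lp.coeFn_smul r (Ψ ab))]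
          with x h1 h2 h3
        rw [h1, RingHom.id_apply, h3]
        simp only [Pi.smul_apply, h2, Prod.smul_fst, Prod.smul_snd]
        module }
  have hle : 𝒯.Vsub ≤ LinearMap.range Ψl := by
    intro v hv
    have hv' := ((𝒯.mem_V_iff hreg).1 hv).2
    choose a b hab using fun T : 𝒯.cellsF => hv' T.1 (𝒯.mem_cellsF.1 T.2)
    refine ⟨fun T => (a T, b T), hext _ _ fun T => ?_⟩
    filter_upwards [hΨ' (fun T => (a T, b T)) T, hab T] with x h1 h2
    rw [h2]
    exact h1
  exact Submodule.finiteDimensional_of_le hle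

end Mesh

/-! ### Nonlinear superposition operators on `L²` -/

/-- Continuous and bounded. -/
def BddCont {E : Type*} [NormedAddCommGroup E] (f : ℝ → E) : Prop :=
  Continuous f ∧ ∃ M, ∀ y, ‖f y‖ ≤ M

open Classical in
/-- The superposition `f(Θ)`. -/
def nem {d : ℕ} {Ω : Set (Pt d)} {E : Type*} [NormedAddCommGroup E] (f : ℝ → E) (Θ : L2 Ω) :
    Lp E 2 (volume.restrict Ω) :=
  if h : MemLp (fun x => f (Θ x)) 2 (volume.restrict Ω) then h.toLp _ else 0

open Classical in
/-- The product `f(Θ) v`. -/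
def nemMul {d : ℕ} {Ω : Set (Pt d)} (f : ℝ → ℝ) (Θ : L2 Ω) (v : L2v Ω) : L2v Ω :=
  if h : MemLp (fun x => f (Θ x) • v x) 2 (volume.restrict Ω) then h.toLp _ else 0

section Nem

variable {d : ℕ} {Ω : Set (Pt d)}

theorem nem_coe (hbdd : Bornology.IsBounded Ω) {E : Type*} [NormedAddCommGroup E] {f : ℝ → E}
    (hf : BddCont f) (Θ : L2 Ω) : ∀ᵐ x ∂(volume.restrict Ω), nem f Θ x = f (Θ x) := by
  have := isFiniteMeasure_restrict hbdd
  obtain ⟨hc, M, hM⟩ := hf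
  have h : MemLp (fun x => f (Θ x)) 2 (volume.restrict Ω) :=
    MemLp.of_bound (hc.comp_aestronglyMeasurable (Lp.memLp Θ).1) M (ae_of_all _ fun x => hM _)
  rw [nem, dif_pos h]
  exact h.coeFn_toLp

theorem nemMul_coe {f : ℝ → ℝ} (hf : BddCont f) (Θ : L2 Ω) (v : L2v Ω) :
    ∀ᵐ x ∂(volume.restrict Ω), nemMul f Θ v x = f (Θ x) • v x := by
  obtain ⟨hc, M, hM⟩ := hf
  have h : MemLp (fun x => f (Θ x) • v x) 2 (volume.restrict Ω) := by
    refine (Lp.memLp v).of_le_mul (c := M)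
      ((hc.comp_aestronglyMeasurable (Lp.memLp Θ).1).smul (Lp.memLp v).1) (ae_of_all _ fun x => ?_)
    rw [norm_smul]
    exact mul_le_mul_of_nonneg_right (hM _) (norm_nonneg _)
  rw [nemMul, dif_pos h]
  exact h.coeFn_toLp

theorem nemMul_add {f : ℝ → ℝ} (hf : BddCont f) (Θ : L2 Ω) (v v' : L2v Ω) :
    nemMul f Θ (v + v') = nemMul f Θ v + nemMul f Θ v' := by
  refine Lp.ext ?_
  filter_upwards [nemMul_coe hf Θ (v + v'), nemMul_coe hf Θ v, nemMul_coe hf Θ v',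
    Lp.coeFn_add v v', Lp.coeFn_add (nemMul f Θ v) (nemMul f Θ v')] with x h1 h2 h3 h4 h5
  rw [h1, h5, Pi.add_apply, h2, h3, h4, Pi.add_apply, smul_add]

theorem nemMul_smul {f : ℝ → ℝ} (hf : BddCont f) (Θ : L2 Ω) (a : ℝ) (v : L2v Ω) :
    nemMul f Θ (a • v) = a • nemMul f Θ v := by
  refine Lp.ext ?_
  filter_upwards [nemMul_coe hf Θ (a • v), nemMul_coe hf Θ v, Lp.coeFn_smul a v,
    Lp.coeFn_smul a (nemMul f Θ v)] with x h1 h2 h3 h4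
  rw [h1, h4, Pi.smul_apply, h2, h3, Pi.smul_apply, smul_comm]

theorem norm_nemMul_le {f : ℝ → ℝ} (hf : BddCont f) {M : ℝ} (hM : ∀ y, |f y| ≤ M) (Θ : L2 Ω)
    (v : L2v Ω) : ‖nemMul f Θ v‖ ≤ M * ‖v‖ := by
  refine Lp.norm_le_mul_norm_of_ae_le_mul ?_
  filter_upwards [nemMul_coe hf Θ v] with x h1
  rw [h1, norm_smul]
  exact mul_le_mul_of_nonneg_right (hM _) (norm_nonneg _)

theorem inner_eq_integral_mul (f g : L2 Ω) : inner ℝ f g = ∫ x in Ω, f x * g x := by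
  rw [L2.inner_def]
  refine integral_congr_ae (ae_of_all _ fun x => ?_)
  simp [mul_comm]

theorem inner_nemMul {f : ℝ → ℝ} (hf : BddCont f) (Θ : L2 Ω) (u v : L2v Ω) :
    inner ℝ (nemMul f Θ u) v = ∫ x in Ω, inner ℝ (f (Θ x) • u x) (v x) := by
  rw [L2.inner_def]
  refine integral_congr_ae ?_
  filter_upwards [nemMul_coe hf Θ u] with x h1
  rw [h1]

theorem inner_nem (hbdd : Bornology.IsBounded Ω) {f : ℝ → Pt d} (hf : BddCont f) (Θ : L2 Ω)
    (v : L2v Ω) : inner ℝ (nem f Θ) v = ∫ x in Ω, inner ℝ (f (Θ x)) (v x) := by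
  rw [L2.inner_def]
  refine integral_congr_ae ?_
  filter_upwards [nem_coe hbdd hf Θ] with x h1
  rw [h1]

theorem inner_nem_real (hbdd : Bornology.IsBounded Ω) {f : ℝ → ℝ} (hf : BddCont f) (Θ w : L2 Ω) :
    inner ℝ (nem f Θ) w = ∫ x in Ω, f (Θ x) * w x := by
  rw [inner_eq_integral_mul]
  refine integral_congr_ae ?_
  filter_upwards [nem_coe hbdd hf Θ] with x h1
  rw [h1]

theorem le_inner_nemMul {f : ℝ → ℝ} (hf : BddCont f) {α : ℝ} (hα : ∀ y, α ≤ f y) (Θ : L2 Ω)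
    (v : L2v Ω) : α * ‖v‖ ^ 2 ≤ inner ℝ (nemMul f Θ v) v := by
  rw [norm_sq_eq_integral, ← integral_const_mul, L2.inner_def]
  refine integral_mono_ae ((integrable_norm_sq v).const_mul α) (L2.integrable_inner _ _) ?_
  filter_upwards [nemMul_coe hf Θ v] with x h1
  rw [h1, inner_smul_left, real_inner_self_eq_norm_sq]
  exact mul_le_mul_of_nonneg_right (hα _) (sq_nonneg _)

theorem norm_nem_sub_le (hbdd : Bornology.IsBounded Ω) {E : Type*} [NormedAddCommGroup E]
    {f : ℝ → E} {s : ℝ → ℝ} (hs : BddCont s) (hfs : BddCont (f ∘ s)) {K : ℝ≥0}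
    (hf : LipschitzWith K f) (Θ Θ' : L2 Ω) :
    ‖nem (f ∘ s) Θ - nem (f ∘ s) Θ'‖ ≤ K * ‖nem s Θ - nem s Θ'‖ := by
  refine Lp.norm_le_mul_norm_of_ae_le_mul ?_
  filter_upwards [nem_coe hbdd hfs Θ, nem_coe hbdd hfs Θ', nem_coe hbdd hs Θ, nem_coe hbdd hs Θ',
    Lp.coeFn_sub (nem (f ∘ s) Θ) (nem (f ∘ s) Θ'), Lp.coeFn_sub (nem s Θ) (nem s Θ')]
    with x h1 h2 h3 h4 h5 h6
  rw [h5, h6, Pi.sub_apply, Pi.sub_apply, h1, h2, h3, h4]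
  exact hf.norm_sub_le _ _

/-- This is where the `L^∞` bound on the flux enters: a difference of coefficients is controlled
only in `L²`, so its factor must be bounded. -/
theorem norm_nemMul_sub_le (hbdd : Bornology.IsBounded Ω) {f s : ℝ → ℝ} (hs : BddCont s)
    (hfs : BddCont (f ∘ s)) {K : ℝ≥0} (hf : LipschitzWith K f) (Θ Θ' : L2 Ω) {u : L2v Ω} {M : ℝ}
    (hu : ∀ᵐ x ∂(volume.restrict Ω), ‖u x‖ ≤ M) :
    ‖nemMul (f ∘ s) Θ u - nemMul (f ∘ s) Θ' u‖ ≤ M * K * ‖nem s Θ - nem s Θ'‖ := by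
  refine Lp.norm_le_mul_norm_of_ae_le_mul ?_
  filter_upwards [nemMul_coe hfs Θ u, nemMul_coe hfs Θ' u, nem_coe hbdd hs Θ, nem_coe hbdd hs Θ',
    Lp.coeFn_sub (nemMul (f ∘ s) Θ u) (nemMul (f ∘ s) Θ' u), Lp.coeFn_sub (nem s Θ) (nem s Θ'), hu]
    with x h1 h2 h3 h4 h5 h6 h7
  rw [h5, h6, Pi.sub_apply, Pi.sub_apply, h1, h2, h3, h4, ← sub_smul, norm_smul]
  calc _ ≤ (K * ‖s (Θ x) - s (Θ' x)‖) * M :=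
        mul_le_mul (hf.norm_sub_le _ _) h7 (norm_nonneg _) (by positivity)
    _ = _ := by ring

theorem satDistSq_eq (hbdd : Bornology.IsBounded Ω) {c : Coeffs d} (hs : BddCont c.s)
    (Θ Θ' : L2 Ω) : satDistSq c Θ Θ' = ‖nem c.s Θ - nem c.s Θ'‖ ^ 2 := by
  rw [norm_sq_eq_integral, satDistSq]
  refine integral_congr_ae ?_
  filter_upwards [nem_coe hbdd hs Θ, nem_coe hbdd hs Θ', Lp.coeFn_sub (nem c.s Θ) (nem c.s Θ')]
    with x h1 h2 h3
  rw [h3, Pi.sub_apply, h1, h2, Real.norm_eq_abs, sq_abs]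

/-- For a monotone function the product of the two increments is nonnegative, so the Lipschitz bound
may be multiplied by the increment of `s` without losing the sign. -/
theorem norm_nem_sub_sq_le (hbdd : Bornology.IsBounded Ω) {s : ℝ → ℝ} (hs : BddCont s)
    (hmono : Monotone s) {K : ℝ≥0} (hlip : LipschitzWith K s) (Θ Θ' : L2 Ω) :
    ‖nem s Θ - nem s Θ'‖ ^ 2 ≤ K * inner ℝ (nem s Θ - nem s Θ') (Θ - Θ') := by
  rw [norm_sq_eq_integral, L2.inner_def, ← integral_const_mul]
  refine integral_mono_ae (integrable_norm_sq _) ((L2.integrable_inner _ _).const_mul _) ?_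
  filter_upwards [nem_coe hbdd hs Θ, nem_coe hbdd hs Θ', Lp.coeFn_sub (nem s Θ) (nem s Θ'),
    Lp.coeFn_sub Θ Θ'] with x h1 h2 h3 h4
  rw [h3, h4, Pi.sub_apply, Pi.sub_apply, h1, h2, Real.norm_eq_abs]
  have hl := hlip.norm_sub_le (Θ x) (Θ' x)
  rw [Real.norm_eq_abs, Real.norm_eq_abs] at hl
  have hprod : inner ℝ (s (Θ x) - s (Θ' x)) (Θ x - Θ' x)
      = |s (Θ x) - s (Θ' x)| * |Θ x - Θ' x| := by
    rw [← abs_mul]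
    have h5 : 0 ≤ (s (Θ x) - s (Θ' x)) * (Θ x - Θ' x) := by
      rcases le_total (Θ x) (Θ' x) with h | h
      · exact mul_nonneg_of_nonpos_of_nonpos (sub_nonpos.2 (hmono h)) (sub_nonpos.2 h)
      · exact mul_nonneg (sub_nonneg.2 (hmono h)) (sub_nonneg.2 h)
    rw [abs_of_nonneg h5]
    simp [mul_comm]
  rw [hprod]
  nlinarith [mul_le_mul_of_nonneg_left hl (abs_nonneg (s (Θ x) - s (Θ' x)))]

end Nem

variable {d : ℕ} {Ω : Set (Pt d)}

/-! ### The discrete problems in terms of inner products -/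

namespace Coeffs.Admissible

variable {c : Coeffs d} {B : Consts}

theorem bddCont_s (hc : c.Admissible B) : BddCont c.s := by
  refine ⟨hc.s_lip.continuous, 1, fun y => ?_⟩
  rw [Real.norm_eq_abs, abs_of_nonneg (hc.s_mem y).1]
  exact (hc.s_mem y).2

/-- The saturation takes values in the compact interval `[0, 1]`, so continuity of `f` alone makes
the composition bounded. -/
theorem bddCont_comp (hc : c.Admissible B) {E : Type*} [NormedAddCommGroup E] {f : ℝ → E}
    (hf : Continuous f) : BddCont (f ∘ c.s) := by
  obtain ⟨M, hM⟩ := isCompact_Icc.exists_bound_of_continuousOn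
    (hf.continuousOn (s := Set.Icc (0 : ℝ) 1))
  exact ⟨hf.comp hc.s_lip.continuous, M, fun y => hM _ (hc.s_mem y)⟩

theorem aUp_pos (hc : c.Admissible B) : 0 < B.aUp :=
  hc.aLow_pos.trans_le ((hc.a_ge 0).trans (hc.a_le 0))

end Coeffs.Admissible

/-- One step of the `L`-scheme, written with the inner products of `L²`. -/
theorem solvesLStep_iff (hbdd : Bornology.IsBounded Ω) {𝒯 : Mesh Ω} {c : Coeffs d} {B : Consts}
    (hc : c.Admissible B) {L τ : ℝ} {Θprev Θold : L2 Ω} {X : State Ω} :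
    SolvesLStep 𝒯 c L τ Θprev Θold X ↔ X.Mem 𝒯 ∧
      (∀ w ∈ 𝒯.W, L * inner ℝ (X.Θ - Θold) w + inner ℝ (nem c.s Θold) w
        + τ * inner ℝ (weakDiv X.q) w = inner ℝ (nem c.s Θprev) w) ∧
      (∀ v ∈ 𝒯.V, inner ℝ X.q v - inner ℝ X.Θ (weakDiv v)
        - inner ℝ (nemMul (c.fw ∘ c.s) Θold X.u) v = inner ℝ (nem (c.f1 ∘ c.s) Θold) v) ∧
      (∀ w ∈ 𝒯.W, inner ℝ (weakDiv X.u) w = inner ℝ (nem (c.f2 ∘ c.s) Θold) w) ∧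
      (∀ v ∈ 𝒯.V, inner ℝ (nemMul (c.a ∘ c.s) Θold X.u) v - inner ℝ X.p (weakDiv v)
        + inner ℝ (nem (c.f3 ∘ c.s) Θold) v = 0) := by
  have hs := hc.bddCont_s
  have key : ∀ w : L2 Ω, ∫ x in Ω, (L * (X.Θ x - Θold x) + c.s (Θold x)) * w x
      = L * inner ℝ (X.Θ - Θold) w + inner ℝ (nem c.s Θold) w := fun w => by
    rw [← real_inner_smul_left, ← inner_add_left, inner_eq_integral_mul]
    refine integral_congr_ae ?_
    filter_upwards [nem_coe hbdd hs Θold, Lp.coeFn_sub X.Θ Θold,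
      Lp.coeFn_smul L (X.Θ - Θold), Lp.coeFn_add (L • (X.Θ - Θold)) (nem c.s Θold)]
      with x h1 h2 h3 h4
    rw [h4, Pi.add_apply, h3, Pi.smul_apply, h2, Pi.sub_apply, h1, smul_eq_mul]
  simp only [SolvesLStep, key, inner_nem_real hbdd hs,
    inner_nem_real hbdd (hc.bddCont_comp hc.f2_lip.continuous),
    inner_nem hbdd (hc.bddCont_comp hc.f1_lip.continuous),
    inner_nem hbdd (hc.bddCont_comp hc.f3_lip.continuous),
    inner_nemMul (hc.bddCont_comp hc.fw_lip.continuous),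
    inner_nemMul (hc.bddCont_comp hc.a_lip.continuous), inner_eq_integral_mul (weakDiv _),
    inner_eq_integral_mul X.Θ, inner_eq_integral_mul X.p, L2.inner_def X.q, Function.comp_apply]

/-- A fixed point of the `L`-scheme solves the nonlinear problem. -/
theorem SolvesLStep.solvesNonlinear (hbdd : Bornology.IsBounded Ω) {𝒯 : Mesh Ω} {c : Coeffs d}
    {B : Consts} (hc : c.Admissible B) {L τ : ℝ} {Θprev : L2 Ω} {X : State Ω}
    (h : SolvesLStep 𝒯 c L τ Θprev X.Θ X) : SolvesNonlinear 𝒯 c τ Θprev X := by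
  have hs := hc.bddCont_s
  refine ⟨h.1, fun w hw => ?_, h.2.2⟩
  have h1 := ((solvesLStep_iff hbdd hc).1 h).2.1 w hw
  have h2 : ∫ x in Ω, (c.s (X.Θ x) - c.s (Θprev x)) * w x
      = inner ℝ (nem c.s X.Θ - nem c.s Θprev) w := by
    rw [inner_eq_integral_mul]
    refine integral_congr_ae ?_
    filter_upwards [nem_coe hbdd hs X.Θ, nem_coe hbdd hs Θprev,
      Lp.coeFn_sub (nem c.s X.Θ) (nem c.s Θprev)] with x h1 h2 h3
    rw [h3, Pi.sub_apply, h1, h2]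
  rw [sub_self, inner_zero_left, mul_zero, zero_add] at h1
  rw [h2, inner_sub_left, ← inner_eq_integral_mul]
  linarith

/-- The bilinear form `⟨f(Θ) u, v⟩` on a subspace. -/
def nemForm {f : ℝ → ℝ} (hf : BddCont f) (Θ : L2 Ω) (V : Submodule ℝ (L2v Ω)) :
    V →ₗ[ℝ] V →ₗ[ℝ] ℝ :=
  LinearMap.mk₂ ℝ (fun u v => inner ℝ (nemMul f Θ u.1) v.1)
    (fun u u' v => by
      change inner ℝ (nemMul f Θ (u.1 + u'.1)) v.1 = _
      rw [nemMul_add hf, inner_add_left])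
    (fun a u v => by
      change inner ℝ (nemMul f Θ (a • u.1)) v.1 = _
      rw [nemMul_smul hf, real_inner_smul_left]; rfl)
    (fun u v v' => inner_add_right _ _ _)
    (fun a u v => real_inner_smul_right _ _ _)

set_option maxHeartbeats 800000 in
/-- Every step of the `L`-scheme is uniquely solvable. -/
theorem existsUnique_solvesLStep (hd : 1 ≤ d) (hbdd : Bornology.IsBounded Ω)
    (hreg : interior (closure Ω) = Ω) {𝒯 : Mesh Ω}
    (hdiv : ∀ w ∈ 𝒯.W, ∃ v ∈ 𝒯.V, weakDiv v = w) {c : Coeffs d} {B : Consts}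
    (hc : c.Admissible B) {L τ : ℝ} (hL : 0 < L) (hτ : 0 < τ) (Θprev Θold : L2 Ω) :
    ∃! X : State Ω, SolvesLStep 𝒯 c L τ Θprev Θold X := by
  have hfinV := 𝒯.finiteDimensional_Vsub hreg hbdd
  have hD : Function.Surjective (𝒯.divL hd hreg) := fun w => by
    obtain ⟨v, hv, hvw⟩ := hdiv w.1 w.2
    exact ⟨⟨v, hv⟩, Subtype.ext hvw⟩
  have hfinW : FiniteDimensional ℝ 𝒯.Wsub := Module.Finite.of_surjective _ hD
  have ha := hc.bddCont_comp hc.a_lip.continuous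
  let l (z : L2 Ω) : 𝒯.Wsub →ₗ[ℝ] ℝ := (innerₗ (L2 Ω) z).comp 𝒯.Wsub.subtype
  let m (z : L2v Ω) : 𝒯.Vsub →ₗ[ℝ] ℝ := (innerₗ (L2v Ω) z).comp 𝒯.Vsub.subtype
  obtain ⟨⟨Θ, q, p, u⟩, hx, huniq⟩ := existsUnique_mixed hD (A := nemForm ha Θold 𝒯.Vsub)
    (N := nemForm (hc.bddCont_comp hc.fw_lip.continuous) Θold 𝒯.Vsub) hc.aLow_pos
    (fun v => le_inner_nemMul ha (fun y => hc.a_ge _) Θold v.1) hL hτ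
    (l (L • Θold - nem c.s Θold + nem c.s Θprev)) (l (nem (c.f2 ∘ c.s) Θold))
    (m (nem (c.f1 ∘ c.s) Θold)) (m (-nem (c.f3 ∘ c.s) Θold))
  have hl1 : ∀ w : 𝒯.Wsub, l (L • Θold - nem c.s Θold + nem c.s Θprev) w
      = L * inner ℝ Θold w.1 - inner ℝ (nem c.s Θold) w.1 + inner ℝ (nem c.s Θprev) w.1 :=
    fun w => by
      change inner ℝ (L • Θold - nem c.s Θold + nem c.s Θprev) w.1 = _
      rw [inner_add_left, inner_sub_left, real_inner_smul_left]
  have hm4 : ∀ v : 𝒯.Vsub, m (-nem (c.f3 ∘ c.s) Θold) v = -inner ℝ (nem (c.f3 ∘ c.s) Θold) v.1 :=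
    fun v => inner_neg_left (𝕜 := ℝ) (nem (c.f3 ∘ c.s) Θold) v.1
  refine ⟨⟨Θ, q, p, u⟩, (solvesLStep_iff hbdd hc).2 ⟨⟨Θ.2, q.2, p.2, u.2⟩, fun w hw => ?_,
    fun v hv => hx.2.1 ⟨v, hv⟩, fun w hw => hx.2.2.1 ⟨w, hw⟩, fun v hv => ?_⟩, fun X hX => ?_⟩
  · have h := hx.1 ⟨w, hw⟩
    rw [hl1] at h
    change L * inner ℝ Θ.1 w + τ * inner ℝ (weakDiv q.1) w = _ at h
    rw [inner_sub_left]
    linarith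
  · have h := hx.2.2.2 ⟨v, hv⟩
    rw [hm4] at h
    change inner ℝ (nemMul (c.a ∘ c.s) Θold u.1) v - inner ℝ p.1 (weakDiv v) = _ at h
    linarith
  · obtain ⟨⟨m1, m2, m3, m4⟩, h1, h2, h3, h4⟩ := (solvesLStep_iff hbdd hc).1 hX
    have h := huniq (⟨X.Θ, m1⟩, ⟨X.q, m2⟩, ⟨X.p, m3⟩, ⟨X.u, m4⟩)
      ⟨fun w => ?_, fun v => h2 v.1 v.2, fun w => h3 w.1 w.2, fun v => ?_⟩
    · simp only [Prod.mk.injEq] at h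
      obtain ⟨e1, e2, e3, e4⟩ := h
      exact State.ext (congrArg Subtype.val e1) (congrArg Subtype.val e2)
        (congrArg Subtype.val e3) (congrArg Subtype.val e4)
    · rw [hl1]
      change L * inner ℝ X.Θ w.1 + τ * inner ℝ (weakDiv X.q) w.1 = _
      have := h1 w.1 w.2
      rw [inner_sub_left] at this
      linarith
    · rw [hm4]
      change inner ℝ (nemMul (c.a ∘ c.s) Θold X.u) v.1 - inner ℝ X.p (weakDiv v.1) = _
      linarith [h4 v.1 v.2]

set_option maxHeartbeats 800000 in
/-- Two steps of the `L`-scheme, started from different complementary pressures. -/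
theorem errorBounds_of_solvesLStep (hd : 1 ≤ d) (hbdd : Bornology.IsBounded Ω)
    (hreg : interior (closure Ω) = Ω) {𝒯 : Mesh Ω} {C : ℝ} (hC : 0 < C)
    (hdiv : ∀ w ∈ 𝒯.W, ∃ v ∈ 𝒯.V, weakDiv v = w ∧ ‖v‖ ≤ C * ‖w‖) {c : Coeffs d} {B : Consts}
    (hc : c.Admissible B) {L τ : ℝ} (hLs : (B.Ls : ℝ) ≤ L) (hL : 0 < L) (hτ : 0 < τ)
    {Θprev Θ Θ' : L2 Ω} (hΘ : Θ ∈ 𝒯.W) (hΘ' : Θ' ∈ 𝒯.W) {X Y : State Ω}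
    (hX : SolvesLStep 𝒯 c L τ Θprev Θ X) (hY : SolvesLStep 𝒯 c L τ Θprev Θ' Y)
    (hu : ∀ᵐ x ∂(volume.restrict Ω), ‖X.u x‖ ≤ B.Mu) : ErrorBounds c B C L τ Θ Θ' X Y := by
  have hs := hc.bddCont_s
  have ha := hc.bddCont_comp hc.a_lip.continuous
  have hfw := hc.bddCont_comp hc.fw_lip.continuous
  obtain ⟨⟨x1, x2, x3, x4⟩, hX1, hX2, hX3, hX4⟩ := (solvesLStep_iff hbdd hc).1 hX
  obtain ⟨⟨y1, y2, y3, y4⟩, hY1, hY2, hY3, hY4⟩ := (solvesLStep_iff hbdd hc).1 hY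
  -- Differences of products are split so that the difference of coefficients always multiplies
  -- `X.u`; `Y.u` needs no bound.
  have hsub : ∀ (f : ℝ → ℝ), BddCont f → nemMul f Θ' X.u
      = nemMul f Θ' Y.u + nemMul f Θ' (X.u - Y.u) := fun f hf => by
    rw [← nemMul_add hf, add_sub_cancel]
  have hdsub : ∀ {v v' : L2v Ω} (hv : v ∈ 𝒯.V) (hv' : v' ∈ 𝒯.V),
      weakDiv (v - v') = weakDiv v - weakDiv v' := fun {v v'} hv hv' =>
    congrArg Subtype.val ((𝒯.divL hd hreg).map_sub ⟨v, hv⟩ ⟨v', hv'⟩)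
  set es := nem c.s Θ - nem c.s Θ' with hes
  let eΘ : 𝒯.Wsub := ⟨X.Θ - Y.Θ, 𝒯.Wsub.sub_mem x1 y1⟩
  let eΘ' : 𝒯.Wsub := ⟨Θ - Θ', 𝒯.Wsub.sub_mem hΘ hΘ'⟩
  let ep : 𝒯.Wsub := ⟨X.p - Y.p, 𝒯.Wsub.sub_mem x3 y3⟩
  let eq : 𝒯.Vsub := ⟨X.q - Y.q, 𝒯.Vsub.sub_mem x2 y2⟩
  let eu : 𝒯.Vsub := ⟨X.u - Y.u, 𝒯.Vsub.sub_mem x4 y4⟩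
  set za := nemMul (c.a ∘ c.s) Θ X.u - nemMul (c.a ∘ c.s) Θ' X.u
    + (nem (c.f3 ∘ c.s) Θ - nem (c.f3 ∘ c.s) Θ') with hza
  set zw := nemMul (c.fw ∘ c.s) Θ X.u - nemMul (c.fw ∘ c.s) Θ' X.u
    + nemMul (c.fw ∘ c.s) Θ' (X.u - Y.u) + (nem (c.f1 ∘ c.s) Θ - nem (c.f1 ∘ c.s) Θ') with hzw
  have hza' : ‖za‖ ≤ ((B.Mu : ℝ) * B.La + B.Lf3) * ‖es‖ := by
    have h1 := norm_nemMul_sub_le hbdd hs ha hc.a_lip Θ Θ' hu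
    have h2 := norm_nem_sub_le hbdd hs (hc.bddCont_comp hc.f3_lip.continuous) hc.f3_lip Θ Θ'
    have h3 := norm_add_le (nemMul (c.a ∘ c.s) Θ X.u - nemMul (c.a ∘ c.s) Θ' X.u)
      (nem (c.f3 ∘ c.s) Θ - nem (c.f3 ∘ c.s) Θ')
    rw [← hes] at h1 h2
    rw [← hza] at h3
    linarith
  have hzw' : ‖zw‖ ≤ B.Mfw * ‖eu‖ + ((B.Mu : ℝ) * B.Lfw + B.Lf1) * ‖es‖ := by
    have h1 := norm_nemMul_sub_le hbdd hs hfw hc.fw_lip Θ Θ' hu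
    have h2 := norm_nem_sub_le hbdd hs (hc.bddCont_comp hc.f1_lip.continuous) hc.f1_lip Θ Θ'
    have h3 := norm_nemMul_le hfw (fun y => hc.fw_bdd (c.s y)) Θ' (X.u - Y.u)
    have h4 := norm_add₃_le (a := nemMul (c.fw ∘ c.s) Θ X.u - nemMul (c.fw ∘ c.s) Θ' X.u)
      (b := nemMul (c.fw ∘ c.s) Θ' (X.u - Y.u)) (c := nem (c.f1 ∘ c.s) Θ - nem (c.f1 ∘ c.s) Θ')
    rw [← hes] at h1 h2
    rw [← hzw] at h4
    change ‖zw‖ ≤ B.Mfw * ‖X.u - Y.u‖ + _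
    linarith
  have hdivu : ‖weakDiv (X.u - Y.u)‖ ≤ B.Lf2 * ‖es‖ := by
    -- The divergence of the error is itself piecewise constant, so it is admissible as a test
    -- function.
    have hmem := 𝒯.weakDiv_mem hd hreg eu.2
    have h1 := hX3 _ hmem
    have h2 := hY3 _ hmem
    have h3 : ‖weakDiv (X.u - Y.u)‖ ^ 2
        = inner ℝ (nem (c.f2 ∘ c.s) Θ - nem (c.f2 ∘ c.s) Θ') (weakDiv (X.u - Y.u)) := by
      rw [← real_inner_self_eq_norm_sq]
      nth_rewrite 1 [hdsub x4 y4]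
      rw [inner_sub_left, inner_sub_left]
      exact congrArg₂ _ h1 h2
    have h4 := norm_nem_sub_le hbdd hs (hc.bddCont_comp hc.f2_lip.continuous) hc.f2_lip Θ Θ'
    refine le_trans ?_ h4
    have h5 := real_inner_le_norm (nem (c.f2 ∘ c.s) Θ - nem (c.f2 ∘ c.s) Θ')
      (weakDiv (X.u - Y.u))
    rw [← h3, sq] at h5
    rcases (norm_nonneg (weakDiv (X.u - Y.u))).eq_or_lt with h0 | hpos
    · rw [← h0]; exact norm_nonneg _
    · exact le_of_mul_le_mul_right h5 hpos
  have hrho : ‖es‖ ^ 2 ≤ L * inner ℝ es (Θ - Θ') := by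
    have h1 := norm_nem_sub_sq_le hbdd hs hc.s_mono hc.s_lip Θ Θ'
    rw [← hes] at h1
    -- Replacing the Lipschitz constant by `L` needs this sign. A negative value would force `es =
    -- 0` by `h1`, hence the value zero.
    have h2 : 0 ≤ inner ℝ es (Θ - Θ') := by
      by_contra! hneg
      have h3 : (B.Ls : ℝ) * inner ℝ es (Θ - Θ') ≤ 0 :=
        mul_nonpos_of_nonneg_of_nonpos B.Ls.2 hneg.le
      have h4 : es = 0 := by
        rw [← norm_eq_zero]
        exact pow_eq_zero_iff two_ne_zero |>.1 (le_antisymm (h1.trans h3) (sq_nonneg _))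
      rw [h4, inner_zero_left] at hneg
      exact lt_irrefl _ hneg
    exact h1.trans (mul_le_mul_of_nonneg_right hLs h2)
  have habs : ∀ (z : L2v Ω) (v : 𝒯.Vsub), |inner ℝ z v.1| ≤ ‖z‖ * ‖v‖ :=
    fun z v => abs_real_inner_le_norm z v.1
  obtain ⟨b1, b2, b3, b4⟩ := mixed_error_bounds (D := 𝒯.divL hd hreg) hC
    (fun w => by
      obtain ⟨v, hv, hvw, hvn⟩ := hdiv w.1 w.2
      exact ⟨⟨v, hv⟩, Subtype.ext hvw, hvn⟩)
    hc.aLow_pos hc.aUp_pos hL hτ (norm_nonneg es) (eΘ := eΘ) (eΘ' := eΘ') (ep := ep) (eq := eq)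
    (eu := eu) (a := fun v => inner ℝ (nemMul (c.a ∘ c.s) Θ' (X.u - Y.u)) v.1)
    (δ := fun v => inner ℝ za v.1) (γ := fun v => inner ℝ zw v.1)
    (ρ := (innerₗ (L2 Ω) es).comp 𝒯.Wsub.subtype)
    (fun v => (habs _ v).trans (mul_le_mul_of_nonneg_right
      (norm_nemMul_le ha (fun y => abs_le.2 ⟨by
        have := hc.a_ge (c.s y)
        have := hc.aLow_pos
        have := hc.aUp_pos
        simp only [Function.comp_apply]
        linarith, hc.a_le _⟩) Θ' _) (norm_nonneg _)))
    (le_inner_nemMul ha (fun y => hc.a_ge _) Θ' _)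
    (fun v => (habs _ v).trans (mul_le_mul_of_nonneg_right hza' (norm_nonneg _)))
    (fun v => by
      have h1 := hX4 v.1 v.2
      have h2 := hY4 v.1 v.2
      change inner ℝ (nemMul (c.a ∘ c.s) Θ' (X.u - Y.u)) v.1
        - inner ℝ (X.p - Y.p) (weakDiv v.1) + inner ℝ za v.1 = 0
      rw [hza, hsub _ ha]
      simp only [inner_add_left, inner_sub_left] at h1 h2 ⊢
      linarith)
    hdivu
    (fun v => (habs _ v).trans (mul_le_mul_of_nonneg_right hzw' (norm_nonneg _)))
    (fun v => by
      have h1 := hX2 v.1 v.2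
      have h2 := hY2 v.1 v.2
      change inner ℝ (X.q - Y.q) v.1 - inner ℝ (X.Θ - Y.Θ) (weakDiv v.1) = inner ℝ zw v.1
      rw [hzw, hsub _ hfw]
      simp only [inner_add_left, inner_sub_left] at h1 h2 ⊢
      linarith)
    (fun w => abs_real_inner_le_norm es w.1)
    hrho
    (fun w => by
      have h1 := hX1 w.1 w.2
      have h2 := hY1 w.1 w.2
      change L * inner ℝ (X.Θ - Y.Θ - (Θ - Θ')) w.1 + inner ℝ es w.1
        + τ * inner ℝ (weakDiv (X.q - Y.q)) w.1 = 0
      rw [hes, hdsub x2 y2]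
      simp only [inner_sub_left] at h1 h2 ⊢
      linarith)
  have hS : satDistSq c Θ Θ' = ‖es‖ ^ 2 := satDistSq_eq hbdd hs Θ Θ'
  refine ⟨?_, ?_, ?_, ?_, ?_⟩ <;> rw [hS]
  · exact b1
  · rw [← mul_pow]
    exact pow_le_pow_left₀ (norm_nonneg _) hdivu 2
  · exact b2
  · exact b3
  · exact b4

/-! ### Convergence of the scheme -/

/-- A sequence whose squared increments contract is a Cauchy sequence. -/
theorem cauchySeq_of_sq_contraction {E : Type*} [NormedAddCommGroup E] {r : ℝ} (hr : 0 ≤ r)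
    (hr1 : r < 1) {x : ℕ → E}
    (h : ∀ i, ‖x (i + 2) - x (i + 1)‖ ^ 2 ≤ r * ‖x (i + 1) - x i‖ ^ 2) : CauchySeq x := by
  have hstep : ∀ i, ‖x (i + 1) - x i‖ ≤ ‖x 1 - x 0‖ * √r ^ i := fun i => by
    induction i with
    | zero => simp
    | succ i ih =>
      have h1 : ‖x (i + 2) - x (i + 1)‖ ≤ √r * ‖x (i + 1) - x i‖ := by
        refine abs_le_of_sq_le_sq' ?_ (by positivity) |>.2
        rw [mul_pow, Real.sq_sqrt hr]
        exact h i
      calc ‖x (i + 2) - x (i + 1)‖ ≤ √r * ‖x (i + 1) - x i‖ := h1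
        _ ≤ √r * (‖x 1 - x 0‖ * √r ^ i) := mul_le_mul_of_nonneg_left ih (Real.sqrt_nonneg r)
        _ = _ := by ring
  refine cauchySeq_of_le_geometric (√r) ‖x 1 - x 0‖ ?_ fun i => ?_
  · rw [Real.sqrt_lt' one_pos]
    simpa using hr1
  · rw [dist_comm, dist_eq_norm]
    exact hstep i

theorem tendsto_of_norm_sub_sq_le {E : Type*} [NormedAddCommGroup E] {x : ℕ → E} {y : E}
    {b : ℕ → ℝ} (hb : Tendsto b atTop (𝓝 0)) (h : ∀ i, ‖x (i + 1) - y‖ ^ 2 ≤ b i) :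
    Tendsto x atTop (𝓝 y) := by
  rw [← tendsto_add_atTop_iff_nat 1, tendsto_iff_norm_sub_tendsto_zero]
  have h1 : Tendsto (fun i => √(b i)) atTop (𝓝 0) := by
    simpa using hb.sqrt
  exact squeeze_zero (fun i => norm_nonneg _) (fun i => Real.le_sqrt_of_sq_le (h i)) h1

theorem satDistSq_nonneg (c : Coeffs d) (Θ Θ' : L2 Ω) : 0 ≤ satDistSq c Θ Θ' :=
  integral_nonneg fun _ => sq_nonneg _

/-- The contraction estimate without the term of the saturations. -/
theorem ErrorBounds.contraction' {c : Coeffs d} {B : Consts} {C L τ : ℝ} (hC : 0 < C) (hL : 0 < L)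
    (hτ : 0 < τ) (hK : τ * (L * B.K C) ≤ 1) {Θ Θ' : L2 Ω} {X Y : State Ω}
    (h : ErrorBounds c B C L τ Θ Θ' X Y) :
    ‖X.Θ - Y.Θ‖ ^ 2 + 3 * C ^ 2 * τ / (2 * (3 * C ^ 2 * L + τ)) * ‖X.q - Y.q‖ ^ 2
      ≤ 3 * C ^ 2 * L / (3 * C ^ 2 * L + τ) * ‖Θ - Θ'‖ ^ 2 := by
  have h1 : 0 ≤ 1 - τ * L * B.K C := by
    rw [mul_assoc]
    linarith
  have h2 : 0 ≤ 3 * C ^ 2 * (1 - τ * L * B.K C) / (L * (3 * C ^ 2 * L + τ))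
      * satDistSq c Θ Θ' := mul_nonneg (by positivity) (satDistSq_nonneg c Θ Θ')
  linarith [h.contraction]

theorem satDistSq_le (hbdd : Bornology.IsBounded Ω) {c : Coeffs d} {B : Consts}
    (hc : c.Admissible B) (Θ Θ' : L2 Ω) :
    satDistSq c Θ Θ' ≤ (B.Ls : ℝ) ^ 2 * ‖Θ - Θ'‖ ^ 2 := by
  rw [satDistSq_eq hbdd hc.bddCont_s, ← mul_pow]
  refine pow_le_pow_left₀ (norm_nonneg _) (Lp.norm_le_mul_norm_of_ae_le_mul ?_) 2
  filter_upwards [nem_coe hbdd hc.bddCont_s Θ, nem_coe hbdd hc.bddCont_s Θ',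
    Lp.coeFn_sub (nem c.s Θ) (nem c.s Θ'), Lp.coeFn_sub Θ Θ'] with x h1 h2 h3 h4
  rw [h3, h4, Pi.sub_apply, Pi.sub_apply, h1, h2]
  exact hc.s_lip.norm_sub_le _ _

/-- The iterates of the `L`-scheme converge to a solution of the nonlinear problem. -/
theorem exists_limit (hd : 1 ≤ d) (hbdd : Bornology.IsBounded Ω)
    (hreg : interior (closure Ω) = Ω) {𝒯 : Mesh Ω} {C : ℝ} (hC : 0 < C)
    (hdiv : ∀ w ∈ 𝒯.W, ∃ v ∈ 𝒯.V, weakDiv v = w ∧ ‖v‖ ≤ C * ‖w‖) {c : Coeffs d} {B : Consts}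
    (hc : c.Admissible B) {L τ : ℝ} (hLs : (B.Ls : ℝ) ≤ L) (hL : 0 < L) (hτ : 0 < τ)
    (hK : τ * (L * B.K C) ≤ 1) {Θprev : L2 Ω} {X : ℕ → State Ω} (hmem : ∀ i, (X i).Θ ∈ 𝒯.W)
    (hX : ∀ i, SolvesLStep 𝒯 c L τ Θprev (X i).Θ (X (i + 1)))
    (hu : ∀ i, ∀ᵐ x ∂(volume.restrict Ω), ‖(X (i + 1)).u x‖ ≤ B.Mu) :
    ∃ Y : State Ω, SolvesNonlinear 𝒯 c τ Θprev Y ∧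
      Tendsto (fun i => (X i).Θ) atTop (𝓝 Y.Θ) ∧ Tendsto (fun i => (X i).q) atTop (𝓝 Y.q) ∧
      Tendsto (fun i => (X i).p) atTop (𝓝 Y.p) ∧ Tendsto (fun i => (X i).u) atTop (𝓝 Y.u) ∧
      ∀ i, ErrorBounds c B C L τ (X i).Θ Y.Θ (X (i + 1)) Y := by
  set r := 3 * C ^ 2 * L / (3 * C ^ 2 * L + τ) with hr
  set k := 3 * C ^ 2 * τ / (2 * (3 * C ^ 2 * L + τ)) with hk
  have hk0 : 0 < k := by positivity
  have hr0 : 0 ≤ r := by positivity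
  have hr1 : r < 1 := by
    rw [hr, div_lt_one (by positivity)]
    linarith
  have hcauchy : CauchySeq fun i => (X i).Θ := by
    refine cauchySeq_of_sq_contraction hr0 hr1 fun i => ?_
    have h := (errorBounds_of_solvesLStep hd hbdd hreg hC hdiv hc hLs hL hτ (hmem _) (hmem _)
      (hX (i + 1)) (hX i) (hu (i + 1))).contraction' hC hL hτ hK
    have h0 : 0 ≤ k * ‖(X (i + 2)).q - (X (i + 1)).q‖ ^ 2 := by positivity
    exact (le_add_of_nonneg_right h0).trans h
  obtain ⟨Θ, hΘ⟩ := cauchySeq_tendsto_of_complete hcauchy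
  -- The discrete space is finite dimensional, as the image of `V_h` under the divergence, and
  -- therefore closed.
  have hΘW : Θ ∈ 𝒯.W := by
    have hfinV := 𝒯.finiteDimensional_Vsub hreg hbdd
    have hfinW : FiniteDimensional ℝ 𝒯.Wsub :=
      Module.Finite.of_surjective (𝒯.divL hd hreg) fun w => by
        obtain ⟨v, hv, hvw, -⟩ := hdiv w.1 w.2
        exact ⟨⟨v, hv⟩, Subtype.ext hvw⟩
    exact (𝒯.Wsub.closed_of_finiteDimensional).mem_of_tendsto hΘ (Eventually.of_forall hmem)
  -- The candidate is the step started from the limit. The iterates converge to it by the error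
  -- bounds, so its `Θ` component is the limit itself and `Y` is a fixed point of the scheme.
  obtain ⟨Y, hY, -⟩ := existsUnique_solvesLStep hd hbdd hreg
    (fun w hw => by obtain ⟨v, hv, hvw, -⟩ := hdiv w hw; exact ⟨v, hv, hvw⟩) hc hL hτ Θprev Θ
  have herr : ∀ i, ErrorBounds c B C L τ (X i).Θ Θ (X (i + 1)) Y := fun i =>
    errorBounds_of_solvesLStep hd hbdd hreg hC hdiv hc hLs hL hτ (hmem i) hΘW (hX i) hY (hu i)
  have hE : Tendsto (fun i => ‖(X i).Θ - Θ‖ ^ 2) atTop (𝓝 0) := by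
    simpa using (tendsto_iff_norm_sub_tendsto_zero.1 hΘ).pow 2
  have hscale : ∀ b : ℝ, Tendsto (fun i => b * ‖(X i).Θ - Θ‖ ^ 2) atTop (𝓝 0) := fun b => by
    simpa using hE.const_mul b
  have hS : Tendsto (fun i => satDistSq c (X i).Θ Θ) atTop (𝓝 0) :=
    squeeze_zero (fun i => satDistSq_nonneg c _ _) (fun i => satDistSq_le hbdd hc _ _) (hscale _)
  have hYΘ : Y.Θ = Θ := by
    refine tendsto_nhds_unique (tendsto_of_norm_sub_sq_le (hscale r) fun i => ?_) hΘ
    have h0 : 0 ≤ k * ‖(X (i + 1)).q - Y.q‖ ^ 2 := by positivity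
    exact (le_add_of_nonneg_right h0).trans ((herr i).contraction' hC hL hτ hK)
  have hq : Tendsto (fun i => (X i).q) atTop (𝓝 Y.q) := by
    refine tendsto_of_norm_sub_sq_le (hscale (r / k)) fun i => ?_
    have h := (herr i).contraction' hC hL hτ hK
    rw [← hk, ← hr] at h
    rw [div_mul_eq_mul_div, le_div_iff₀ hk0]
    nlinarith [sq_nonneg ‖(X (i + 1)).Θ - Y.Θ‖]
  have hp : Tendsto (fun i => (X i).p) atTop (𝓝 Y.p) :=
    tendsto_of_norm_sub_sq_le (by simpa using hS.const_mul (B.C2 C)) fun i => (herr i).p_bound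
  have huc : Tendsto (fun i => (X i).u) atTop (𝓝 Y.u) :=
    tendsto_of_norm_sub_sq_le (by simpa using hS.const_mul (B.C1 C)) fun i => (herr i).u_bound
  subst hYΘ
  exact ⟨Y, hY.solvesNonlinear hbdd hc, hΘ, hq, hp, huc, herr⟩

end TwoPhase

end

/-! ### Well-posedness and linear convergence of the `L`-scheme. -/

theorem mainTheorem2 {d : ℕ} (hd : 1 ≤ d) (Ω : Set (TwoPhase.Pt d))
    (hbdd : Bornology.IsBounded Ω) (hreg : interior (closure Ω) = Ω) (σ : ℝ) :
    ∃ C : ℝ, 0 < C ∧ ∀ 𝒯 : TwoPhase.Mesh Ω, 𝒯.ShapeRegular σ →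
      -- `C` is a stability constant of the divergence, uniformly over the meshes
      (∀ w ∈ 𝒯.W, ∃ v ∈ 𝒯.V, TwoPhase.weakDiv v = w ∧ ‖v‖ ≤ C * ‖w‖) ∧
      ∀ (c : TwoPhase.Coeffs d) (B : TwoPhase.Consts), c.Admissible B →
      ∀ (L τ : ℝ), (B.Ls : ℝ) ≤ L → 0 < L → 0 < τ → τ * (L * B.K C) ≤ 1 →
      ∀ Θprev : TwoPhase.L2 Ω,
        -- every step of the scheme is uniquely solvable
        (∀ Θold ∈ 𝒯.W, ∃! X : TwoPhase.State Ω,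
          TwoPhase.SolvesLStep 𝒯 c L τ Θprev Θold X) ∧
        -- any sequence of iterates with bounded total fluxes converges linearly
        ∀ X : ℕ → TwoPhase.State Ω, (X 0).Θ ∈ 𝒯.W →
          (∀ i, TwoPhase.SolvesLStep 𝒯 c L τ Θprev (X i).Θ (X (i + 1))) →
          (∀ i, ∀ᵐ x ∂(volume.restrict Ω), ‖(X (i + 1)).u x‖ ≤ B.Mu) →
          -- bounds for the increments of the iteration
          (∀ i, TwoPhase.ErrorBounds c B C L τ (X (i + 1)).Θ (X i).Θ (X (i + 2)) (X (i + 1))) ∧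
          (∀ i, ‖(X (i + 2)).Θ - (X (i + 1)).Θ‖ ^ 2
              + 3 * C ^ 2 * τ / (2 * (3 * C ^ 2 * L + τ)) * ‖(X (i + 2)).q - (X (i + 1)).q‖ ^ 2
            ≤ 3 * C ^ 2 * L / (3 * C ^ 2 * L + τ) * ‖(X (i + 1)).Θ - (X i).Θ‖ ^ 2) ∧
          -- the limit exists, solves the nonlinear problem, and is approached linearly
          ∃ Y : TwoPhase.State Ω, TwoPhase.SolvesNonlinear 𝒯 c τ Θprev Y ∧
            Tendsto (fun i => (X i).Θ) atTop (𝓝 Y.Θ) ∧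
            Tendsto (fun i => (X i).q) atTop (𝓝 Y.q) ∧
            Tendsto (fun i => (X i).p) atTop (𝓝 Y.p) ∧
            Tendsto (fun i => (X i).u) atTop (𝓝 Y.u) ∧
            (∀ i, TwoPhase.ErrorBounds c B C L τ (X i).Θ Y.Θ (X (i + 1)) Y) ∧
            (∀ i, ‖(X (i + 1)).Θ - Y.Θ‖ ^ 2
                + 3 * C ^ 2 * τ / (2 * (3 * C ^ 2 * L + τ)) * ‖(X (i + 1)).q - Y.q‖ ^ 2
              ≤ 3 * C ^ 2 * L / (3 * C ^ 2 * L + τ) * ‖(X i).Θ - Y.Θ‖ ^ 2) := by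
  obtain ⟨C, hC, hstab⟩ := TwoPhase.exists_stability_constant hd Ω hbdd hreg σ
  refine ⟨C, hC, fun 𝒯 h𝒯 => ⟨hstab 𝒯 h𝒯, fun c B hc L τ hLs hL hτ hK Θprev =>
    ⟨fun Θold _ => TwoPhase.existsUnique_solvesLStep hd hbdd hreg (fun w hw => ?_) hc hL hτ
      Θprev Θold, fun X hX0 hX hu => ?_⟩⟩⟩
  · obtain ⟨v, hv, hvw, -⟩ := hstab 𝒯 h𝒯 w hw
    exact ⟨v, hv, hvw⟩
  · have hmem : ∀ i, (X i).Θ ∈ 𝒯.W := fun i => by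
      cases i with
      | zero => exact hX0
      | succ i => exact (hX i).1.1
    -- Only the `Θ` component of `X 0` is initial data, so increments of all four components are
    -- compared from `X 2 - X 1` on; the later step supplies the bounded flux.
    have herr := fun i => TwoPhase.errorBounds_of_solvesLStep hd hbdd hreg hC (hstab 𝒯 h𝒯) hc hLs
      hL hτ (hmem _) (hmem _) (hX (i + 1)) (hX i) (hu (i + 1))
    obtain ⟨Y, hY, hΘ, hq, hp, hu', hYerr⟩ := TwoPhase.exists_limit hd hbdd hreg hC (hstab 𝒯 h𝒯)
      hc hLs hL hτ hK hmem hX hu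
    exact ⟨herr, fun i => (herr i).contraction' hC hL hτ hK, Y, hY, hΘ, hq, hp, hu', hYerr,
      fun i => (hYerr i).contraction' hC hL hτ hK⟩
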